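/- Notation. Write $e(x)=e^{2\pi i x}$, $q=e(\tau)$, $\tau\in\mathbb H$ (the upper half-plane), $\eta(\tau)=q^{1/24}\prod_{m\ge1}(1-q^m)$, and $\vartheta(\tau,z)=\sum_{r\in\mathbb Z}\left(\frac{-4}{r}\right)q^{r^2/8}e(rz/2)$. Let $(L,\beta)$ be an integral lattice of rank $n$, i.e. $L$ is a free $\mathbb Z$-module of rank $n$ and $\beta:L\times L\to\mathbb Z$ is a symmetric non-degenerate bilinear form; extend $\beta$ bilinearly to $\mathbb Q\otimes L$ and $\mathbb C\otimes L$ and put $\beta(x)=\frac12\beta(x,x)$. Let $L^\sharp=\{y\in\mathbb Q\otimes L:\beta(y,x)\in\mathbb Z\ \forall x\in L\}$ be the dual, $L_{ev}=\{x\in L:\beta(x)\in\mathbb Z\}$, and let $L^\bullet=\{r\in\mathbb Q\otimes L:\beta(x)\equiv\beta(r,x)\bmod\mathbb Z\ \forall x\in L\}$ be the shadow. A eutactic star of rank $N$ on $(L,\beta)$ is a family $s=(s_1,\dots,s_N)$ of non-zero vectors of $L^\sharp$ with $x=\sum_{j=1}^N\beta(s_j,x)s_j$ for all $x\in\mathbb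 Q\otimes L$. Let $G$ be a subgroup of the orthogonal group $O(L,\beta)$ that leaves $s$ invariant up to signs: for every $g\in G$ there are a permutation $\sigma$ of $\{1,\dots,N\}$ and signs $\epsilon_j\in\{\pm1\}$ with $gs_j=\epsilon_js_{\sigma(j)}$ for all $j$; put $\mathrm{sn}(g)=\prod_j\epsilon_j$ (this does not depend on the choice of $\sigma$ and $\epsilon$). The star $s$ is called $G$-extremal if there is exactly one $G$-orbit in $L^\bullet/L_{ev}$ whose elements have their stabilizers (in $G$) contained in the kernel of $\mathrm{sn}$. For an integer $h$ and $k\in\frac h2+\mathbb Z$, a Jacobi form of weight $k$, index $(L,\beta)$ and character $\varepsilon^h$ is a holomorphic function $\phi(\tau,z)$ on $\mathbb H\times(\mathbb C\otimes L)$ such that (i) $\phi\left(A\tau,\frac z{c\tau+d}\right)=e\left(\frac{c\beta(z)}{c\tau+d}\right)(c\tau+d)^{k-h/2}\,\frac{\eta(A\tau)^h}{\eta(\tau)^h}\,\phi(\tau,z)$ for all $A=\begin{pmatrix}a&b\\c&d\end{pmatrix}\in SL_2(\mathbb Z)$; (ii) $\phi(\tau,z+x\tau+y)=e(\beta(x+y))\,e(-\tau\beta(x)-\beta(x,z))\,\phi(\tau,z)$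 for all $x,y\in L$; (iii) $\phi$ has a Fourier expansion $\phi(\tau,z)=\sum_{m\in\frac h{24}+\mathbb Z}\ \sum_{r\in L^\bullet,\ m\ge\beta(r)}c(m,r)\,q^m\,e(\beta(r,z))$. Theorem. Let $(L,\beta)$ be an integral lattice of rank $n$ and let $s$ be a $G$-extremal eutactic star of rank $N$ on it. Then $G$ is finite, and there are a constant $\gamma\in\mathbb C$ and a vector $w\in L^\bullet$ such that, for all $\tau\in\mathbb H$ and $z\in\mathbb C\otimes L$, $$\eta(\tau)^{n-N}\prod_{j=1}^N\vartheta\big(\tau,\beta(s_j,z)\big)=\gamma\sum_{x\in w+L_{ev}}q^{\beta(x)}\sum_{g\in G}\mathrm{sn}(g)\,e\big(\beta(gx,z)\big),$$ where the series on the right converges absolutely. Moreover, the function on the left-hand side is a Jacobi form of weight $n/2$, index $(L,\beta)$ and character $\varepsilon^{n+2N}$. -/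

import Mathlib

open scoped TensorProduct BigOperators
open UpperHalfPlane (ofComplex)

noncomputable section

namespace LatticeJacobi

/-! ### Integral lattices

Throughout, `L` is an abelian group (free of finite rank in the theorem) with an integral bilinear
form `β`.  The rational and complex extensions of `(L, β)` are `ℚ ⊗ L` and `ℂ ⊗ L` with the
base-changed forms. -/

section Lattice

variable {L : Type*} [AddCommGroup L]

/-- `(L, β)` is an integral lattice: `L` is a free `ℤ`-module of finite rank and `β` is a symmetric
non-degenerate bilinear form with values in `ℤ`. -/
structure IsIntegralLattice (β : LinearMap.BilinForm ℤ L) : Prop where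
  free : Module.Free ℤ L
  finite : Module.Finite ℤ L
  symm : β.IsSymm
  nondegenerate : β.Nondegenerate

/-- The canonical map `L → ℚ ⊗ L`, `x ↦ 1 ⊗ x`. -/
def toRat : L →+ ℚ ⊗[ℤ] L := (TensorProduct.mk ℤ ℚ L 1).toAddMonoidHom

/-- The canonical map `ℚ ⊗ L → ℂ ⊗ L`. -/
def ratToComplex : ℚ ⊗[ℤ] L →ₗ[ℤ] ℂ ⊗[ℤ] L :=
  LinearMap.rTensor L (algebraMap ℚ ℂ).toAddMonoidHom.toIntLinearMap

/-- The bilinear extension of `β` to `ℚ ⊗ L`. -/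
def bilinQ (β : LinearMap.BilinForm ℤ L) : LinearMap.BilinForm ℚ (ℚ ⊗[ℤ] L) :=
  LinearMap.BilinForm.baseChange ℚ β

/-- The (complex bilinear) extension of `β` to `ℂ ⊗ L`. -/
def bilinC (β : LinearMap.BilinForm ℤ L) : LinearMap.BilinForm ℂ (ℂ ⊗[ℤ] L) :=
  LinearMap.BilinForm.baseChange ℂ β

/-- `β(x) = β(x, x) / 2` on `ℚ ⊗ L`. -/
def quadQ (β : LinearMap.BilinForm ℤ L) (x : ℚ ⊗[ℤ] L) : ℚ := bilinQ β x x / 2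

/-- `β(z) = β(z, z) / 2` on `ℂ ⊗ L`. -/
def quadC (β : LinearMap.BilinForm ℤ L) (z : ℂ ⊗[ℤ] L) : ℂ := bilinC β z z / 2

/-- `β(r, z)` for `r ∈ ℚ ⊗ L` and `z ∈ ℂ ⊗ L`. -/
def pairing (β : LinearMap.BilinForm ℤ L) (r : ℚ ⊗[ℤ] L) (z : ℂ ⊗[ℤ] L) : ℂ :=
  bilinC β (ratToComplex r) z

/-- The dual `L^♯` of `L` in `ℚ ⊗ L`. -/
def dualLattice (β : LinearMap.BilinForm ℤ L) : Set (ℚ ⊗[ℤ] L) :=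
  {y | ∀ x : L, ∃ m : ℤ, bilinQ β y (toRat x) = m}

/-- The sublattice `L_ev` of all `x ∈ L` for which `β(x) = β(x, x) / 2` is an integer. -/
def evenSublattice (β : LinearMap.BilinForm ℤ L) (hβ : β.IsSymm) : AddSubgroup L where
  carrier := {x | Even (β x x)}
  zero_mem' := by simp
  add_mem' := by
    intro x y hx hy
    have h : β (x + y) (x + y) = β x x + β y y + 2 * β x y := by
      have hxy : β y x = β x y := hβ.eq y x
      simp only [map_add, LinearMap.add_apply]
      rw [hxy]; ring
    change Even (β (x + y) (x + y))
    rw [h]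
    exact (Even.add hx hy).add (even_two_mul _)
  neg_mem' := by
    intro x hx
    change Even (β (-x) (-x))
    simpa using (show Even (β x x) from hx)

/-- The image of `L_ev` in `ℚ ⊗ L`. -/
def evenSublatticeQ (β : LinearMap.BilinForm ℤ L) (hβ : β.IsSymm) : AddSubgroup (ℚ ⊗[ℤ] L) :=
  (evenSublattice β hβ).map toRat

/-- The shadow `L^•` of the lattice: all `r ∈ ℚ ⊗ L` with `β(x) ≡ β(r, x) mod ℤ` for `x ∈ L`. -/
def shadow (β : LinearMap.BilinForm ℤ L) : Set (ℚ ⊗[ℤ] L) :=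
  {r | ∀ x : L, ∃ m : ℤ, quadQ β (toRat x) - bilinQ β r (toRat x) = m}

/-- The orthogonal group `O(L, β)`. -/
def orthogonalGroup (β : LinearMap.BilinForm ℤ L) : Subgroup (L ≃ₗ[ℤ] L) where
  carrier := {g | ∀ x y, β (g x) (g y) = β x y}
  one_mem' := by intro x y; rfl
  mul_mem' := by
    intro g h hg hh x y
    rw [LinearEquiv.mul_apply, LinearEquiv.mul_apply, hg, hh]
  inv_mem' := by
    intro g hg x y
    have := hg (g⁻¹ x) (g⁻¹ y)
    rw [← this, ← LinearEquiv.mul_apply, ← LinearEquiv.mul_apply, mul_inv_cancel]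
    rfl

/-- The action of an automorphism of `L` on `ℚ ⊗ L`. -/
def actQ (g : L ≃ₗ[ℤ] L) : ℚ ⊗[ℤ] L →ₗ[ℚ] ℚ ⊗[ℤ] L :=
  LinearMap.baseChange ℚ (g : L →ₗ[ℤ] L)

end Lattice

/-! ### Eutactic stars and extremality -/

section Star

variable {L : Type*} [AddCommGroup L] {N : ℕ}

/-- A eutactic star of rank `N` on `(L, β)`. -/
structure IsEutacticStar (β : LinearMap.BilinForm ℤ L) (s : Fin N → ℚ ⊗[ℤ] L) : Prop where
  ne_zero : ∀ j, s j ≠ 0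
  mem_dual : ∀ j, s j ∈ dualLattice β
  eutactic : ∀ x : ℚ ⊗[ℤ] L, x = ∑ j, bilinQ β (s j) x • s j

/-- `g s_j = ε_j s_{σ(j)}` for all `j`. -/
def IsSignedPerm (s : Fin N → ℚ ⊗[ℤ] L) (g : L ≃ₗ[ℤ] L) (σ : Equiv.Perm (Fin N))
    (ε : Fin N → ℤˣ) : Prop :=
  ∀ j, actQ g (s j) = ((ε j : ℤˣ) : ℤ) • s (σ j)

/-- `g` leaves the family `s` invariant up to signs. -/
def PreservesUpToSigns (s : Fin N → ℚ ⊗[ℤ] L) (g : L ≃ₗ[ℤ] L) : Prop :=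
  ∃ (σ : Equiv.Perm (Fin N)) (ε : Fin N → ℤˣ), IsSignedPerm s g σ ε

open Classical in
/-- `sn(g) = ∏ ε_j` if `g s_j = ε_j s_{σ(j)}` for all `j`.  The value does not depend on the choice
of `σ` and `ε`, see `sn_eq`; it is set to `1` if `g` does not preserve `s` up to signs. -/
def sn (s : Fin N → ℚ ⊗[ℤ] L) (g : L ≃ₗ[ℤ] L) : ℤˣ :=
  if h : PreservesUpToSigns s g then ∏ j, h.choose_spec.choose j else 1

/-- `sn` is well defined. -/
theorem sn_eq {s : Fin N → ℚ ⊗[ℤ] L} (hs : ∀ j, s j ≠ 0) {g : L ≃ₗ[ℤ] L}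
    {σ : Equiv.Perm (Fin N)} {ε : Fin N → ℤˣ} (h : IsSignedPerm s g σ ε) :
    sn s g = ∏ j, ε j := by
  classical
  -- an odd sign function on the non-zero vectors
  obtain ⟨sgn, hsgn⟩ : ∃ sgn : ℚ ⊗[ℤ] L → ℤˣ, ∀ v, v ≠ 0 → sgn (-v) = - sgn v := by
    let _ : LinearOrder (ℚ ⊗[ℤ] L) := linearOrderOfSTO WellOrderingRel
    refine ⟨fun v => if v < -v then 1 else -1, fun v hv => ?_⟩
    have hne : v ≠ -v := by
      intro h
      have h2 : (2 : ℚ) • v = 0 := by rw [two_smul]; exact add_eq_zero_iff_eq_neg.2 h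
      exact hv ((smul_eq_zero.1 h2).resolve_left two_ne_zero)
    rcases lt_or_gt_of_ne hne with h1 | h1
    · simp [h1, not_lt_of_gt h1]
    · simp [h1, not_lt_of_gt h1]
  have key : ∀ (σ : Equiv.Perm (Fin N)) (ε : Fin N → ℤˣ), IsSignedPerm s g σ ε →
      ∏ j, sgn (actQ g (s j)) = (∏ j, ε j) * ∏ j, sgn (s j) := by
    intro σ ε h
    rw [← Equiv.prod_comp σ (fun j => sgn (s j)), ← Finset.prod_mul_distrib]
    refine Finset.prod_congr rfl fun j _ => ?_
    rw [h j]
    rcases Int.units_eq_one_or (ε j) with h1 | h1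
    · simp [h1]
    · simp [h1, hsgn _ (hs (σ j))]
  have hg : PreservesUpToSigns s g := ⟨σ, ε, h⟩
  have e1 := key σ ε h
  have e2 := key _ _ hg.choose_spec.choose_spec
  rw [sn, dif_pos hg]
  exact mul_right_cancel (e2.symm.trans e1)

/-- The class of `r` in `(ℚ ⊗ L) / L_ev`. -/
def evenClass (β : LinearMap.BilinForm ℤ L) (hβ : β.IsSymm) (r : ℚ ⊗[ℤ] L) :
    (ℚ ⊗[ℤ] L) ⧸ evenSublatticeQ β hβ :=
  QuotientAddGroup.mk r

/-- The orbit of the class of `r` modulo `L_ev` under the group `G`. -/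
def orbit (β : LinearMap.BilinForm ℤ L) (hβ : β.IsSymm) (G : Subgroup (L ≃ₗ[ℤ] L))
    (r : ℚ ⊗[ℤ] L) : Set ((ℚ ⊗[ℤ] L) ⧸ evenSublatticeQ β hβ) :=
  {c | ∃ g ∈ G, c = evenClass β hβ (actQ g r)}

/-- The star `s` is `G`-extremal: `G` is a group of orthogonal transformations that preserve `s` up
to signs, and there is exactly one `G`-orbit `O` in `L^• / L_ev` such that the stabilizer in `G` of
every element of `O` is contained in the kernel of `sn`. -/
structure IsExtremal (β : LinearMap.BilinForm ℤ L) (hβ : β.IsSymm) (G : Subgroup (L ≃ₗ[ℤ] L))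
    (s : Fin N → ℚ ⊗[ℤ] L) : Prop where
  le_orthogonal : G ≤ orthogonalGroup β
  preserves : ∀ g ∈ G, PreservesUpToSigns s g
  existsUnique_orbit : ∃! O : Set ((ℚ ⊗[ℤ] L) ⧸ evenSublatticeQ β hβ),
    (∃ r ∈ shadow β, O = orbit β hβ G r) ∧
      ∀ r ∈ shadow β, evenClass β hβ r ∈ O →
        ∀ g ∈ G, evenClass β hβ (actQ g r) = evenClass β hβ r → sn s g = 1

end Star

/-! ### Theta functions and Jacobi forms of lattice index -/

section Jacobi

open Complex

/-- `e(x) = exp(2πix)`. -/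
def e (x : ℂ) : ℂ := Complex.exp (2 * Real.pi * I * x)

/-- The Jacobi theta function
`ϑ(τ, z) = ∑_{r ∈ ℤ} (-4/r) q^{r²/8} ζ^{r/2}`, with `q = e(τ)` and `ζ = e(z)`. -/
def theta (τ : UpperHalfPlane) (z : ℂ) : ℂ :=
  ∑' r : ℤ, (ZMod.χ₄ (r : ZMod 4) : ℂ) * e ((r : ℂ) ^ 2 / 8 * τ + (r : ℂ) / 2 * z)

/-- `c τ + d` for `A = (a b; c d)`. -/
def autFactor (A : Matrix.SpecialLinearGroup (Fin 2) ℤ) (τ : UpperHalfPlane) : ℂ :=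
  ((A 1 0 : ℤ) : ℂ) * τ + ((A 1 1 : ℤ) : ℂ)

/-- The cocycle `ε^h(A) = η(Aτ)^h / η(τ)^h`, for integral `h`. -/
def etaCocycle (h : ℤ) (A : Matrix.SpecialLinearGroup (Fin 2) ℤ) (τ : UpperHalfPlane) : ℂ :=
  ModularForm.eta ((A • τ : UpperHalfPlane) : ℂ) ^ h / ModularForm.eta (τ : ℂ) ^ h

variable {L : Type*} [AddCommGroup L]

/-- A function on `ℍ × (ℂ ⊗ L)` is holomorphic if it is so in the linear coordinates of `ℂ ⊗ L` with
respect to any basis of `L`. -/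
def IsHolomorphic (φ : UpperHalfPlane → ℂ ⊗[ℤ] L → ℂ) : Prop :=
  ∀ b : Module.Basis (Fin (Module.finrank ℤ L)) ℤ L,
    DifferentiableOn ℂ
      (fun p : ℂ × (Fin (Module.finrank ℤ L) → ℂ) => φ (ofComplex p.1) (∑ i, p.2 i ⊗ₜ[ℤ] b i))
      {p | 0 < p.1.im}

/-- `φ` is a (holomorphic) Jacobi form of weight `k`, index `(L, β)` and character `ε^h`,
where `h` is an integer and `k ≡ h/2 mod ℤ`. -/
structure IsJacobiForm (β : LinearMap.BilinForm ℤ L) (k : ℚ) (h : ℤ)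
    (φ : UpperHalfPlane → ℂ ⊗[ℤ] L → ℂ) : Prop where
  holomorphic : IsHolomorphic φ
  /-- The integer `m` is `k - h/2`. -/
  modular : ∃ m : ℤ, k - h / 2 = m ∧
    ∀ (A : Matrix.SpecialLinearGroup (Fin 2) ℤ) (τ : UpperHalfPlane) (z : ℂ ⊗[ℤ] L),
      φ (A • τ) ((autFactor A τ)⁻¹ • z) =
        e (((A 1 0 : ℤ) : ℂ) * quadC β z / autFactor A τ) * autFactor A τ ^ m *
          etaCocycle h A τ * φ τ z
  elliptic : ∀ (x y : L) (τ : UpperHalfPlane) (z : ℂ ⊗[ℤ] L),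
    φ τ (z + (τ : ℂ) ⊗ₜ[ℤ] x + (1 : ℂ) ⊗ₜ[ℤ] y) =
      e (quadQ β (toRat (x + y)) : ℚ) *
        e (-(τ : ℂ) * (quadQ β (toRat x) : ℚ) - pairing β (toRat x) z) * φ τ z
  /-- The Fourier expansion is supported on the pairs `(n, r)` with `n ∈ h/24 + ℤ`, `r ∈ L^•` and
  `n ≥ β(r)`. -/
  fourier : ∃ c : ℚ → ℚ ⊗[ℤ] L → ℂ,
    (∀ n r, c n r ≠ 0 → (∃ j : ℤ, n = h / 24 + j) ∧ r ∈ shadow β ∧ quadQ β r ≤ n) ∧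
    ∀ (τ : UpperHalfPlane) (z : ℂ ⊗[ℤ] L),
      HasSum (fun p : ℚ × (ℚ ⊗[ℤ] L) => c p.1 p.2 * e ((p.1 : ℂ) * τ) * e (pairing β p.2 z))
        (φ τ z)

/-- The summand `q^{β(x)} ∑_{g ∈ G} sn(g) e(β(gx, z))`. -/
def alternatingTerm {N : ℕ} (β : LinearMap.BilinForm ℤ L) (s : Fin N → ℚ ⊗[ℤ] L)
    (G : Subgroup (L ≃ₗ[ℤ] L)) (τ : UpperHalfPlane) (z : ℂ ⊗[ℤ] L) (x : ℚ ⊗[ℤ] L) : ℂ :=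
  e ((quadQ β x : ℚ) * (τ : ℂ)) *
    ∑ᶠ g : G, (((sn s (g : L ≃ₗ[ℤ] L) : ℤˣ) : ℤ) : ℂ) * e (pairing β (actQ g x) z)

end Jacobi

end LatticeJacobi

end

/-! Fix τ. The star gives β(x, y) = ∑ β(s_j, x) β(s_j, y), so β is positive definite, and the
quasi-periodicity factors of the functions ϑ(τ, β(s_j, z)) multiply to the elliptic law of index (L,
β) (`thetaProd_elliptic`). Since ϑ is odd, the product alternates under G by sn. In each coordinate
of an orthogonal frame of L_ev, a function with the elliptic law is a classical theta function
(`exists_eq_sum_th`); hence it equals ∑ c(r) q^{β(r)} e(β(r, z)) with c supported on L^• and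
periodic under L_ev (`IsOrthoFrame.exists_coeff`). The coefficients are unique because distinct
unitary characters are independent (`eq_zero_of_forall_tsum_mul_pow_eq_zero`). Alternation says
c(gr) = sn(g) c(r), so c vanishes on each class fixed by some g with sn(g) = -1. By extremality c
lives on one G-orbit and is determined up to a scalar: the theta block is f(τ) times the alternating
series (`IsExtremal.exists_eq_mul_alternatingSeries`).

It remains to see that f is constant. It is holomorphic and has no zeros, since for no τ does the
block vanish identically in z. Under τ ↦ -1/τ both sides acquire the same factor (-iτ)^{n/2}
e(β(z)/τ) up to a constant and a constant linear map on coefficients; comparing coefficients, f is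
multiplied by constants under S and T. The relations S² = (ST)³ = -1 make these constants sixth
roots of unity. At a generic real z₀ the series is bounded near the cusp and the block is
exponentially bounded below, so 1/f grows at most exponentially. For large K, f^{-6} Δ^K is then a
modular form of weight 12K without zeros on ℍ, hence a multiple of Δ^K
(`eq_discriminant_pow_of_ne_zero`), so f^6 and with it f are constant
(`eq_const_of_multiplicative`).

The modular and elliptic laws of the block come from those of ϑ and η, eutaxy summing the exponents.
The Fourier condition is read off the series, where only m = β(r) occurs; comparing the multipliers
under τ ↦ τ + 1 gives the class of m modulo ℤ. -/

noncomputable section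

namespace LatticeJacobi

/-! ### Independence of characters; multiplying series and separating variables. -/

section Analysis

open Filter Topology

/-- The Cesàro means of the powers of a unimodular number other than `1` tend to `0`. -/
theorem tendsto_mean_pow {w : ℂ} (hw : ‖w‖ = 1) (h1 : w ≠ 1) :
    Tendsto (fun K : ℕ => (K : ℂ)⁻¹ * ∑ k ∈ Finset.range K, w ^ k) atTop (𝓝 0) := by
  have hb : ∀ K : ℕ, ‖(K : ℂ)⁻¹ * ∑ k ∈ Finset.range K, w ^ k‖ ≤ (K : ℝ)⁻¹ * (2 / ‖w - 1‖) := by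
    intro K
    rw [geom_sum_eq h1, norm_mul, norm_inv, Complex.norm_natCast, norm_div]
    gcongr
    calc ‖w ^ K - 1‖ ≤ ‖w ^ K‖ + ‖(1 : ℂ)‖ := norm_sub_le _ _
      _ = 2 := by rw [norm_pow, hw]; norm_num
  refine squeeze_zero_norm hb ?_
  simpa using (tendsto_inv_atTop_nhds_zero_nat (𝕜 := ℝ)).mul_const (2 / ‖w - 1‖)

/-- The Cesàro means of the powers of a unimodular number are bounded by `1`. -/
theorem norm_mean_pow_le {w : ℂ} (hw : ‖w‖ = 1) (K : ℕ) :
    ‖(K : ℂ)⁻¹ * ∑ k ∈ Finset.range K, w ^ k‖ ≤ 1 := by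
  have h : ‖∑ k ∈ Finset.range K, w ^ k‖ ≤ K := by
    refine (norm_sum_le _ _).trans ?_
    simp [norm_pow, hw]
  rw [norm_mul, norm_inv, Complex.norm_natCast]
  rcases Nat.eq_zero_or_pos K with rfl | hK
  · simp
  · have : (0 : ℝ) < K := by exact_mod_cast hK
    rw [inv_mul_le_iff₀ this]
    simpa using h

/-- Distinct unitary characters of `ℕ` are independent, also for absolutely convergent series. -/
theorem eq_zero_of_forall_tsum_mul_pow_eq_zero {ι : Type*} {a : ι → ℂ} (ha : Summable a)
    {w : ι → ℂ} (hw : ∀ i, ‖w i‖ = 1) (hinj : Function.Injective w)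
    (h : ∀ k : ℕ, ∑' i, a i * w i ^ k = 0) (j : ι) : a j = 0 := by
  classical
  have hj : w j ≠ 0 := norm_ne_zero_iff.1 (by simp [hw j])
  have hn : ∀ i, ‖w i / w j‖ = 1 := fun i => by simp [hw]
  have hs : ∀ k : ℕ, Summable fun i => a i * (w i / w j) ^ k := fun k =>
    Summable.of_norm (by simpa [norm_mul, norm_pow, hw] using ha.norm)
  have hz : ∀ k : ℕ, ∑' i, a i * (w i / w j) ^ k = 0 := by
    intro k
    have : ∀ i, a i * (w i / w j) ^ k = a i * w i ^ k * (w j ^ k)⁻¹ := by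
      intro i; rw [div_pow, div_eq_mul_inv, mul_assoc]
    simp_rw [this, tsum_mul_right, h k, zero_mul]
  -- Averaging the k-th relation divided by w_j^k over k < K gives zero for each K, while as K → ∞
  -- the averages tend to a_j: only the ratio w_i/w_j = 1 survives.
  have key : ∀ K : ℕ,
      ∑' i, a i * ((K : ℂ)⁻¹ * ∑ k ∈ Finset.range K, (w i / w j) ^ k) = 0 := by
    intro K
    have : ∀ i, a i * ((K : ℂ)⁻¹ * ∑ k ∈ Finset.range K, (w i / w j) ^ k) =
        (K : ℂ)⁻¹ * ∑ k ∈ Finset.range K, a i * (w i / w j) ^ k := by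
      intro i; rw [← Finset.mul_sum]; ring
    simp_rw [this]
    rw [tsum_mul_left, Summable.tsum_finsetSum fun k _ => hs k]
    simp [hz]
  have lim : Tendsto (fun K : ℕ =>
      ∑' i, a i * ((K : ℂ)⁻¹ * ∑ k ∈ Finset.range K, (w i / w j) ^ k)) atTop
      (𝓝 (∑' i, if i = j then a j else 0)) := by
    refine tendsto_tsum_of_dominated_convergence ha.norm ?_ (Eventually.of_forall fun K i => ?_)
    · intro i
      by_cases hij : i = j
      · subst hij
        simp only [div_self hj, one_pow, if_true]
        refine tendsto_const_nhds.congr' ?_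
        filter_upwards [eventually_gt_atTop 0] with K hK
        have : (K : ℂ) ≠ 0 := by exact_mod_cast hK.ne'
        simp [this]
      · simp only [hij, if_false]
        have h1 : w i / w j ≠ 1 := fun h => hij (hinj ((div_eq_one_iff_eq hj).1 h))
        simpa using (tendsto_mean_pow (hn i) h1).const_mul (a i)
    · rw [norm_mul]
      exact mul_le_of_le_one_right (norm_nonneg _) (norm_mean_pow_le (hn i) K)
  simp_rw [key, tsum_ite_eq] at lim
  exact (tendsto_nhds_unique lim tendsto_const_nhds)

/-- A product of absolutely convergent series as a series over tuples. -/
theorem hasSum_pi_prod {n : ℕ} {ι : Type*} (f : Fin n → ι → ℂ) (hf : ∀ i, Summable (f i)) :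
    Summable (fun m : Fin n → ι => ‖∏ i, f i (m i)‖) ∧
      HasSum (fun m : Fin n → ι => ∏ i, f i (m i)) (∏ i, ∑' k, f i k) := by
  induction n with
  | zero =>
    refine ⟨(hasSum_fintype _).summable, ?_⟩
    convert hasSum_fintype (fun m : Fin 0 → ι => ∏ i, f i (m i)) using 1
    simp
  | succ n ih =>
    obtain ⟨h1, h2⟩ := ih (fun i => f i.succ) (fun i => hf i.succ)
    have hs := summable_mul_of_summable_norm (hf 0).norm h1
    have hp := (hf 0).hasSum.mul h2 hs
    have hc := Summable.mul_norm (hf 0).norm h1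
    rw [← (Fin.consEquiv (fun _ => ι)).summable_iff, ← (Fin.consEquiv (fun _ => ι)).hasSum_iff]
    constructor
    · convert hc using 2 with p
      simp [Fin.prod_univ_succ]
    · rw [Fin.prod_univ_succ]
      refine hp.congr_fun fun p => ?_
      simp [Fin.prod_univ_succ]

/-- A finite linearly independent family of functions has a dual family of combinations of point
evaluations. -/
theorem exists_dual_evaluations {X A : Type*} [Fintype A] [DecidableEq A] (b : A → X → ℂ)
    (hb : LinearIndependent ℂ b) :
    ∃ l : A → (X →₀ ℂ), ∀ a a', ((l a).sum fun t w => w * b a' t) = if a = a' then 1 else 0 := by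
  set Φ : (X →₀ ℂ) →ₗ[ℂ] (A → ℂ) := Finsupp.linearCombination ℂ (fun t a => b a t) with hΦ
  have happ : ∀ l a', Φ l a' = l.sum fun t w => w * b a' t := by
    intro l a'
    simp [hΦ, Finsupp.linearCombination_apply, Finsupp.sum, Finset.sum_apply]
  have hsurj : LinearMap.range Φ = ⊤ := by
    -- A functional that kills every vector (b_a(t))_a has as its coordinates a linear relation
    -- between the functions b_a.
    by_contra hne
    obtain ⟨f, hf0, hf⟩ := Submodule.exists_le_ker_of_lt_top _ (lt_top_iff_ne_top.2 hne)
    have hsum : ∑ a, f (Pi.single a 1) • b a = 0 := by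
      ext t
      have h1 : f (fun a => b a t) = 0 := by
        have : (fun a => b a t) ∈ LinearMap.range Φ :=
          ⟨Finsupp.single t 1, by simp [hΦ]⟩
        exact hf this
      rw [pi_eq_sum_univ (fun a => b a t)] at h1
      rw [Pi.zero_apply, ← h1]
      simp only [map_sum, map_smul, Finset.sum_apply, Pi.smul_apply, smul_eq_mul]
      refine Finset.sum_congr rfl fun a _ => ?_
      rw [mul_comm]
      congr 2
      ext j
      simp [Pi.single_apply, eq_comm]
    have h0 := Fintype.linearIndependent_iff.1 hb _ hsum
    apply hf0
    refine LinearMap.ext fun v => ?_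
    rw [pi_eq_sum_univ v, map_sum, LinearMap.zero_apply]
    simp only [map_smul]
    refine Finset.sum_eq_zero fun a _ => ?_
    have := h0 a
    have h2 : (fun j => if a = j then (1 : ℂ) else 0) = Pi.single a 1 := by
      ext j; simp [Pi.single_apply, eq_comm]
    rw [h2, this, smul_zero]
  have hex : ∀ a, ∃ l, Φ l = Pi.single a 1 := fun a => LinearMap.range_eq_top.1 hsurj _
  choose l hl using hex
  refine ⟨l, fun a a' => ?_⟩
  rw [← happ, hl]
  simp [Pi.single_apply, eq_comm]

/-- A function of several variables whose slices in the `i`-th variable lie in the span of a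
linearly independent finite family `b i` is a combination of products of these functions. -/
theorem exists_eq_sum_prod_of_slices {n : ℕ} {X : Type*} {A : Fin n → Type*}
    [∀ i, Fintype (A i)] (b : ∀ i, A i → X → ℂ)
    (hb : ∀ i, LinearIndependent ℂ (b i)) (F : (Fin n → X) → ℂ)
    (hF : ∀ i ζ, ∃ c : A i → ℂ, ∀ t, F (Function.update ζ i t) = ∑ a, c a * b i a t) :
    ∃ c : (∀ i, A i) → ℂ, ∀ ζ, F ζ = ∑ a, c a * ∏ i, b i (a i) (ζ i) := by
  classical
  induction n with
  | zero =>
    refine ⟨fun _ => F (fun i => i.elim0), fun ζ => ?_⟩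
    simp only [Finset.univ_eq_empty, Finset.prod_empty, mul_one]
    simp [Subsingleton.elim ζ (fun i => i.elim0)]
  | succ n ih =>
    obtain ⟨l, hl⟩ := exists_dual_evaluations (b 0) (hb 0)
    -- The dual evaluations express the coefficients of the first slice as finite combinations of
    -- values of F. As functions of the remaining variables they therefore inherit the slice
    -- hypothesis, and the induction applies to them.
    have h0 : ∀ ζ' : Fin n → X, ∀ t, F (Fin.cons t ζ') =
        ∑ a, ((l a).sum fun u w => w * F (Fin.cons u ζ')) * b 0 a t := by
      intro ζ' t
      obtain ⟨c, hc⟩ := hF 0 (Fin.cons t ζ')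
      simp only [Fin.update_cons_zero] at hc
      have : ∀ a, ((l a).sum fun u w => w * F (Fin.cons u ζ')) = c a := by
        intro a
        simp only [hc, Finsupp.sum, Finset.mul_sum]
        rw [Finset.sum_comm]
        have h2 : ∀ a', ∑ u ∈ (l a).support, l a u * (c a' * b 0 a' u) =
            c a' * if a = a' then 1 else 0 := by
          intro a'
          rw [← hl a a', Finsupp.sum, Finset.mul_sum]
          exact Finset.sum_congr rfl fun u _ => by ring
        simp [h2]
      simp only [this]
      exact hc t
    have hG : ∀ a : A 0, ∃ c : (∀ i : Fin n, A i.succ) → ℂ, ∀ ζ' : Fin n → X,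
        ((l a).sum fun u w => w * F (Fin.cons u ζ')) =
          ∑ a', c a' * ∏ i, b i.succ (a' i) (ζ' i) := by
      intro a
      refine ih (fun i => b i.succ) (fun i => hb i.succ)
        (fun ζ' => (l a).sum fun u w => w * F (Fin.cons u ζ')) fun i ζ' => ?_
      have hu : ∀ u : X, ∃ c : A i.succ → ℂ, ∀ t,
          F (Fin.cons u (Function.update ζ' i t)) = ∑ a, c a * b i.succ a t := by
        intro u
        obtain ⟨c, hc⟩ := hF i.succ (Fin.cons u ζ')
        refine ⟨c, fun t => ?_⟩
        rw [← hc t, Fin.cons_update]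
      choose c hc using hu
      refine ⟨fun a' => (l a).sum fun u w => w * c u a', fun t => ?_⟩
      simp only [hc, Finsupp.sum, Finset.mul_sum, Finset.sum_mul]
      rw [Finset.sum_comm]
      exact Finset.sum_congr rfl fun _ _ => Finset.sum_congr rfl fun _ _ => by ring
    choose c hc using hG
    refine ⟨fun a => c (a 0) (fun i => a i.succ), fun ζ => ?_⟩
    have hζ : ζ = Fin.cons (ζ 0) (fun i => ζ i.succ) := (Fin.cons_self_tail ζ).symm
    conv_lhs => rw [hζ, h0]
    rw [← (Fin.consEquiv A).sum_comp, Fintype.sum_prod_type]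
    refine Finset.sum_congr rfl fun a _ => ?_
    rw [hc, Finset.sum_mul]
    refine Finset.sum_congr rfl fun a' _ => ?_
    simp [Fin.prod_univ_succ]
    ring

end Analysis

end LatticeJacobi

end

noncomputable section

namespace LatticeJacobi

/-! ### The character e(x) = exp(2πix). -/

section Exponential

open Complex

theorem e_add (x y : ℂ) : e (x + y) = e x * e y := by
  rw [e, e, e, ← Complex.exp_add, mul_add]

@[simp] theorem e_zero : e 0 = 1 := by simp [e]

theorem e_ne_zero (x : ℂ) : e x ≠ 0 := Complex.exp_ne_zero _

theorem e_neg (x : ℂ) : e (-x) = (e x)⁻¹ := by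
  rw [e, e, mul_neg, Complex.exp_neg]

theorem e_sum {ι : Type*} (s : Finset ι) (f : ι → ℂ) : e (∑ i ∈ s, f i) = ∏ i ∈ s, e (f i) := by
  rw [e, Finset.mul_sum, Complex.exp_sum]; rfl

theorem e_natCast_mul (n : ℕ) (x : ℂ) : e (n * x) = e x ^ n := by
  rw [e, e, ← Complex.exp_nat_mul]; congr 1; ring

@[simp] theorem e_int (m : ℤ) : e m = 1 := by
  rw [e, mul_comm]; exact Complex.exp_int_mul_two_pi_mul_I m

theorem e_add_int (x : ℂ) (m : ℤ) : e (x + m) = e x := by rw [e_add, e_int, mul_one]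

theorem e_half : e (1 / 2) = -1 := by
  rw [e, show 2 * (Real.pi : ℂ) * I * (1 / 2) = Real.pi * I by ring, Complex.exp_pi_mul_I]

theorem e_int_div_two (m : ℤ) : e (m / 2) = (-1) ^ m := by
  rw [← e_half, e, e, ← Complex.exp_int_mul]; congr 1; ring

theorem norm_e (x : ℂ) : ‖e x‖ = Real.exp (-(2 * Real.pi * x.im)) := by
  rw [e, Complex.norm_exp]
  congr 1
  simp [Complex.mul_re, Complex.mul_im]

theorem norm_e_real (x : ℝ) : ‖e x‖ = 1 := by simp [norm_e]

theorem e_eq_one_iff {x : ℂ} : e x = 1 ↔ ∃ m : ℤ, x = m := by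
  rw [e, Complex.exp_eq_one_iff]
  have h : (2 * (Real.pi : ℂ) * I) ≠ 0 := by simp [Real.pi_ne_zero, I_ne_zero]
  refine exists_congr fun m => ?_
  rw [mul_comm (m : ℂ)]
  exact mul_right_inj' h

theorem e_eq_e_iff {x y : ℂ} : e x = e y ↔ ∃ m : ℤ, x - y = m := by
  rw [← e_eq_one_iff, sub_eq_add_neg, e_add, e_neg, ← div_eq_mul_inv, div_eq_one_iff_eq (e_ne_zero y)]

@[fun_prop] theorem differentiable_e : Differentiable ℂ e := by
  unfold e; fun_prop

end Exponential

/-! ### One-variable theta functions of index d/2: independence and inversion. -/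

section ThetaDecomposition

open Complex

/-- The summand `q^{k²/2d} ζ^k` of the theta functions of index `d/2`. -/
def thTerm (d : ℕ) (τ z : ℂ) (k : ℤ) : ℂ := e ((k : ℂ) ^ 2 / (2 * d) * τ + k * z)

/-- The theta function `∑_{k ≡ b mod d} q^{k²/2d} ζ^k`. -/
def th (d : ℕ) (b : ZMod d) (τ z : ℂ) : ℂ := ∑' k : ℤ, if (k : ZMod d) = b then thTerm d τ z k else 0

variable {d : ℕ} [NeZero d]

theorem im_div_natCast_pos {τ : ℂ} (hτ : 0 < τ.im) : 0 < (τ / d).im := by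
  have : (0 : ℝ) < d := by exact_mod_cast Nat.pos_of_neZero d
  rw [Complex.div_natCast_im]; positivity

theorem thTerm_eq (τ z : ℂ) (k : ℤ) : thTerm d τ z k = jacobiTheta₂_term k z (τ / d) := by
  have : (d : ℂ) ≠ 0 := NeZero.ne _
  rw [thTerm, e, jacobiTheta₂_term]
  congr 1
  field_simp
  ring

theorem summable_thTerm {τ : ℂ} (hτ : 0 < τ.im) (z : ℂ) : Summable (thTerm d τ z) := by
  simp_rw [funext (thTerm_eq (d := d) τ z)]
  exact (summable_jacobiTheta₂_term_iff z _).2 (im_div_natCast_pos hτ)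

theorem summable_ite_thTerm {τ : ℂ} (hτ : 0 < τ.im) (z : ℂ) (b : ZMod d) :
    Summable (fun k : ℤ => if (k : ZMod d) = b then thTerm d τ z k else 0) := by
  refine Summable.of_norm_bounded (summable_thTerm (d := d) hτ z).norm fun k => ?_
  split_ifs <;> simp

theorem hasSum_th {τ : ℂ} (hτ : 0 < τ.im) (z : ℂ) (b : ZMod d) :
    HasSum (fun k : ℤ => if (k : ZMod d) = b then thTerm d τ z k else 0) (th d b τ z) :=
  (summable_ite_thTerm hτ z b).hasSum

theorem hasSum_periodic_thTerm {τ : ℂ} (hτ : 0 < τ.im) (z : ℂ) (c : ZMod d → ℂ) :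
    HasSum (fun k : ℤ => c k * thTerm d τ z k) (∑ b, c b * th d b τ z) := by
  refine (hasSum_sum (s := Finset.univ) fun b _ =>
    (hasSum_th hτ z b).mul_left (c b)).congr_fun fun k => ?_
  simp

/-- Substitute k = a + dm. Holomorphy and the inversion formula for these functions are thereby
inherited from `jacobiTheta₂`. -/
theorem th_eq_jacobiTheta₂ (a : ℤ) (τ z : ℂ) :
    th d (a : ZMod d) τ z =
      e ((a : ℂ) ^ 2 / (2 * d) * τ + a * z) * jacobiTheta₂ (d * z + a * τ) (d * τ) := by
  have hd : (d : ℂ) ≠ 0 := NeZero.ne _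
  have hinj : Function.Injective (fun m : ℤ => a + d * m) := fun m m' h => by
    simpa [NeZero.ne d] using h
  rw [th, ← hinj.tsum_eq]
  · rw [jacobiTheta₂, ← tsum_mul_left]
    refine tsum_congr fun m => ?_
    rw [if_pos (by simp), thTerm, jacobiTheta₂_term, e, e, ← Complex.exp_add]
    congr 1
    push_cast
    field_simp
    ring
  · intro k hk
    have hk' : (k : ZMod d) = a := by
      by_contra h; simp [h] at hk
    rw [ZMod.intCast_eq_intCast_iff_dvd_sub] at hk'
    obtain ⟨m, hm⟩ := hk'
    exact ⟨-m, by simp only; linarith⟩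

theorem th_differentiableAt (b : ZMod d) {τ : ℂ} (hτ : 0 < τ.im) (z : ℂ) :
    DifferentiableAt ℂ (fun p : ℂ × ℂ => th d b p.1 p.2) (τ, z) := by
  obtain ⟨a, rfl⟩ := ZMod.intCast_surjective b
  simp_rw [th_eq_jacobiTheta₂]
  have hd : 0 < ((d : ℂ) * τ).im := by
    have : (0 : ℝ) < d := by exact_mod_cast Nat.pos_of_neZero d
    simpa using mul_pos this hτ
  refine DifferentiableAt.mul (by fun_prop) ?_
  exact (hasFDerivAt_jacobiTheta₂ (d * z + a * τ) hd).differentiableAt.comp (τ, z)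
    (f := fun p : ℂ × ℂ => ((d : ℂ) * p.2 + a * p.1, (d : ℂ) * p.1)) (by fun_prop)

theorem th_differentiable (b : ZMod d) {τ : ℂ} (hτ : 0 < τ.im) :
    Differentiable ℂ (fun z => th d b τ z) := fun z =>
  (th_differentiableAt b hτ z).comp z (f := fun z => (τ, z)) (by fun_prop)

/-- At the real points z = k√2 the exponentials e(jz) become k-th powers of the numbers e(j√2).
These are unimodular, and distinct since √2 is irrational, so the independence of characters applies
to series over ℤ. -/
theorem irrational_combination_injective :
    Function.Injective (fun k : ℤ => e (k * (Real.sqrt 2 : ℝ))) := by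
  intro k k' h
  obtain ⟨m, hm⟩ := e_eq_e_iff.1 h
  by_contra hne
  have h1 : ((k - k' : ℤ) : ℝ) * Real.sqrt 2 = m := by
    have : (((k - k' : ℤ) : ℝ) * Real.sqrt 2 : ℂ) = m := by rw [← hm]; push_cast; ring
    exact_mod_cast this
  have h2 := irrational_sqrt_two.intCast_mul (sub_ne_zero.2 hne)
  exact h2 ⟨m, by rw [h1]; simp⟩

/-- The theta functions of index `d/2` are linearly independent. -/
theorem linearIndependent_th {τ : ℂ} (hτ : 0 < τ.im) :
    LinearIndependent ℂ (fun (b : ZMod d) z => th d b τ z) := by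
  rw [Fintype.linearIndependent_iff]
  intro c hc b
  obtain ⟨a, rfl⟩ := ZMod.intCast_surjective b
  have key := eq_zero_of_forall_tsum_mul_pow_eq_zero
    (hasSum_periodic_thTerm hτ 0 c).summable
    (w := fun k : ℤ => e (k * (Real.sqrt 2 : ℝ))) (fun k => by
      have := norm_e_real (k * Real.sqrt 2); push_cast at this; exact this)
    irrational_combination_injective (fun k => ?_) a
  · exact (mul_eq_zero.1 key).resolve_right (e_ne_zero _)
  · have h1 := (hasSum_periodic_thTerm hτ (k * (Real.sqrt 2 : ℝ)) c).tsum_eq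
    have h2 := congrFun hc (k * (Real.sqrt 2 : ℝ))
    simp only [Finset.sum_apply, Pi.smul_apply, smul_eq_mul, Pi.zero_apply] at h2
    rw [h2] at h1
    refine Eq.trans (tsum_congr fun j => ?_) h1
    rw [mul_assoc, ← e_natCast_mul, thTerm, thTerm, ← e_add]
    congr 2
    ring

/-- A positive real factor does not change the argument, so the principal logarithm is additive.
This is used to take 1/d out of (-iτ/d)^{1/2}. -/
theorem mul_cpow_half {x : ℝ} (hx : 0 < x) {w : ℂ} (hw : w ≠ 0) (s : ℂ) :
    ((x : ℂ) * w) ^ s = (x : ℂ) ^ s * w ^ s := by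
  have hx' : (x : ℂ) ≠ 0 := by exact_mod_cast hx.ne'
  rw [Complex.cpow_def_of_ne_zero (mul_ne_zero hx' hw), Complex.cpow_def_of_ne_zero hx',
    Complex.cpow_def_of_ne_zero hw, ← Complex.exp_add, Complex.log_ofReal_mul hx hw,
    Complex.ofReal_log hx.le]
  congr 1; ring

theorem neg_I_mul_ne_zero {τ : ℂ} (hτ : 0 < τ.im) : -I * τ ≠ 0 := by
  refine mul_ne_zero (neg_ne_zero.2 I_ne_zero) ?_
  rintro rfl; simp at hτ

/-- The functional equation of `jacobiTheta₂`, solved for the value at `-1/τ`. -/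
theorem jacobiTheta₂_neg_one_div {τ : ℂ} (hτ : 0 < τ.im) (z : ℂ) :
    jacobiTheta₂ (z / τ) (-1 / τ) =
      (-I * τ) ^ (1 / 2 : ℂ) * e (z ^ 2 / (2 * τ)) * jacobiTheta₂ z τ := by
  have h0 : (-I * τ) ^ (1 / 2 : ℂ) ≠ 0 := by
    simp [Complex.cpow_eq_zero_iff]
    rintro rfl; simp at hτ
  have hτ0 : τ ≠ 0 := by rintro rfl; simp at hτ
  rw [jacobiTheta₂_functional_equation z τ]
  have h1 : e (z ^ 2 / (2 * τ)) * cexp (-Real.pi * I * z ^ 2 / τ) = 1 := by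
    rw [e, ← Complex.exp_add, ← Complex.exp_zero]
    congr 1
    field_simp
    ring
  calc _ = ((-I * τ) ^ (1 / 2 : ℂ) * (1 / (-I * τ) ^ (1 / 2 : ℂ))) *
        (e (z ^ 2 / (2 * τ)) * cexp (-Real.pi * I * z ^ 2 / τ)) * jacobiTheta₂ (z / τ) (-1 / τ) := by
        rw [h1, mul_one_div_cancel h0]; ring
    _ = _ := by ring

/-- The inversion formula for the theta functions of index `d/2`; the matrix does not depend
on `τ` and `z`. -/
theorem exists_th_inversion (d : ℕ) [NeZero d] :
    ∃ M : ZMod d → ZMod d → ℂ, ∀ (a : ZMod d) (τ z : ℂ), 0 < τ.im →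
      th d a (-1 / τ) (z / τ) =
        (-I * τ) ^ (1 / 2 : ℂ) * e (d * z ^ 2 / (2 * τ)) * ∑ b, M a b * th d b τ z := by
  have hd : (d : ℂ) ≠ 0 := NeZero.ne _
  have hdpos : (0 : ℝ) < (d : ℝ)⁻¹ := by
    have : (0 : ℝ) < d := by exact_mod_cast Nat.pos_of_neZero d
    positivity
  -- The finite Fourier matrix d^{-1/2} e(-ab/d), on integer representatives of the residue classes.
  refine ⟨fun a b => ((d : ℝ)⁻¹ : ℂ) ^ (1 / 2 : ℂ) *
    e (-((a.cast : ℤ) : ℂ) * ((b.cast : ℤ) : ℂ) / d), fun a τ z hτ => ?_⟩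
  have hτ0 : τ ≠ 0 := by rintro rfl; simp at hτ
  set n : ℤ := a.cast with hn
  have ha : a = (n : ZMod d) := by rw [hn]; simp
  have h1 := jacobiTheta₂_neg_one_div (im_div_natCast_pos (d := d) hτ) (z - n / d)
  conv_lhs => rw [ha, th_eq_jacobiTheta₂]
  have e1 : (d : ℂ) * (z / τ) + n * (-1 / τ) = (z - n / d) / (τ / d) := by field_simp; ring
  have e2 : (d : ℂ) * (-1 / τ) = -1 / (τ / d) := by field_simp
  have e3 : -I * (τ / d) = ((d : ℝ)⁻¹ : ℝ) * (-I * τ) := by push_cast; field_simp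
  rw [e1, e2, h1, e3, mul_cpow_half hdpos (neg_I_mul_ne_zero hτ)]
  -- After inversion the sum runs over all of ℤ. Splitting it by residues modulo d produces every
  -- `th d b`, because e(-nk/d) depends only on k modulo d.
  have e4 : jacobiTheta₂ (z - n / d) (τ / d) =
      ∑ b : ZMod d, e (-(n : ℂ) * ((b.cast : ℤ) : ℂ) / d) * th d b τ z := by
    rw [← (hasSum_periodic_thTerm hτ z fun b => e (-(n : ℂ) * ((b.cast : ℤ) : ℂ) / d)).tsum_eq,
      jacobiTheta₂]
    refine tsum_congr fun k => ?_
    have : ∃ m : ℤ, k = (((k : ZMod d).cast : ℤ)) + d * m := by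
      have : (((k : ZMod d).cast : ℤ) : ZMod d) = k := by simp
      rw [ZMod.intCast_eq_intCast_iff_dvd_sub] at this
      obtain ⟨m, hm⟩ := this
      exact ⟨m, by linarith⟩
    obtain ⟨m, hm⟩ := this
    have h5 : e (-(n : ℂ) * (((k : ZMod d).cast : ℤ) : ℂ) / d) = e (-(n : ℂ) * k / d) := by
      have h6 : -(n : ℂ) * (((k : ZMod d).cast : ℤ) : ℂ) / d = -(n : ℂ) * k / d + (n * m : ℤ) := by
        have h7 : (k : ℂ) = (((k : ZMod d).cast : ℤ) : ℂ) + d * m := by exact_mod_cast hm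
        conv_rhs => rw [h7]
        push_cast
        field_simp
        ring
      rw [h6, e_add_int]
    rw [h5, thTerm, ← e_add, e, jacobiTheta₂_term]
    congr 1
    field_simp
    ring
  rw [e4]
  have e5 : e ((n : ℂ) ^ 2 / (2 * d) * (-1 / τ) + n * (z / τ)) *
      e ((z - n / d) ^ 2 / (2 * (τ / d))) = e (d * z ^ 2 / (2 * τ)) := by
    rw [← e_add]
    congr 1
    field_simp
    ring
  rw [← e5]
  simp only [mul_assoc, ← Finset.mul_sum]
  push_cast
  ring

end ThetaDecomposition

end LatticeJacobi

end

noncomputable section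

namespace LatticeJacobi

/-! ### Entire functions with a theta transformation law. -/

section FourierDecomposition

open Complex MeasureTheory

/-- The integral of a `1`-periodic entire function over a horizontal period does not depend on the
position of the period. -/
theorem integral_shift_of_periodic {H : ℂ → ℂ} (hH : Differentiable ℂ H)
    (h1 : ∀ z, H (z + 1) = H z) (w : ℂ) :
    ∫ u in (0 : ℝ)..1, H (u + w) = ∫ u in (0 : ℝ)..1, H u := by
  -- Cauchy's theorem on the rectangle over [0, 1] of height Im w: the vertical sides cancel by
  -- periodicity. The horizontal part of the shift is absorbed by periodicity as well.
  have hrect := Complex.integral_boundary_rect_eq_zero_of_differentiableOn H 0 (1 + w.im * I)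
    hH.differentiableOn
  simp only [zero_re, add_re, one_re, mul_re, ofReal_re, I_re, mul_zero, ofReal_im, I_im, mul_one,
    sub_self, add_zero, zero_im, ofReal_zero, zero_mul, add_im, one_im, mul_im, zero_add,
    ofReal_one] at hrect
  have h2 : ∀ y : ℝ, H (1 + y * I) = H (y * I) := fun y => by rw [add_comm, h1]
  simp only [h2, add_sub_cancel_right] at hrect
  have hper : Function.Periodic (fun u : ℝ => H (u + w.im * I)) 1 := fun u => by
    simp only [ofReal_add, ofReal_one]
    rw [← h1 (u + w.im * I)]
    congr 1; ring
  have h3 := hper.intervalIntegral_add_eq w.re 0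
  have h4 := intervalIntegral.integral_comp_add_right (a := 0) (b := 1)
    (fun u : ℝ => H (u + w.im * I)) w.re
  rw [zero_add, add_comm 1] at h4
  rw [zero_add, ← h4] at h3
  rw [sub_eq_zero.1 hrect, ← h3]
  refine intervalIntegral.integral_congr fun u _ => ?_
  simp only [ofReal_add]
  congr 1
  conv_lhs => rw [← re_add_im w]
  ring

variable {d : ℕ} [NeZero d]

/-- An entire function with the transformation behaviour of a theta function of index `d/2` is
a linear combination of the functions `th d b τ`. -/
theorem exists_eq_sum_th {τ : ℂ} (hτ : 0 < τ.im) {F : ℂ → ℂ} (hF : Differentiable ℂ F)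
    (h1 : ∀ z, F (z + 1) = F z) (h2 : ∀ z, F (z + τ) = e (-(d * τ / 2) - d * z) * F z) :
    ∃ c : ZMod d → ℂ, ∀ z, F z = ∑ b, c b * th d b τ z := by
  have hd : (d : ℂ) ≠ 0 := NeZero.ne _
  set a : ℤ → ℂ := fun k => ∫ u in (0 : ℝ)..1, F u * e (-(k * u)) with ha
  -- Move the path of integration of F(z) e(-kz) by τ and apply the quasi-periodicity of F.
  have hrec : ∀ k : ℤ, a (k + d) = e (d * τ / 2 + k * τ) * a k := by
    intro k
    have hs := integral_shift_of_periodic (H := fun z => F z * e (-(k * z))) (by fun_prop)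
      (fun z => by
        rw [h1, show -((k : ℂ) * (z + 1)) = -(k * z) + (-k : ℤ) by push_cast; ring, e_add_int]) τ
    simp only [h2] at hs
    have : ∀ u : ℝ, e (-(d * τ / 2) - d * u) * F u * e (-(k * (u + τ))) =
        e (-(d * τ / 2 + k * τ)) * (F u * e (-(((k + d : ℤ) : ℂ) * u))) := by
      intro u
      have : e (-(d * τ / 2) - d * u) * e (-(k * (u + τ))) =
          e (-(d * τ / 2 + k * τ)) * e (-(((k + d : ℤ) : ℂ) * u)) := by
        rw [← e_add, ← e_add]; congr 1; push_cast; ring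
      linear_combination F u * this
    simp only [this, intervalIntegral.integral_const_mul] at hs
    simp only [ha]
    rw [← hs, ← mul_assoc, ← e_add]
    simp
  -- Removing q^{k²/2d} turns the recursion into d-periodicity, so only the d values on residue
  -- classes remain.
  set c : ℤ → ℂ := fun k => a k * e (-((k : ℂ) ^ 2 / (2 * d) * τ)) with hc
  have hper : Function.Periodic c d := by
    intro k
    simp only [hc]
    rw [hrec, mul_comm (e _) (a k), mul_assoc, ← e_add]
    congr 2
    push_cast
    field_simp
    ring
  have hc' : ∀ k : ℤ, c k = c ((k : ZMod d).cast : ℤ) := by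
    intro k
    have : (((k : ZMod d).cast : ℤ) : ZMod d) = k := by simp
    rw [ZMod.intCast_eq_intCast_iff_dvd_sub] at this
    obtain ⟨m, hm⟩ := this
    have hk : k = ((k : ZMod d).cast : ℤ) + m * d := by rw [mul_comm]; linarith
    conv_lhs => rw [hk]
    exact hper.int_mul m _
  have hak : ∀ k : ℤ, a k = c ((k : ZMod d).cast : ℤ) * e ((k : ℂ) ^ 2 / (2 * d) * τ) := by
    intro k
    rw [← hc' k]
    simp only [hc]
    rw [mul_assoc, ← e_add]
    simp
  have hsum := fun z => hasSum_periodic_thTerm hτ z fun b : ZMod d => c (b.cast : ℤ)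
  refine ⟨fun b => c (b.cast : ℤ), fun z => ?_⟩
  have hper1 : Function.Periodic (fun u : ℝ => F u) (1 : ℝ) := fun u => by
    simp only [ofReal_add, ofReal_one]; exact h1 u
  let f : C(AddCircle (1 : ℝ), ℂ) :=
    ⟨hper1.lift, by
      refine continuous_quot_lift _ ?_
      exact hF.continuous.comp continuous_ofReal⟩
  have hf : ∀ u : ℝ, f u = F u := fun u => hper1.lift_coe u
  have hcoef : ∀ k : ℤ, fourierCoeff f k = a k := by
    intro k
    rw [fourierCoeff_eq_intervalIntegral _ _ 0]
    simp only [ha, one_div, inv_one, one_smul, zero_add]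
    refine intervalIntegral.integral_congr fun u _ => ?_
    simp only [hf, fourier_coe_apply, smul_eq_mul, e]
    rw [mul_comm]
    congr 2
    push_cast
    ring
  -- Absolute convergence of the theta series makes the Fourier series converge pointwise to F on ℝ;
  -- the identity theorem then extends the equality to ℂ.
  have hsa : Summable (fourierCoeff f) := by
    refine (hsum 0).summable.congr fun k => ?_
    rw [hcoef, hak, thTerm]
    simp
  have hreal : ∀ u : ℝ, F u = ∑ b : ZMod d, c (b.cast : ℤ) * th d b τ u := by
    intro u
    have h3 := has_pointwise_sum_fourier_series_of_summable hsa (u : AddCircle (1 : ℝ))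
    rw [hf] at h3
    refine h3.unique ((hsum u).congr_fun fun k => ?_)
    rw [hcoef, hak, thTerm, smul_eq_mul, e_add, fourier_coe_apply, e, e, mul_assoc]
    congr 3
    push_cast
    ring
  have hG : Differentiable ℂ fun z => ∑ b : ZMod d, c (b.cast : ℤ) * th d b τ z :=
    Differentiable.fun_sum fun b _ => (th_differentiable b hτ).const_mul _
  have hfreq : ∃ᶠ z in nhdsWithin (0 : ℂ) {0}ᶜ,
      F z = ∑ b : ZMod d, c (b.cast : ℤ) * th d b τ z := by
    have ht : Filter.Tendsto (fun n : ℕ => (((1 / ((n : ℝ) + 1)) : ℝ) : ℂ)) Filter.atTop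
        (nhdsWithin (0 : ℂ) {0}ᶜ) := by
      refine tendsto_nhdsWithin_iff.2 ⟨?_, Filter.Eventually.of_forall fun n => ?_⟩
      · have := (Complex.continuous_ofReal.tendsto 0).comp
          (tendsto_one_div_add_atTop_nhds_zero_nat (𝕜 := ℝ))
        exact this
      · have : (1 / ((n : ℝ) + 1)) ≠ 0 := by positivity
        exact ofReal_ne_zero.2 this
    exact ht.frequently (Filter.Frequently.of_forall fun n => hreal _)
  exact congrFun (AnalyticOnNhd.eq_of_frequently_eq
    (fun z _ => hF.analyticAt z) (fun z _ => hG.analyticAt z) hfreq) z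

end FourierDecomposition

end LatticeJacobi

end

noncomputable section

namespace LatticeJacobi

/-! ### The Jacobi theta function and η: elliptic and modular transformations. -/

section JacobiTheta

open Complex hiding eta
open Filter Topology ModularForm

open scoped MatrixGroups

theorem im_coe_pos (τ : UpperHalfPlane) : 0 < (τ : ℂ).im := τ.im_pos

/-- The sign χ₄(2k+1) = (-1)^k = e(k/2) is absorbed by shifting the argument by 1/2, and the cross
term of (2k+1)²/8 by shifting it by τ/2. -/
theorem theta_term_odd (τ z : ℂ) (k : ℤ) :
    (ZMod.χ₄ ((2 * k + 1 : ℤ) : ZMod 4) : ℂ) *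
        e (((2 * k + 1 : ℤ) : ℂ) ^ 2 / 8 * τ + ((2 * k + 1 : ℤ) : ℂ) / 2 * z) =
      e (τ / 8 + z / 2) * jacobiTheta₂_term k (z + τ / 2 + 1 / 2) τ := by
  have hχ : (ZMod.χ₄ ((2 * k + 1 : ℤ) : ZMod 4) : ℂ) = e (k / 2) := by
    rw [e_int_div_two]
    rcases Int.even_or_odd' k with ⟨m, rfl | rfl⟩
    · rw [ZMod.χ₄_int_one_mod_four (by omega)]
      simp [zpow_mul]
    · rw [ZMod.χ₄_int_three_mod_four (by omega)]
      rw [zpow_add₀ (by norm_num), zpow_mul]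
      simp
  rw [hχ, jacobiTheta₂_term, e, e, e, ← Complex.exp_add, ← Complex.exp_add]
  congr 1
  push_cast
  ring

theorem hasSum_theta (τ : UpperHalfPlane) (z : ℂ) :
    HasSum (fun r : ℤ => (ZMod.χ₄ (r : ZMod 4) : ℂ) *
      e ((r : ℂ) ^ 2 / 8 * τ + (r : ℂ) / 2 * z))
      (e ((τ : ℂ) / 8 + z / 2) * jacobiTheta₂ (z + τ / 2 + 1 / 2) τ) := by
  have hinj : Function.Injective (fun k : ℤ => 2 * k + 1) := fun m m' h => by
    simpa using h
  rw [← hinj.hasSum_iff]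
  · refine ((hasSum_jacobiTheta₂_term (z + τ / 2 + 1 / 2) (im_coe_pos τ)).mul_left
      (e ((τ : ℂ) / 8 + z / 2))).congr_fun fun k => ?_
    exact theta_term_odd τ z k
  · intro r hr
    have : r % 2 = 0 := by
      by_contra h
      exact hr ⟨r / 2, by simp only; omega⟩
    rw [ZMod.χ₄_int_eq_if_mod_four, if_pos this]
    simp

theorem theta_eq (τ : UpperHalfPlane) (z : ℂ) :
    theta τ z = e ((τ : ℂ) / 8 + z / 2) * jacobiTheta₂ (z + τ / 2 + 1 / 2) τ :=
  (hasSum_theta τ z).tsum_eq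

theorem theta_differentiableAt {τ : ℂ} (hτ : 0 < τ.im) (z : ℂ) :
    DifferentiableAt ℂ (fun p : ℂ × ℂ => theta (ofComplex p.1) p.2) (τ, z) := by
  have h1 : DifferentiableAt ℂ (fun p : ℂ × ℂ =>
      e (p.1 / 8 + p.2 / 2) * jacobiTheta₂ (p.2 + p.1 / 2 + 1 / 2) p.1) (τ, z) := by
    refine DifferentiableAt.mul (by fun_prop) ?_
    exact (hasFDerivAt_jacobiTheta₂ (z + τ / 2 + 1 / 2) hτ).differentiableAt.comp (τ, z)
      (f := fun p : ℂ × ℂ => (p.2 + p.1 / 2 + 1 / 2, p.1)) (by fun_prop)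
  refine h1.congr_of_eventuallyEq ?_
  have : ∀ᶠ p : ℂ × ℂ in 𝓝 (τ, z), 0 < p.1.im :=
    (isOpen_lt continuous_const (by fun_prop)).mem_nhds (by exact hτ)
  filter_upwards [this] with p hp
  rw [theta_eq, UpperHalfPlane.ofComplex_apply_of_im_pos hp]

theorem theta_differentiable (τ : UpperHalfPlane) : Differentiable ℂ (theta τ) := fun z => by
  have := (theta_differentiableAt (im_coe_pos τ) z).comp z (f := fun z => ((τ : ℂ), z)) (by fun_prop)
  simpa [Function.comp_def] using this

theorem theta_add_int (τ : UpperHalfPlane) (z : ℂ) (m : ℤ) :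
    theta τ (z + m) = (-1) ^ m * theta τ z := by
  have hp : Function.Periodic (fun z : ℂ => jacobiTheta₂ z τ) 1 := fun z => jacobiTheta₂_add_left z τ
  have h1 := hp.int_mul m (z + τ / 2 + 1 / 2)
  simp only [mul_one] at h1
  rw [theta_eq, theta_eq, show z + m + (τ : ℂ) / 2 + 1 / 2 = z + τ / 2 + 1 / 2 + m by ring, h1,
    ← e_int_div_two, ← mul_assoc, ← e_add]
  congr 2; ring

theorem theta_add_tau (τ : UpperHalfPlane) (z : ℂ) :
    theta τ (z + τ) = -(e (-(τ : ℂ) / 2 - z) * theta τ z) := by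
  have h : cexp (-Real.pi * I * (τ + 2 * (z + τ / 2 + 1 / 2))) =
      e (-(τ + 2 * (z + τ / 2 + 1 / 2)) / 2) := by
    rw [e]; congr 1; ring
  rw [theta_eq, theta_eq, show z + (τ : ℂ) + τ / 2 + 1 / 2 = z + τ / 2 + 1 / 2 + τ by ring,
    jacobiTheta₂_add_left', h]
  have h2 : e ((τ : ℂ) / 8 + (z + τ) / 2) * e (-(τ + 2 * (z + τ / 2 + 1 / 2)) / 2) =
      -(e (-(τ : ℂ) / 2 - z) * e ((τ : ℂ) / 8 + z / 2)) := by
    rw [neg_eq_neg_one_mul (e _ * e _), ← e_half, ← e_add, ← e_add, ← e_add, e_eq_e_iff]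
    exact ⟨-1, by push_cast; ring⟩
  linear_combination jacobiTheta₂ (z + τ / 2 + 1 / 2) τ * h2

theorem theta_add_int_mul_tau (τ : UpperHalfPlane) (z : ℂ) (l : ℤ) :
    theta τ (z + l * τ) = (-1) ^ l * e (-((l : ℂ) ^ 2 / 2 * τ) - l * z) * theta τ z := by
  have step : ∀ (l : ℤ) (z : ℂ),
      theta τ (z + (l + 1 : ℤ) * τ) = -(e (-(τ : ℂ) / 2 - (z + l * τ)) * theta τ (z + l * τ)) := by
    intro l z
    rw [← theta_add_tau]
    congr 1
    push_cast; ring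
  have hneg : ∀ l : ℤ, ((-1 : ℂ)) ^ (l + 1) = -(-1) ^ l := fun l => by
    rw [zpow_add_one₀ (by norm_num)]; ring
  induction l using Int.induction_on with
  | zero => simp
  | succ n ih =>
    rw [step, ih, hneg]
    have : e (-(τ : ℂ) / 2 - (z + (n : ℤ) * τ)) * e (-(((n : ℤ) : ℂ) ^ 2 / 2 * τ) - (n : ℤ) * z) =
        e (-((((n : ℤ) + 1 : ℤ) : ℂ) ^ 2 / 2 * τ) - ((n : ℤ) + 1 : ℤ) * z) := by
      rw [← e_add]; congr 1; push_cast; ring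
    rw [← this]; ring
  | pred n ih =>
    have h1 := step (-n - 1) z
    rw [sub_add_cancel, ih] at h1
    have h2 := hneg (-n - 1)
    rw [sub_add_cancel] at h2
    rw [h2] at h1
    have : e (-(τ : ℂ) / 2 - (z + (-n - 1 : ℤ) * τ)) *
        e (-(((-n - 1 : ℤ) : ℂ) ^ 2 / 2 * τ) - (-n - 1 : ℤ) * z) =
        e (-(((-n : ℤ) : ℂ) ^ 2 / 2 * τ) - (-n : ℤ) * z) := by
      rw [← e_add]; congr 1; push_cast; ring
    rw [← this] at h1
    have h0 := e_ne_zero (-(τ : ℂ) / 2 - (z + (-n - 1 : ℤ) * τ))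
    refine mul_left_cancel₀ h0 ?_
    linear_combination h1

/-- The sign (-1)^{l+m} is written as e((l+m)²/2), using (l+m)² ≡ l+m mod 2. In this quadratic form
the signs of the factors add up to e(β(x+y)) over a eutactic star. -/
theorem theta_add_lattice (τ : UpperHalfPlane) (z : ℂ) (l m : ℤ) :
    theta τ (z + l * τ + m) =
      e ((l + m : ℂ) ^ 2 / 2) * e (-((l : ℂ) ^ 2 / 2 * τ) - l * z) * theta τ z := by
  rw [theta_add_int, theta_add_int_mul_tau]
  have : e ((l + m : ℂ) ^ 2 / 2) = (-1) ^ l * (-1) ^ m := by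
    rw [← zpow_add₀ (by norm_num), ← e_int_div_two, e_eq_e_iff]
    obtain ⟨j, hj⟩ := Int.even_mul_pred_self (l + m)
    refine ⟨j, ?_⟩
    have : ((l + m : ℂ)) * (l + m - 1) = j + j := by exact_mod_cast hj
    push_cast
    linear_combination this / 2
  rw [this]; ring

/-- No branch is crossed: arg τ lies in [0, π] and arg(-i) = -π/2. -/
theorem log_neg_I_mul {τ : ℂ} (hτ : 0 < τ.im) : log (-I * τ) = log (-I) + log τ := by
  have h0 : τ ≠ 0 := by rintro rfl; simp at hτ
  refine Complex.log_mul (by simp) h0 ?_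
  rw [Complex.arg_neg_I]
  have h1 : 0 ≤ arg τ := Complex.arg_nonneg_iff.2 hτ.le
  have h2 := Complex.arg_le_pi τ
  constructor <;> linarith [Real.pi_pos]

/-- The factor is brought to the same branch (-iτ)^{1/2} that occurs for `jacobiTheta₂`, so that the
factors of η and ϑ can be combined. -/
theorem eta_neg_one_div {τ : ℂ} (hτ : 0 < τ.im) :
    eta (-1 / τ) = (-I * τ) ^ (1 / 2 : ℂ) * eta τ := by
  have h := eta_comp_eq_csqrt_I_inv hτ
  simp only [Function.comp_apply, Pi.smul_apply, Pi.mul_apply, smul_eq_mul] at h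
  rw [h, ← mul_assoc]
  congr 1
  have h0 : τ ≠ 0 := by rintro rfl; simp at hτ
  rw [sqrt_eq_exp I_ne_zero, sqrt_eq_exp h0,
    Complex.cpow_def_of_ne_zero (neg_I_mul_ne_zero hτ), ← Complex.exp_neg, ← Complex.exp_add,
    log_neg_I_mul hτ, Complex.log_neg_I, Complex.log_I]
  congr 1
  ring

theorem eta_add_one (τ : ℂ) : eta (τ + 1) = e (1 / 24) * eta τ := by
  rw [eta, eta]
  have h1 : ∀ n, eta_q n (τ + 1) = eta_q n τ := fun n => by
    have : Function.Periodic.qParam 1 (τ + 1) = Function.Periodic.qParam 1 τ := by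
      rw [Function.Periodic.qParam, Function.Periodic.qParam, ofReal_one, div_one, div_one, mul_add,
        mul_one, Complex.exp_add, Complex.exp_two_pi_mul_I, mul_one]
    rw [eta_q, this]
  simp only [h1]
  rw [← mul_assoc]
  congr 1
  rw [Function.Periodic.qParam, Function.Periodic.qParam, e, ← Complex.exp_add]
  congr 1
  push_cast
  ring

theorem neg_I_mul_cpow_half_sq (τ : ℂ) :
    ((-I * τ) ^ (1 / 2 : ℂ)) ^ 2 = -I * τ := by
  rw [← Complex.cpow_nat_mul]
  norm_num

theorem e_neg_quarter : e (-(1 / 4)) = -I := by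
  rw [e, show 2 * (Real.pi : ℂ) * I * (-(1 / 4)) = -(Real.pi / 2 * I) by ring, Complex.exp_neg,
    Complex.exp_pi_div_two_mul_I, inv_I]

theorem theta_neg_one_div (τ τ' : UpperHalfPlane) (hτ' : (τ' : ℂ) = -1 / τ) (z : ℂ) :
    theta τ' (z / τ) =
      e (z ^ 2 / (2 * τ)) * (-I * (-I * (τ : ℂ)) ^ (1 / 2 : ℂ)) * theta τ z := by
  have hτ0 : (τ : ℂ) ≠ 0 := τ.ne_zero
  rw [theta_eq, theta_eq, hτ']
  -- Division by τ takes this point to z/τ + (-1/τ)/2 + 1/2, the argument belonging to ϑ at -1/τ. It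
  -- differs by the period 1 from the argument belonging to ϑ at τ.
  have h1 := jacobiTheta₂_neg_one_div (im_coe_pos τ) (z - 1 / 2 + τ / 2)
  rw [show (z - 1 / 2 + (τ : ℂ) / 2) / τ = z / τ + -1 / τ / 2 + 1 / 2 by field_simp; ring] at h1
  rw [h1, show z + (τ : ℂ) / 2 + 1 / 2 = z - 1 / 2 + τ / 2 + 1 by ring, jacobiTheta₂_add_left]
  have h2 : e (-1 / (τ : ℂ) / 8 + z / τ / 2) * e ((z - 1 / 2 + (τ : ℂ) / 2) ^ 2 / (2 * τ)) =
      e (z ^ 2 / (2 * τ)) * e (-(1 / 4)) * e (τ / 8 + z / 2) := by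
    rw [← e_add, ← e_add, ← e_add]
    congr 1
    field_simp
    ring
  rw [e_neg_quarter] at h2
  linear_combination (-I * (τ : ℂ)) ^ (1 / 2 : ℂ) *
    jacobiTheta₂ (z - 1 / 2 + τ / 2) τ * h2

/-- Only odd r contribute, and then r² ≡ 1 mod 8. -/
theorem theta_add_one (τ τ' : UpperHalfPlane) (hτ' : (τ' : ℂ) = τ + 1) (z : ℂ) :
    theta τ' z = e (1 / 8) * theta τ z := by
  rw [theta, theta, ← tsum_mul_left]
  refine tsum_congr fun r => ?_
  by_cases hr : r % 2 = 0
  · rw [ZMod.χ₄_int_eq_if_mod_four, if_pos hr]; simp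
  · have : e ((r : ℂ) ^ 2 / 8 * τ' + r / 2 * z) = e (1 / 8) * e ((r : ℂ) ^ 2 / 8 * τ + r / 2 * z) := by
      rw [← e_add, e_eq_e_iff, hτ']
      obtain ⟨k, rfl⟩ : ∃ k, r = 2 * k + 1 := ⟨r / 2, by omega⟩
      obtain ⟨j, hj⟩ := Int.even_mul_succ_self k
      refine ⟨j, ?_⟩
      have : (k : ℂ) * (k + 1) = j + j := by exact_mod_cast hj
      push_cast
      linear_combination this / 2
    rw [this]; ring

theorem coe_smul (A : SL(2, ℤ)) (τ : UpperHalfPlane) :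
    ((A • τ : UpperHalfPlane) : ℂ) = (A 0 0 * τ + A 0 1) / autFactor A τ := by
  rw [UpperHalfPlane.specialLinearGroup_apply, autFactor]
  simp

theorem autFactor_ne_zero (A : SL(2, ℤ)) (τ : UpperHalfPlane) : autFactor A τ ≠ 0 := by
  have := UpperHalfPlane.denom_ne_zero (A : GL (Fin 2) ℝ) τ
  rw [UpperHalfPlane.denom] at this
  simpa [autFactor] using this

theorem autFactor_mul (A B : SL(2, ℤ)) (τ : UpperHalfPlane) :
    autFactor (A * B) τ = autFactor A (B • τ) * autFactor B τ := by
  have h := autFactor_ne_zero B τ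
  rw [autFactor, autFactor, coe_smul]
  simp only [Matrix.SpecialLinearGroup.coe_mul, Matrix.mul_apply, Fin.sum_univ_two]
  field_simp
  push_cast
  rw [autFactor]
  ring

theorem etaCocycle_mul (h : ℤ) (A B : SL(2, ℤ)) (τ : UpperHalfPlane) :
    etaCocycle h (A * B) τ = etaCocycle h A (B • τ) * etaCocycle h B τ := by
  have := zpow_ne_zero h (eta_ne_zero (im_coe_pos (B • τ)))
  rw [etaCocycle, etaCocycle, etaCocycle, mul_smul]
  field_simp

theorem etaCocycle_one (h : ℤ) (τ : UpperHalfPlane) : etaCocycle h 1 τ = 1 := by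
  rw [etaCocycle, one_smul, div_self (zpow_ne_zero h (eta_ne_zero (im_coe_pos τ)))]

theorem autFactor_one (τ : UpperHalfPlane) : autFactor 1 τ = 1 := by simp [autFactor]

/-- The exponents of the automorphy factors form a cocycle. -/
theorem autFactor_exponent (A B : SL(2, ℤ)) (τ : UpperHalfPlane) :
    ((A * B) 1 0 : ℂ) / autFactor (A * B) τ =
      (A 1 0 : ℂ) / (autFactor B τ ^ 2 * autFactor A (B • τ)) + (B 1 0 : ℂ) / autFactor B τ := by
  have h1 := autFactor_ne_zero B τ
  have h2 := autFactor_ne_zero A (B • τ)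
  have h3 : autFactor A (B • τ) * autFactor B τ = autFactor (A * B) τ := (autFactor_mul A B τ).symm
  have hdet : (B 0 0 : ℂ) * B 1 1 - B 0 1 * B 1 0 = 1 := by
    have := B.det_coe
    rw [Matrix.det_fin_two] at this
    exact_mod_cast this
  have key : ((A * B) 1 0 : ℂ) * autFactor B τ = A 1 0 + B 1 0 * autFactor (A * B) τ := by
    rw [autFactor, autFactor]
    simp only [Matrix.SpecialLinearGroup.coe_mul, Matrix.mul_apply, Fin.sum_univ_two]
    push_cast
    linear_combination (A 1 0 : ℂ) * hdet
  rw [← h3] at key ⊢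
  field_simp
  linear_combination key

/-- The modular transformation law of the Jacobi theta function. -/
theorem theta_modular (A : SL(2, ℤ)) (τ : UpperHalfPlane) (z : ℂ) :
    theta (A • τ) ((autFactor A τ)⁻¹ * z) =
      e ((A 1 0 : ℂ) / autFactor A τ * (z ^ 2 / 2)) * (autFactor A τ)⁻¹ * etaCocycle 3 A τ *
        theta τ z := by
  -- The automorphy factors are cocycles, so the law needs direct verification only for the
  -- generators.
  have hA : A ∈ Subgroup.closure {ModularGroup.S, ModularGroup.T} := by
    rw [SpecialLinearGroup.SL2Z_generators]; trivial
  induction hA using Subgroup.closure_induction generalizing τ z with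
  | mem A hA =>
    rcases hA with rfl | rfl
    · have hS : ((ModularGroup.S • τ : UpperHalfPlane) : ℂ) = -1 / τ := by
        rw [coe_smul, autFactor]; simp [ModularGroup.S]
      have h1 := theta_neg_one_div τ _ hS z
      have hj : autFactor ModularGroup.S τ = τ := by simp [autFactor, ModularGroup.S]
      have hτ0 : (τ : ℂ) ≠ 0 := τ.ne_zero
      have h2 := neg_I_mul_cpow_half_sq τ
      have h3 := eta_ne_zero (im_coe_pos τ)
      rw [hj, ← div_eq_inv_mul, h1, etaCocycle, hS, eta_neg_one_div (im_coe_pos τ)]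
      rw [mul_zpow, mul_div_assoc, div_self (zpow_ne_zero _ h3), mul_one]
      -- With s = (-iτ)^{1/2}, the factor τ⁻¹ s³ required by the law is -i s, since s² = -iτ.
      have h4 : (-I * (τ : ℂ) : ℂ) ^ (1 / 2 : ℂ) * (-I * τ) =
          ((-I * (τ : ℂ) : ℂ) ^ (1 / 2 : ℂ)) ^ (3 : ℤ) := by
        have : ∀ s : ℂ, s ^ 2 = -I * τ → s * (-I * τ) = s ^ (3 : ℤ) := fun s hs => by
          rw [← hs]; norm_cast; ring
        exact this _ h2
      rw [← h4, show z ^ 2 / (2 * (τ : ℂ)) = (ModularGroup.S 1 0 : ℂ) / τ * (z ^ 2 / 2) by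
        simp [ModularGroup.S]; field_simp]
      field_simp
    · have hT : ((ModularGroup.T • τ : UpperHalfPlane) : ℂ) = τ + 1 := by
        rw [coe_smul, autFactor]; simp [ModularGroup.T]
      have h1 := theta_add_one τ _ hT z
      have hj : autFactor ModularGroup.T τ = 1 := by simp [autFactor, ModularGroup.T]
      have h3 := eta_ne_zero (im_coe_pos τ)
      rw [hj, inv_one, one_mul, h1, etaCocycle, hT, eta_add_one]
      rw [mul_zpow, mul_div_assoc, div_self (zpow_ne_zero _ h3), mul_one]
      have : e (1 / 24) ^ (3 : ℤ) = e (1 / 8) := by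
        have := e_natCast_mul 3 (1 / 24)
        norm_cast at this ⊢
        rw [← this]; congr 1; norm_num
      rw [this]
      simp [ModularGroup.T]
  | one => simp [autFactor_one, etaCocycle_one]
  | mul A B _ _ hA hB =>
    have h := hA (B • τ) ((autFactor B τ)⁻¹ * z)
    rw [← mul_assoc, ← mul_inv, ← autFactor_mul, ← mul_smul] at h
    rw [h, hB, autFactor_exponent, etaCocycle_mul, autFactor_mul, mul_inv, add_mul, e_add]
    have h1 := autFactor_ne_zero B τ
    have h2 := autFactor_ne_zero A (B • τ)
    have : (A 1 0 : ℂ) / autFactor A (B • τ) * (((autFactor B τ)⁻¹ * z) ^ 2 / 2) =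
        (A 1 0 : ℂ) / (autFactor B τ ^ 2 * autFactor A (B • τ)) * (z ^ 2 / 2) := by
      field_simp
    rw [this]
    ring
  | inv A _ hA =>
    have h := hA (A⁻¹ • τ) ((autFactor A⁻¹ τ)⁻¹ * z)
    have hj : autFactor A (A⁻¹ • τ) * autFactor A⁻¹ τ = 1 := by
      rw [← autFactor_mul, mul_inv_cancel, autFactor_one]
    have he : etaCocycle 3 A (A⁻¹ • τ) * etaCocycle 3 A⁻¹ τ = 1 := by
      rw [← etaCocycle_mul, mul_inv_cancel, etaCocycle_one]
    have hx := autFactor_exponent A A⁻¹ τ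
    rw [mul_inv_cancel, autFactor_one] at hx
    have h1 := autFactor_ne_zero A⁻¹ τ
    have h2 := autFactor_ne_zero A (A⁻¹ • τ)
    rw [← mul_assoc, ← mul_inv, hj, inv_one, one_mul, smul_inv_smul] at h
    rw [h]
    have h4 : e ((A⁻¹ 1 0 : ℂ) / autFactor A⁻¹ τ * (z ^ 2 / 2)) *
        e ((A 1 0 : ℂ) / autFactor A (A⁻¹ • τ) * (((autFactor A⁻¹ τ)⁻¹ * z) ^ 2 / 2)) = 1 := by
      rw [← e_add]
      convert e_zero using 2
      have h10 : (((1 : SL(2, ℤ)) 1 0 : ℤ) : ℂ) = 0 := by simp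
      rw [h10, zero_div] at hx
      have : (A 1 0 : ℂ) / autFactor A (A⁻¹ • τ) * (((autFactor A⁻¹ τ)⁻¹ * z) ^ 2 / 2) =
        (A 1 0 : ℂ) / (autFactor A⁻¹ τ ^ 2 * autFactor A (A⁻¹ • τ)) * (z ^ 2 / 2) := by
        field_simp
      rw [this]
      linear_combination -(z ^ 2 / 2) * hx
    have h5 : (autFactor A⁻¹ τ)⁻¹ * (autFactor A (A⁻¹ • τ))⁻¹ = 1 := by
      rw [← mul_inv, mul_comm, hj, inv_one]
    set x1 := e ((A⁻¹ 1 0 : ℂ) / autFactor A⁻¹ τ * (z ^ 2 / 2))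
    set x2 := e ((A 1 0 : ℂ) / autFactor A (A⁻¹ • τ) * (((autFactor A⁻¹ τ)⁻¹ * z) ^ 2 / 2))
    set y1 := (autFactor A⁻¹ τ)⁻¹
    set y2 := (autFactor A (A⁻¹ • τ))⁻¹
    set w1 := etaCocycle 3 A⁻¹ τ
    set w2 := etaCocycle 3 A (A⁻¹ • τ)
    set t := theta (A⁻¹ • τ) (y1 * z)
    calc t = 1 * 1 * 1 * t := by ring
      _ = (x1 * x2) * (y1 * y2) * (w2 * w1) * t := by rw [h4, h5, he]
      _ = _ := by ring

end JacobiTheta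

end LatticeJacobi

end

noncomputable section

namespace LatticeJacobi

/-! ### Zeros of ϑ in z, and growth of ϑ, η and Δ at the cusp. -/

section ThetaGrowth

open Complex hiding eta
open Filter Topology ModularForm
open UpperHalfPlane hiding I

/-- If ϑ vanished at all points 2k√2, independence of characters would kill the coefficient of r =
1, which is e(τ/8). -/
theorem exists_theta_ne_zero (τ : UpperHalfPlane) : ∃ z, theta τ z ≠ 0 := by
  by_contra! h
  have hs : Summable fun r : ℤ => (ZMod.χ₄ (r : ZMod 4) : ℂ) * e ((r : ℂ) ^ 2 / 8 * τ) := by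
    simpa using (hasSum_theta τ 0).summable
  have key := eq_zero_of_forall_tsum_mul_pow_eq_zero hs
    (w := fun k : ℤ => e (k * (Real.sqrt 2 : ℝ))) (fun k => by
      have := norm_e_real (k * Real.sqrt 2); push_cast at this; exact this)
    irrational_combination_injective (fun k => ?_) 1
  · simp [e_ne_zero] at key
  · refine Eq.trans (tsum_congr fun r => ?_) (h (2 * k * (Real.sqrt 2 : ℝ)))
    rw [mul_assoc, ← e_natCast_mul, ← e_add]
    congr 2
    ring

/-- Zeros along a complex line are isolated by the identity theorem. In this form finitely many
theta factors can be made non-zero at once. -/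
theorem theta_eventually_ne_zero (τ : UpperHalfPlane) {a : ℂ} (ha : a ≠ 0) (b t₀ : ℂ) :
    ∀ᶠ t in 𝓝[≠] t₀, theta τ (b + t * a) ≠ 0 := by
  have hd : Differentiable ℂ fun t : ℂ => theta τ (b + t * a) :=
    (theta_differentiable τ).comp (f := fun t : ℂ => b + t * a) (by fun_prop)
  have han : AnalyticOnNhd ℂ (fun t : ℂ => theta τ (b + t * a)) Set.univ :=
    fun z _ => hd.analyticAt z
  rcases (han t₀ trivial).eventually_eq_zero_or_eventually_ne_zero with h | h
  · exfalso
    obtain ⟨z, hz⟩ := exists_theta_ne_zero τ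
    have := han.eqOn_zero_of_preconnected_of_eventuallyEq_zero isPreconnected_univ
      (Set.mem_univ t₀) h (Set.mem_univ ((z - b) / a))
    simp only [Pi.zero_apply, div_mul_cancel₀ _ ha, add_sub_cancel] at this
    exact hz this
  · exact h

theorem norm_theta_term (k : ℤ) (z τ : ℂ) :
    ‖jacobiTheta₂_term k (z + τ / 2 + 1 / 2) τ‖ =
      Real.exp (-(Real.pi * (k * (k + 1)) * τ.im) - 2 * Real.pi * k * z.im) := by
  rw [norm_jacobiTheta₂_term]
  congr 1
  have : (z + τ / 2 + 1 / 2).im = z.im + τ.im / 2 := by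
    simp
  rw [this]
  ring

theorem int_mul_succ_nonneg (k : ℤ) : (0 : ℝ) ≤ k * (k + 1) := by
  have : 0 ≤ k * (k + 1) := by
    rcases le_or_gt 0 k with h | h
    · positivity
    · nlinarith
  exact_mod_cast this

/-- The k-th term decays like exp(-πk(k+1) Im τ), so only k = 0 and k = -1 survive. For Im τ ≥ 1 the
terms at τ = i dominate. -/
theorem tendsto_theta_factor (z : ℂ) :
    Tendsto (fun τ : UpperHalfPlane => jacobiTheta₂ (z + τ / 2 + 1 / 2) τ) atImInfty
      (𝓝 (1 - e (-z))) := by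
  have hsum : ∑' k : ℤ, (if k = 0 then (1 : ℂ) else if k = -1 then -e (-z) else 0) =
      1 - e (-z) := by
    rw [tsum_eq_sum (s := {0, -1})]
    · simp [sub_eq_add_neg]
    · intro k hk
      simp only [Finset.mem_insert, Finset.mem_singleton, not_or] at hk
      simp [hk]
  rw [← hsum]
  have hI : (0 : ℝ) < I.im := by simp
  refine tendsto_tsum_of_dominated_convergence
    (bound := fun k => ‖jacobiTheta₂_term k (z + I / 2 + 1 / 2) I‖)
    ((summable_jacobiTheta₂_term_iff _ _).2 hI).norm (fun k => ?_) ?_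
  · by_cases h0 : k = 0
    · subst h0; simp [jacobiTheta₂_term]
    by_cases h1 : k = -1
    · subst h1
      simp only [jacobiTheta₂_term]
      refine tendsto_const_nhds.congr fun τ => ?_
      have : -e (-z) = e (-z - 1 / 2) := by
        rw [neg_eq_neg_one_mul, ← e_half, ← e_add, e_eq_e_iff]
        exact ⟨1, by push_cast; ring⟩
      simp only [neg_eq_zero, one_ne_zero, if_true, if_false]
      rw [this, e]
      congr 1
      push_cast
      ring
    · simp only [h0, h1, if_false]
      rw [tendsto_zero_iff_norm_tendsto_zero]
      have hpos : (0 : ℝ) < k * (k + 1) := by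
        have : 0 < k * (k + 1) := by
          rcases lt_trichotomy 0 k with h | h | h
          · positivity
          · omega
          · have : k + 1 < 0 := by omega
            nlinarith
        exact_mod_cast this
      simp_rw [norm_theta_term]
      refine Real.tendsto_exp_atBot.comp ?_
      have h2 : Tendsto (fun τ : UpperHalfPlane => (τ : ℂ).im) atImInfty atTop := tendsto_comap
      have h3 := (h2.const_mul_atTop (by positivity : 0 < Real.pi * (k * (k + 1) : ℝ)))
      exact tendsto_atBot_add_const_right _ _ (tendsto_neg_atTop_atBot.comp h3)
  · have : ∀ᶠ τ : UpperHalfPlane in atImInfty, 1 ≤ τ.im :=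
      (atImInfty_mem _).2 ⟨1, fun z hz => hz⟩
    filter_upwards [this] with τ hτ k
    rw [norm_theta_term, norm_theta_term]
    refine Real.exp_le_exp.2 (sub_le_sub_right (neg_le_neg ?_) _)
    have h1 : (0 : ℝ) ≤ Real.pi * (k * (k + 1)) := mul_nonneg Real.pi_pos.le (int_mul_succ_nonneg k)
    rw [Complex.I_im]
    exact mul_le_mul_of_nonneg_left hτ h1

/-- A lower bound for the Jacobi theta function near the cusp. -/
theorem exists_le_norm_theta {z : ℂ} (hz : ∀ m : ℤ, z ≠ m) :
    ∃ c : ℝ, 0 < c ∧ ∀ᶠ τ : UpperHalfPlane in atImInfty,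
      c * Real.exp (-(Real.pi / 4 * τ.im)) ≤ ‖theta τ z‖ := by
  have h0 : 1 - e (-z) ≠ 0 := by
    intro h
    obtain ⟨m, hm⟩ := e_eq_one_iff.1 (sub_eq_zero.1 h).symm
    exact hz (-m) (by rw [← neg_neg z, hm]; push_cast; rfl)
  have h1 := (tendsto_theta_factor z).norm.eventually
    (lt_mem_nhds (half_lt_self (norm_pos_iff.2 h0)))
  -- Half the modulus of the limit, times |e(z/2)|; the remaining factor |e(τ/8)| is the exponential
  -- in the bound.
  refine ⟨‖1 - e (-z)‖ / 2 * Real.exp (-(Real.pi * z.im)), by positivity, ?_⟩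
  filter_upwards [h1] with τ hτ
  rw [theta_eq, norm_mul, norm_e]
  have : -(2 * Real.pi * ((τ : ℂ) / 8 + z / 2).im) = -(Real.pi * z.im) + -(Real.pi / 4 * τ.im) := by
    simp
    ring
  rw [this, Real.exp_add]
  have h2 := Real.exp_pos (-(Real.pi * z.im))
  have h3 := Real.exp_pos (-(Real.pi / 4 * τ.im))
  calc _ = ‖1 - e (-z)‖ / 2 * (Real.exp (-(Real.pi * z.im)) * Real.exp (-(Real.pi / 4 * τ.im))) := by
        ring
    _ ≤ ‖jacobiTheta₂ (z + τ / 2 + 1 / 2) τ‖ *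
        (Real.exp (-(Real.pi * z.im)) * Real.exp (-(Real.pi / 4 * τ.im))) := by gcongr
    _ = _ := by ring

/-- Since η^24 = Δ tends to zero at the cusp. -/
theorem eventually_norm_eta_le_one : ∀ᶠ τ : UpperHalfPlane in atImInfty, ‖eta τ‖ ≤ 1 := by
  have h : Tendsto (fun τ : UpperHalfPlane => ‖discriminant τ‖) atImInfty (𝓝 0) :=
    tendsto_zero_iff_norm_tendsto_zero.1 discriminant_isZeroAtImInfty
  filter_upwards [h.eventually (ge_mem_nhds zero_lt_one)] with τ hτ
  rw [discriminant, norm_pow] at hτ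
  exact (pow_le_one_iff_of_nonneg (norm_nonneg _) (by norm_num)).1 hτ

theorem discriminant_isBigO_exp :
    (fun τ : UpperHalfPlane => discriminant τ) =O[atImInfty]
      fun τ => Real.exp (-(2 * Real.pi * τ.im)) := by
  have := CuspFormClass.exp_decay_atImInfty (h := 1) CuspForm.discriminant one_pos
    one_mem_strictPeriods_SL
  simpa using this

end ThetaGrowth

/-! ### Modular forms without zeros and the constancy criterion. -/

section ModularConstant

open Complex hiding eta
open Filter Topology ModularForm
open UpperHalfPlane hiding I

open scoped MatrixGroups Manifold

/-- A function that is invariant under the generators of the modular group, holomorphic, and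
bounded at infinity is a modular form of level one. -/
theorem exists_modularForm {k : ℤ} {f : UpperHalfPlane → ℂ} (hS : f ∣[k] ModularGroup.S = f)
    (hT : f ∣[k] ModularGroup.T = f) (hf : DifferentiableOn ℂ (f ∘ ofComplex) {z | 0 < z.im})
    (hb : IsBoundedAtImInfty f) : ∃ M : ModularForm 𝒮ℒ k, ⇑M = f := by
  have hinv := SlashInvariantForm.slash_action_generators_SL2Z hS hT
  refine ⟨{ toFun := f
            slash_action_eq' := fun _ ⟨γ, hγ⟩ => hγ ▸ hinv γ
            holo' := UpperHalfPlane.mdifferentiable_iff.2 hf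
            bdd_at_cusps' := fun {c} hc => ?_ }, rfl⟩
  rw [Subgroup.IsArithmetic.isCusp_iff_isCusp_SL2Z] at hc
  rw [OnePoint.isBoundedAt_iff_forall_SL2Z hc]
  intro γ _
  rw [hinv]
  exact hb

/-- Induction by dividing by Δ. If the constant term of M vanishes, M/Δ is again a form without
zeros, of weight lower by 12. If it does not, 1/M is a modular form of negative weight, hence zero,
which is absurd. -/
theorem eq_discriminant_pow_of_ne_zero (K : ℕ) : ∀ {k : ℤ} (_ : k = 12 * K) (M : ModularForm 𝒮ℒ k)
    (_ : ∀ τ, M τ ≠ 0), ∃ c : ℂ, ∀ τ, M τ = c * discriminant τ ^ K := by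
  induction K with
  | zero =>
    intro k hk M _
    obtain rfl : k = 0 := by simpa using hk
    obtain ⟨c, hc⟩ := ModularFormClass.levelOne_weight_zero_const M
    exact ⟨c, fun τ => by rw [hc]; simp⟩
  | succ K ih =>
    intro k hk M hM
    by_cases h0 : (qExpansion 1 M).coeff 0 = 0
    · have hd : ∀ τ, CuspForm.discriminantEquiv (toCuspForm M h0) τ = M τ / discriminant τ :=
        fun τ => rfl
      obtain ⟨c, hc⟩ := ih (by rw [hk]; push_cast; ring)
        (CuspForm.discriminantEquiv (toCuspForm M h0)) fun τ => by
          rw [hd]; exact div_ne_zero (hM τ) (discriminant_ne_zero τ)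
      refine ⟨c, fun τ => ?_⟩
      have := hc τ
      rw [hd, div_eq_iff (discriminant_ne_zero τ)] at this
      rw [this]; ring
    · exfalso
      have hlim : Tendsto M atImInfty (𝓝 (cuspFunction 1 M 0)) :=
        ((ModularFormClass.analyticAt_cuspFunction_zero M one_pos
          one_mem_strictPeriods_SL).continuousAt.tendsto.comp
          (qParam_tendsto_atImInfty one_pos)).congr
          (fun τ => SlashInvariantFormClass.eq_cuspFunction M τ one_mem_strictPeriods_SL one_ne_zero)
      rw [qExpansion_coeff_zero one_pos
        (ModularFormClass.analyticAt_cuspFunction_zero M one_pos one_mem_strictPeriods_SL)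
        (SlashInvariantFormClass.periodic_comp_ofComplex M one_mem_strictPeriods_SL),
        ← cuspFunction_apply_zero one_pos
        (ModularFormClass.analyticAt_cuspFunction_zero M one_pos one_mem_strictPeriods_SL)
        (SlashInvariantFormClass.periodic_comp_ofComplex M one_mem_strictPeriods_SL)] at h0
      have hslash : ∀ γ : SL(2, ℤ), (fun τ => (M τ)⁻¹) ∣[-k] γ = fun τ => (M τ)⁻¹ := by
        intro γ
        ext τ
        have h1 : ((⇑M) ∣[k] γ) τ = M τ := congrFun (M.slash_action_eq' _ ⟨γ, rfl⟩) τ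
        rw [SL_slash_apply] at h1 ⊢
        rw [← h1, mul_inv, ← zpow_neg]
      obtain ⟨M', hM'⟩ := exists_modularForm (hslash ModularGroup.S) (hslash ModularGroup.T)
        (by
          have := UpperHalfPlane.mdifferentiable_iff.1 M.holo'
          exact this.inv fun z _ => hM _)
        (by
          exact (hlim.inv₀ h0).isBigO_one ℝ)
      have := ModularFormClass.levelOne_neg_weight_eq_zero (k := -k) (by rw [hk]; push_cast; linarith) M'
      have h2 := congrFun this UpperHalfPlane.I
      rw [hM'] at h2
      exact inv_ne_zero (hM _) h2

theorem modular_relation (τ : UpperHalfPlane) :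
    ModularGroup.S • ModularGroup.T • ModularGroup.S • ModularGroup.T • ModularGroup.S •
      ModularGroup.T • τ = τ := by
  have h : ModularGroup.S * ModularGroup.T * (ModularGroup.S * ModularGroup.T) *
      (ModularGroup.S * ModularGroup.T) = -1 := by
    decide
  have h2 : (-1 : SL(2, ℤ)) • τ = τ := by
    rw [ModularGroup.SL_neg_smul, one_smul]
  rw [← h] at h2
  simpa only [mul_smul] using h2

/-- A holomorphic function without zeros on the upper half-plane that is invariant up to constants
under the modular group, and whose inverse has at most exponential growth at the cusp, is
constant. -/
theorem eq_const_of_multiplicative {f : UpperHalfPlane → ℂ} (hf0 : ∀ τ, f τ ≠ 0)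
    (hf : DifferentiableOn ℂ (f ∘ ofComplex) {z | 0 < z.im}) {χ κ : ℂ}
    (hT : ∀ τ : UpperHalfPlane, f (ModularGroup.T • τ) = χ * f τ)
    (hS : ∀ τ : UpperHalfPlane, f (ModularGroup.S • τ) = κ * f τ) {C : ℝ}
    (hb : (fun τ : UpperHalfPlane => (f τ)⁻¹) =O[atImInfty] fun τ => Real.exp (C * τ.im)) :
    ∃ γ, ∀ τ, f τ = γ := by
  -- S² = -1 acts trivially on ℍ, and so does (ST)³ in the next relation; f has no zeros, so its
  -- values cancel.
  have hκ : κ ^ 2 = 1 := by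
    have h1 := hS (ModularGroup.S • UpperHalfPlane.I)
    have h2 : ModularGroup.S • ModularGroup.S • UpperHalfPlane.I = UpperHalfPlane.I := by
      have h : ModularGroup.S * ModularGroup.S = -1 := by decide
      rw [← mul_smul, h, ModularGroup.SL_neg_smul, one_smul]
    rw [h2, hS] at h1
    have := hf0 UpperHalfPlane.I
    refine mul_right_cancel₀ this ?_
    linear_combination -h1
  have hκχ : κ ^ 3 * χ ^ 3 = 1 := by
    have h1 := congrArg f (modular_relation UpperHalfPlane.I)
    simp only [hS, hT] at h1
    have := hf0 UpperHalfPlane.I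
    refine mul_right_cancel₀ this ?_
    linear_combination h1
  have hκ6 : κ ^ 6 = 1 := by rw [show 6 = 2 * 3 from rfl, pow_mul, hκ, one_pow]
  have hχ6 : χ ^ 6 = 1 := by
    have : (κ ^ 3 * χ ^ 3) ^ 2 = κ ^ 6 * χ ^ 6 := by ring
    rw [hκχ, hκ6] at this
    linear_combination -this
  -- So large that the decay exp(-2πK Im τ) of Δ^K outweighs the growth exp(6C Im τ) of f^{-6}.
  obtain ⟨K, hK⟩ := exists_nat_ge (6 * C / (2 * Real.pi))
  set F : UpperHalfPlane → ℂ := fun τ => (f τ)⁻¹ ^ 6 * discriminant τ ^ K with hF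
  have hslash : ∀ (γ : SL(2, ℤ)) (c : ℂ), c ^ 6 = 1 → (∀ τ, f (γ • τ) = c * f τ) →
      discriminant ∣[(12 : ℤ)] γ = discriminant → F ∣[(12 * K : ℤ)] γ = F := by
    intro γ c hc hγ hΔ
    ext τ
    have h1 := congrFun hΔ τ
    rw [SL_slash_apply] at h1 ⊢
    have h2 : denom γ τ ^ (-(12 * (K : ℤ))) = (denom γ τ ^ (-12 : ℤ)) ^ K := by
      rw [← zpow_natCast, ← zpow_mul, neg_mul]
    simp only [hF]
    rw [hγ, mul_inv, mul_pow, inv_pow c, hc, ← h1, h2, mul_pow]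
    ring
  have hFS := hslash _ _ hκ6 hS discriminant_S_invariant
  have hFT := hslash _ _ hχ6 hT discriminant_T_invariant
  have hΔ : DifferentiableOn ℂ (discriminant ∘ ofComplex) {z | 0 < z.im} :=
    UpperHalfPlane.mdifferentiable_iff.1 CuspForm.discriminant.holo'
  have hFd : DifferentiableOn ℂ (F ∘ ofComplex) {z | 0 < z.im} :=
    ((hf.inv fun z _ => hf0 _).pow 6).mul (hΔ.pow K)
  have hFb : IsBoundedAtImInfty F := by
    have h1 := (hb.pow 6).mul (discriminant_isBigO_exp.pow K)
    refine h1.trans ?_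
    refine Asymptotics.IsBigO.of_bound 1 ?_
    filter_upwards with τ
    rw [← Real.exp_nat_mul, ← Real.exp_nat_mul, ← Real.exp_add, Real.norm_eq_abs, Real.abs_exp]
    simp only [Pi.one_apply, norm_one, mul_one, Nat.cast_ofNat]
    rw [Real.exp_le_one_iff]
    rw [div_le_iff₀ (by positivity)] at hK
    have := mul_le_mul_of_nonneg_right hK τ.im_pos.le
    nlinarith
  obtain ⟨M, hM⟩ := exists_modularForm hFS hFT hFd hFb
  have hF0 : ∀ τ, F τ ≠ 0 := fun τ =>
    mul_ne_zero (pow_ne_zero _ (inv_ne_zero (hf0 τ))) (pow_ne_zero _ (discriminant_ne_zero τ))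
  obtain ⟨c, hc⟩ := eq_discriminant_pow_of_ne_zero K rfl M fun τ => by rw [hM]; exact hF0 τ
  have hf6 : ∀ τ, f τ ^ 6 = c⁻¹ := by
    intro τ
    have h1 := hc τ
    rw [hM] at h1
    have h2 := mul_right_cancel₀ (pow_ne_zero _ (discriminant_ne_zero τ)) h1
    rw [← h2, inv_pow, inv_inv]
  have hopen : IsOpen {z : ℂ | 0 < z.im} := isOpen_upperHalfPlaneSet
  -- Differentiating the constant f^6 gives 6 f^5 f' = 0, and f has no zeros.
  have hder : ∀ z ∈ {z : ℂ | 0 < z.im}, deriv (f ∘ ofComplex) z = 0 := by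
    intro z hz
    have hd := (hf z hz).differentiableAt (hopen.mem_nhds hz)
    have h1 := hd.hasDerivAt.pow 6
    have h2 : HasDerivAt (fun w => (f ∘ ofComplex) w ^ 6) 0 z := by
      simp only [Function.comp_apply, hf6]
      exact hasDerivAt_const z _
    have h3 := h1.unique h2
    have h4 : f (ofComplex z) ≠ 0 := hf0 _
    simpa [h4] using h3
  refine ⟨f UpperHalfPlane.I, fun τ => ?_⟩
  have := hopen.is_const_of_deriv_eq_zero (convex_halfSpace_im_gt 0).isPreconnected hf hder
    (show (τ : ℂ) ∈ {z : ℂ | 0 < z.im} from τ.im_pos)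
    (show ((UpperHalfPlane.I : UpperHalfPlane) : ℂ) ∈ {z : ℂ | 0 < z.im} from
      UpperHalfPlane.I.im_pos)
  rwa [Function.comp_apply, Function.comp_apply, ofComplex_apply, ofComplex_apply] at this

end ModularConstant

end LatticeJacobi

end

noncomputable section

namespace LatticeJacobi

/-! ### The form on ℚ ⊗ L and ℂ ⊗ L. -/

section Extension

variable {L : Type*} [AddCommGroup L] (β : LinearMap.BilinForm ℤ L)

theorem bilinQ_tmul (a b : ℚ) (x y : L) :
    bilinQ β (a ⊗ₜ x) (b ⊗ₜ y) = a * b * β x y := by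
  rw [bilinQ, LinearMap.BilinForm.baseChange_tmul, zsmul_eq_mul, mul_comm]

theorem bilinC_tmul (a b : ℂ) (x y : L) :
    bilinC β (a ⊗ₜ x) (b ⊗ₜ y) = a * b * β x y := by
  rw [bilinC, LinearMap.BilinForm.baseChange_tmul, zsmul_eq_mul, mul_comm]

theorem toRat_apply (x : L) : toRat x = (1 : ℚ) ⊗ₜ[ℤ] x := rfl

@[simp] theorem bilinQ_toRat (x y : L) : bilinQ β (toRat x) (toRat y) = β x y := by
  rw [toRat_apply, toRat_apply, bilinQ_tmul]; ring

theorem quadQ_toRat (x : L) : quadQ β (toRat x) = (β x x : ℚ) / 2 := by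
  rw [quadQ, bilinQ_toRat]

theorem ratToComplex_tmul (q : ℚ) (x : L) :
    ratToComplex (q ⊗ₜ[ℤ] x) = (q : ℂ) ⊗ₜ[ℤ] x := rfl

theorem ratToComplex_smul (q : ℚ) (v : ℚ ⊗[ℤ] L) :
    ratToComplex (q • v) = (q : ℂ) • ratToComplex v := by
  induction v using TensorProduct.induction_on with
  | zero => simp
  | tmul a x =>
    rw [TensorProduct.smul_tmul', ratToComplex_tmul, ratToComplex_tmul, TensorProduct.smul_tmul']
    simp
  | add v w hv hw => rw [smul_add, map_add, map_add, smul_add, hv, hw]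

theorem ratToComplex_toRat (x : L) : ratToComplex (toRat x) = (1 : ℂ) ⊗ₜ[ℤ] x := by
  rw [toRat_apply, ratToComplex_tmul, Rat.cast_one]

theorem pairing_add_left (r r' : ℚ ⊗[ℤ] L) (z : ℂ ⊗[ℤ] L) :
    pairing β (r + r') z = pairing β r z + pairing β r' z := by simp [pairing]

theorem pairing_smul_left (q : ℚ) (r : ℚ ⊗[ℤ] L) (z : ℂ ⊗[ℤ] L) :
    pairing β (q • r) z = q * pairing β r z := by
  rw [pairing, ratToComplex_smul, map_smul, LinearMap.smul_apply, smul_eq_mul, pairing]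

theorem pairing_sub_left (r r' : ℚ ⊗[ℤ] L) (z : ℂ ⊗[ℤ] L) :
    pairing β (r - r') z = pairing β r z - pairing β r' z := by simp [pairing]

theorem pairing_sum_left {ι : Type*} (s : Finset ι) (r : ι → ℚ ⊗[ℤ] L) (z : ℂ ⊗[ℤ] L) :
    pairing β (∑ i ∈ s, r i) z = ∑ i ∈ s, pairing β (r i) z := by
  simp [pairing, map_sum, LinearMap.sum_apply]

theorem pairing_add_right (r : ℚ ⊗[ℤ] L) (z z' : ℂ ⊗[ℤ] L) :
    pairing β r (z + z') = pairing β r z + pairing β r z' := by simp [pairing]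

theorem pairing_smul_right (r : ℚ ⊗[ℤ] L) (c : ℂ) (z : ℂ ⊗[ℤ] L) :
    pairing β r (c • z) = c * pairing β r z := by simp [pairing]

theorem pairing_sum_right {ι : Type*} (s : Finset ι) (r : ℚ ⊗[ℤ] L) (z : ι → ℂ ⊗[ℤ] L) :
    pairing β r (∑ i ∈ s, z i) = ∑ i ∈ s, pairing β r (z i) := by
  simp [pairing, map_sum]

theorem pairing_tmul (r : ℚ ⊗[ℤ] L) (c : ℂ) (x : L) :
    pairing β r (c ⊗ₜ x) = c * bilinQ β r (toRat x) := by
  induction r using TensorProduct.induction_on with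
  | zero => simp [pairing]
  | tmul a y =>
    rw [pairing, ratToComplex_tmul, bilinC_tmul, toRat_apply, bilinQ_tmul]
    push_cast; ring
  | add v w hv hw => rw [pairing_add_left, hv, hw, map_add, LinearMap.add_apply]; push_cast; ring

variable {β} (hβ : β.IsSymm)

include hβ in
theorem bilinQ_comm (v w : ℚ ⊗[ℤ] L) : bilinQ β v w = bilinQ β w v := by
  induction v using TensorProduct.induction_on with
  | zero => simp
  | tmul a x =>
    induction w using TensorProduct.induction_on with
    | zero => simp
    | tmul b y =>
      rw [bilinQ_tmul, bilinQ_tmul, show β x y = β y x from hβ.eq x y]; ring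
    | add v w hv hw => rw [map_add, hv, hw, map_add, LinearMap.add_apply]
  | add v w hv hw => rw [map_add, LinearMap.add_apply, hv, hw, map_add]

include hβ in
theorem quadQ_add (v w : ℚ ⊗[ℤ] L) : quadQ β (v + w) = quadQ β v + bilinQ β v w + quadQ β w := by
  simp only [quadQ, map_add, LinearMap.add_apply]
  rw [bilinQ_comm hβ w v]; ring

theorem exists_nsmul_eq_toRat (v : ℚ ⊗[ℤ] L) : ∃ m : ℕ, 0 < m ∧ ∃ x : L, (m : ℚ) • v = toRat x := by
  induction v using TensorProduct.induction_on with
  | zero => exact ⟨1, one_pos, 0, by simp⟩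
  | tmul a x =>
    refine ⟨a.den, a.den_pos, a.num • x, ?_⟩
    rw [TensorProduct.smul_tmul', smul_eq_mul, Rat.den_mul_eq_num, toRat_apply,
      TensorProduct.tmul_smul, TensorProduct.smul_tmul', zsmul_eq_mul, mul_one]
  | add v w hv hw =>
    obtain ⟨m, hm, x, hx⟩ := hv
    obtain ⟨m', hm', x', hx'⟩ := hw
    refine ⟨m * m', Nat.mul_pos hm hm', m' • x + m • x', ?_⟩
    rw [map_add, map_nsmul, map_nsmul, ← hx, ← hx', smul_add, ← Nat.cast_smul_eq_nsmul ℚ,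
      ← Nat.cast_smul_eq_nsmul ℚ, smul_smul, smul_smul]
    push_cast
    rw [mul_comm (m' : ℚ)]

end Extension

/-- An orthogonal frame of `L_ev` with lengths `d`: the vectors `l i` are pairwise orthogonal, have
even square lengths `d i`, and span `ℚ ⊗ L`. -/
structure IsOrthoFrame {L : Type*} [AddCommGroup L] (β : LinearMap.BilinForm ℤ L) {n : ℕ}
    (l : Fin n → L) (d : Fin n → ℕ) : Prop where
  pos : ∀ i, 0 < d i
  apply : ∀ i j, β (l i) (l j) = if i = j then (d i : ℤ) else 0
  even : ∀ i, Even (d i)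
  expand : ∀ v, v = ∑ i, (bilinQ β (toRat (l i)) v / d i) • toRat (l i)

/-! ### Orthogonal frames, lattice theta series and uniqueness of coefficients. -/

section Frame

variable {L : Type*} [AddCommGroup L] {β : LinearMap.BilinForm ℤ L}

/-- Orthogonalize over ℚ, clear denominators and double: the factor 2 makes the square lengths 4β(x,
x) even, which puts the vectors in L_ev. -/
theorem exists_isOrthoFrame (hL : IsIntegralLattice β)
    (hpos : ∀ v : ℚ ⊗[ℤ] L, v ≠ 0 → 0 < bilinQ β v v) :
    ∃ (l : Fin (Module.finrank ℤ L) → L) (d : Fin (Module.finrank ℤ L) → ℕ),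
      IsOrthoFrame β l d := by
  have := hL.free
  have := hL.finite
  have hsymm : LinearMap.IsSymm (bilinQ β) := ⟨fun v w => by simpa using bilinQ_comm hL.symm v w⟩
  have : Invertible (2 : ℚ) := invertibleOfNonzero two_ne_zero
  obtain ⟨b, hb⟩ : ∃ b : Module.Basis (Fin (Module.finrank ℤ L)) ℚ (ℚ ⊗[ℤ] L),
      ∀ i j, i ≠ j → bilinQ β (b i) (b j) = 0 := by
    obtain ⟨b, hb⟩ := LinearMap.BilinForm.exists_orthogonal_basis hsymm
    refine ⟨b.reindex (finCongr Module.finrank_baseChange), fun i j hij => ?_⟩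
    rw [Module.Basis.reindex_apply, Module.Basis.reindex_apply]
    exact hb fun h => hij ((Equiv.injective _) h)
  choose m hm x hx using fun i => exists_nsmul_eq_toRat (b i)
  have hbb : ∀ i, 0 < bilinQ β (b i) (b i) := fun i => hpos _ (b.ne_zero i)
  have hl : ∀ i, toRat ((2 : ℤ) • x i) = (2 * m i : ℚ) • b i := fun i => by
    rw [map_zsmul, ← hx, ← Int.cast_smul_eq_zsmul ℚ, smul_smul]; rfl
  have hxx : ∀ i, 0 < β (x i) (x i) := fun i => by
    have h1 := bilinQ_toRat β (x i) (x i)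
    rw [← hx, map_smul, map_smul, LinearMap.smul_apply, smul_eq_mul, smul_eq_mul] at h1
    have h2 : (0 : ℚ) < m i := by exact_mod_cast hm i
    have h3 : (0 : ℚ) < β (x i) (x i) := by
      rw [← h1]; exact mul_pos h2 (mul_pos h2 (hbb i))
    exact_mod_cast h3
  have hd : ∀ i, (((4 * β (x i) (x i)).toNat : ℤ)) = 4 * β (x i) (x i) := fun i =>
    Int.toNat_of_nonneg (by have := hxx i; positivity)
  refine ⟨fun i => (2 : ℤ) • x i, fun i => (4 * β (x i) (x i)).toNat, ?_, ?_, ?_, ?_⟩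
  · intro i
    have := hd i
    have := hxx i
    omega
  · intro i j
    split_ifs with hij
    · subst hij
      rw [hd]
      simp
      ring
    · have h1 := bilinQ_toRat β ((2 : ℤ) • x i) ((2 : ℤ) • x j)
      rw [hl, hl, map_smul, map_smul, LinearMap.smul_apply] at h1
      have h2 : bilinQ β (b i) (b j) = 0 := hb i j hij
      rw [h2, smul_zero, smul_zero] at h1
      exact_mod_cast h1.symm
  · intro i
    have := hd i
    exact ⟨(2 * β (x i) (x i)).toNat, by have := hxx i; omega⟩
  · intro v
    have hrep := b.sum_repr v
    conv_lhs => rw [← hrep]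
    refine Finset.sum_congr rfl fun i _ => ?_
    have h1 : bilinQ β (b i) v = b.repr v i * bilinQ β (b i) (b i) := by
      conv_lhs => rw [← hrep]
      rw [map_sum, Finset.sum_eq_single i]
      · rw [map_smul, smul_eq_mul]
      · intro j _ hj
        have h2 : bilinQ β (b i) (b j) = 0 := hb i j hj.symm
        rw [map_smul, h2, smul_zero]
      · simp
    have h2 : ((4 * β (x i) (x i)).toNat : ℚ) = 4 * m i ^ 2 * bilinQ β (b i) (b i) := by
      have h3 : (((4 * β (x i) (x i)).toNat : ℤ) : ℚ) = 4 * (β (x i) (x i) : ℚ) := by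
        rw [hd]; push_cast; rfl
      have h4 := bilinQ_toRat β (x i) (x i)
      rw [← hx, map_smul, map_smul, LinearMap.smul_apply, smul_eq_mul, smul_eq_mul] at h4
      rw [← h4, Int.cast_natCast] at h3
      rw [h3]; ring
    rw [hl, map_smul, LinearMap.smul_apply, h1, h2, smul_smul, smul_eq_mul]
    congr 1
    have h5 : (m i : ℚ) ≠ 0 := by exact_mod_cast (hm i).ne'
    have h6 := (hbb i).ne'
    field_simp
    norm_num

variable {n : ℕ} {l : Fin n → L} {d : Fin n → ℕ} (hl : IsOrthoFrame β l d)

/-- The coordinates of a point of `ℂ ⊗ L` with respect to an orthogonal frame. -/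
def coord (β : LinearMap.BilinForm ℤ L) (l : Fin n → L) (d : Fin n → ℕ) (z : ℂ ⊗[ℤ] L)
    (i : Fin n) : ℂ :=
  pairing β (toRat (l i)) z / d i

/-- The vector of `ℚ ⊗ L` that has inner products `k` with the vectors of an orthogonal frame. -/
def dualVec (l : Fin n → L) (d : Fin n → ℕ) (k : Fin n → ℤ) : ℚ ⊗[ℤ] L :=
  ∑ i, ((k i : ℚ) / d i) • toRat (l i)

/-- The summand `q^{β(r)} e(β(r, z))` of the theta series of a lattice. -/
def latTerm (β : LinearMap.BilinForm ℤ L) (τ : ℂ) (z : ℂ ⊗[ℤ] L) (r : ℚ ⊗[ℤ] L) : ℂ :=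
  e ((quadQ β r : ℚ) * τ + pairing β r z)

namespace IsOrthoFrame

include hl

theorem cast_ne_zero (i : Fin n) : (d i : ℚ) ≠ 0 := by exact_mod_cast (hl.pos i).ne'

theorem ratToComplex_eq (v : ℚ ⊗[ℤ] L) :
    ratToComplex v = ∑ i, ((bilinQ β (toRat (l i)) v / d i : ℚ) : ℂ) ⊗ₜ[ℤ] l i := by
  conv_lhs => rw [hl.expand v]
  rw [map_sum]
  refine Finset.sum_congr rfl fun i _ => ?_
  rw [ratToComplex_smul, ratToComplex_toRat, TensorProduct.smul_tmul', smul_eq_mul, mul_one]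

theorem eq_sum_coord (z : ℂ ⊗[ℤ] L) : z = ∑ i, coord β l d z i ⊗ₜ[ℤ] l i := by
  induction z using TensorProduct.induction_on with
  | zero => simp [coord, pairing]
  | tmul a x =>
    have h1 : (a ⊗ₜ[ℤ] x : ℂ ⊗[ℤ] L) = a • ratToComplex (toRat x) := by
      rw [ratToComplex_toRat, TensorProduct.smul_tmul', smul_eq_mul, mul_one]
    conv_lhs => rw [h1, hl.ratToComplex_eq, Finset.smul_sum]
    refine Finset.sum_congr rfl fun i _ => ?_
    rw [TensorProduct.smul_tmul', coord, pairing_tmul, smul_eq_mul]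
    congr 1
    push_cast
    ring
  | add v w hv hw =>
    conv_lhs => rw [hv, hw]
    rw [← Finset.sum_add_distrib]
    refine Finset.sum_congr rfl fun i _ => ?_
    rw [coord, coord, coord, pairing_add_right, add_div, TensorProduct.add_tmul]

theorem pairing_frame_sum (ζ : Fin n → ℂ) (i : Fin n) :
    pairing β (toRat (l i)) (∑ j, ζ j ⊗ₜ[ℤ] l j) = d i * ζ i := by
  rw [pairing_sum_right, Finset.sum_eq_single i]
  · rw [pairing_tmul, bilinQ_toRat, hl.apply, if_pos rfl]
    push_cast
    ring
  · intro j _ hj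
    rw [pairing_tmul, bilinQ_toRat, hl.apply, if_neg hj.symm]
    simp
  · simp

theorem coord_sum (ζ : Fin n → ℂ) (i : Fin n) : coord β l d (∑ j, ζ j ⊗ₜ[ℤ] l j) i = ζ i := by
  have : (d i : ℂ) ≠ 0 := by exact_mod_cast (hl.pos i).ne'
  rw [coord, hl.pairing_frame_sum, mul_div_cancel_left₀ _ this]

theorem pairing_eq (r : ℚ ⊗[ℤ] L) (z : ℂ ⊗[ℤ] L) :
    pairing β r z = ∑ i, (bilinQ β (toRat (l i)) r : ℂ) * coord β l d z i := by
  conv_lhs => rw [hl.expand r]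
  rw [pairing_sum_left]
  refine Finset.sum_congr rfl fun i _ => ?_
  rw [pairing_smul_left, coord]
  push_cast
  ring

theorem bilinQ_eq (r r' : ℚ ⊗[ℤ] L) :
    bilinQ β r r' = ∑ i, bilinQ β (toRat (l i)) r * bilinQ β (toRat (l i)) r' / d i := by
  conv_lhs => rw [hl.expand r]
  rw [map_sum, LinearMap.sum_apply]
  refine Finset.sum_congr rfl fun i _ => ?_
  rw [map_smul, LinearMap.smul_apply, smul_eq_mul]
  ring

theorem quadQ_eq (r : ℚ ⊗[ℤ] L) :
    quadQ β r = ∑ i, bilinQ β (toRat (l i)) r ^ 2 / (2 * d i) := by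
  rw [quadQ, hl.bilinQ_eq, Finset.sum_div]
  refine Finset.sum_congr rfl fun i _ => ?_
  have := hl.cast_ne_zero i
  field_simp

theorem quadC_eq (z : ℂ ⊗[ℤ] L) : quadC β z = ∑ i, d i * coord β l d z i ^ 2 / 2 := by
  have h1 : ∀ (x : L), bilinC β ((1 : ℂ) ⊗ₜ[ℤ] x) z = pairing β (toRat x) z := fun x => by
    rw [pairing, ratToComplex_toRat]
  rw [quadC]
  conv_lhs => enter [1, 1]; rw [hl.eq_sum_coord z]
  rw [map_sum, LinearMap.sum_apply, Finset.sum_div]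
  refine Finset.sum_congr rfl fun i _ => ?_
  have h2 : coord β l d z i ⊗ₜ[ℤ] l i = coord β l d z i • ((1 : ℂ) ⊗ₜ[ℤ] l i) := by
    rw [TensorProduct.smul_tmul', smul_eq_mul, mul_one]
  have h3 : pairing β (toRat (l i)) z = d i * coord β l d z i := by
    have : (d i : ℂ) ≠ 0 := by exact_mod_cast (hl.pos i).ne'
    rw [coord, mul_div_cancel₀ _ this]
  rw [h2, map_smul, LinearMap.smul_apply, h1, h3, smul_eq_mul]
  ring

theorem bilinQ_dualVec (k : Fin n → ℤ) (i : Fin n) :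
    bilinQ β (toRat (l i)) (dualVec l d k) = k i := by
  rw [dualVec, map_sum, Finset.sum_eq_single i]
  · rw [map_smul, bilinQ_toRat, hl.apply, if_pos rfl, smul_eq_mul]
    have := hl.cast_ne_zero i
    push_cast
    field_simp
  · intro j _ hj
    rw [map_smul, bilinQ_toRat, hl.apply, if_neg hj.symm]
    simp
  · simp

theorem dualVec_injective : Function.Injective (dualVec (L := L) l d) := by
  intro k k' h
  ext i
  have h1 := hl.bilinQ_dualVec k i
  rw [h, hl.bilinQ_dualVec] at h1
  exact_mod_cast h1.symm

theorem eq_dualVec {r : ℚ ⊗[ℤ] L} {k : Fin n → ℤ} (h : ∀ i, bilinQ β (toRat (l i)) r = k i) :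
    r = dualVec l d k := by
  conv_lhs => rw [hl.expand r]
  rw [dualVec]
  exact Finset.sum_congr rfl fun i _ => by rw [h]

/-- Orthogonality of the frame splits both β(r) and β(r, z) into sums over the coordinates, reducing
lattice theta series to one variable. -/
theorem latTerm_dualVec (τ : ℂ) (z : ℂ ⊗[ℤ] L) (k : Fin n → ℤ) :
    latTerm β τ z (dualVec l d k) = ∏ i, thTerm (d i) τ (coord β l d z i) (k i) := by
  rw [latTerm, hl.quadQ_eq, hl.pairing_eq]
  simp only [hl.bilinQ_dualVec, thTerm, ← e_sum]
  rw [Finset.sum_add_distrib]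
  congr 2
  · push_cast
    rw [Finset.sum_mul]

variable [∀ i, NeZero (d i)]

theorem hasSum_dualVec {τ : ℂ} (hτ : 0 < τ.im) (z : ℂ ⊗[ℤ] L)
    (C : (∀ i, ZMod (d i)) → ℂ) :
    HasSum (fun k : Fin n → ℤ => C (fun i => k i) * latTerm β τ z (dualVec l d k))
      (∑ b, C b * ∏ i, th (d i) (b i) τ (coord β l d z i)) := by
  classical
  have h1 : ∀ b : ∀ i, ZMod (d i), HasSum (fun k : Fin n → ℤ => C b *
      ∏ i, if (k i : ZMod (d i)) = b i then thTerm (d i) τ (coord β l d z i) (k i) else 0)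
      (C b * ∏ i, th (d i) (b i) τ (coord β l d z i)) := fun b =>
    (hasSum_pi_prod (fun i (k : ℤ) => if (k : ZMod (d i)) = b i then
      thTerm (d i) τ (coord β l d z i) k else 0)
      fun i => summable_ite_thTerm hτ _ _).2.mul_left _
  refine (hasSum_sum (s := Finset.univ) fun b _ => h1 b).congr_fun fun k => ?_
  rw [Finset.sum_eq_single (fun i => (k i : ZMod (d i)))]
  · rw [hl.latTerm_dualVec]
    simp
  · intro b _ hb
    obtain ⟨i, hi⟩ := Function.ne_iff.1 hb
    rw [Finset.prod_eq_zero (Finset.mem_univ i), mul_zero]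
    rw [if_neg (fun h => hi h.symm)]
  · simp

/-- A periodic function on the dual of an orthogonal frame depends only on residue classes. -/
theorem hasSum_of_periodic {c : ℚ ⊗[ℤ] L → ℂ}
    (hsupp : ∀ r, c r ≠ 0 → ∀ i, ∃ m : ℤ, bilinQ β (toRat (l i)) r = m)
    (hper : ∀ r i, c (r + toRat (l i)) = c r) {τ : ℂ} (hτ : 0 < τ.im) (z : ℂ ⊗[ℤ] L) :
    HasSum (fun r => c r * latTerm β τ z r)
      (∑ b : ∀ i, ZMod (d i), c (dualVec l d fun i => (b i).cast) *
        ∏ i, th (d i) (b i) τ (coord β l d z i)) := by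
  rw [← hl.dualVec_injective.hasSum_iff]
  · refine (hl.hasSum_dualVec hτ z
      (fun b => c (dualVec l d fun i => ((b i).cast : ℤ)))).congr_fun fun k => ?_
    simp only [Function.comp_apply]
    congr 1
    have h0 : ∀ r i (m : ℤ), c (r + m • toRat (l i)) = c r := by
      intro r i m
      induction m using Int.induction_on with
      | zero => simp
      | succ m ih => rw [add_smul, one_smul, ← add_assoc, hper, ih]
      | pred m ih => rw [← hper, sub_smul, one_smul, add_assoc, sub_add_cancel, ih]
    have h1 : ∀ (s : Finset (Fin n)) (m : Fin n → ℤ) r,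
        c (r + ∑ i ∈ s, m i • toRat (l i)) = c r := by
      intro s m
      induction s using Finset.cons_induction with
      | empty => simp
      | cons i s hi ih => intro r; rw [Finset.sum_cons, ← add_assoc, ih, h0]
    have h2 : ∀ i, ∃ m : ℤ, k i = (((k i : ZMod (d i)).cast : ℤ)) + d i * m := fun i => by
      have : (((k i : ZMod (d i)).cast : ℤ) : ZMod (d i)) = k i := by simp
      rw [ZMod.intCast_eq_intCast_iff_dvd_sub] at this
      obtain ⟨m, hm⟩ := this
      exact ⟨m, by linarith⟩
    choose m hm using h2
    rw [← h1 Finset.univ m (dualVec l d fun i => ((k i : ZMod (d i)).cast : ℤ))]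
    congr 1
    rw [dualVec, dualVec, ← Finset.sum_add_distrib]
    refine Finset.sum_congr rfl fun i _ => ?_
    rw [← Int.cast_smul_eq_zsmul ℚ, ← add_smul]
    congr 1
    have h3 : (k i : ℚ) = (((k i : ZMod (d i)).cast : ℤ) : ℚ) + d i * m i := by exact_mod_cast hm i
    have := hl.cast_ne_zero i
    rw [h3]
    field_simp
  · intro r hr
    by_contra h
    have h1 : c r ≠ 0 := fun h0 => h (by rw [h0, zero_mul])
    choose k hk using hsupp r h1
    exact hr ⟨k, (hl.eq_dualVec hk).symm⟩

omit [∀ i, NeZero (d i)]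

/-- There is a real point `z₀` of `ℂ ⊗ L` on which no non-zero vector of `ℚ ⊗ L` takes a rational
value. -/
theorem exists_generic : ∃ z₀ : ℂ ⊗[ℤ] L, (∀ r, ∃ x : ℝ, pairing β r z₀ = x) ∧
    ∀ r, ∀ q : ℚ, pairing β r z₀ = q → r = 0 := by
  have hex : ∀ n : ℕ, ∃ u : Fin n → ℝ, LinearIndependent ℚ u := by
    intro n
    induction n with
    | zero => exact ⟨fun i => i.elim0, linearIndependent_empty_type⟩
    | succ n ih =>
      obtain ⟨u, hu⟩ := ih
      obtain ⟨x, hx⟩ := exists_linearIndependent_cons_of_lt_rank hu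
        (by rw [Real.rank_rat_real]; exact Cardinal.nat_lt_continuum n)
      exact ⟨_, hx⟩
  -- The additional number u₀ is a unit of measure: in the coordinates u_{i+1}/u₀ a rational value q
  -- of β(r, ·) becomes a rational relation with coefficient -q at u₀.
  obtain ⟨u, hu⟩ := hex (n + 1)
  have hu0 : u 0 ≠ 0 := hu.ne_zero 0
  have hpair : ∀ r, pairing β r (∑ i, ((u i.succ / u 0 : ℝ) : ℂ) ⊗ₜ[ℤ] l i) =
      ((∑ i, (bilinQ β (toRat (l i)) r : ℝ) * (u i.succ / u 0) : ℝ) : ℂ) := by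
    intro r
    rw [hl.pairing_eq, Complex.ofReal_sum]
    refine Finset.sum_congr rfl fun i _ => ?_
    rw [hl.coord_sum fun i => ((u i.succ / u 0 : ℝ) : ℂ), Complex.ofReal_mul,
      Complex.ofReal_ratCast]
  refine ⟨_, fun r => ⟨_, hpair r⟩, fun r q hq => ?_⟩
  rw [hpair] at hq
  have h1 : ∑ i, (bilinQ β (toRat (l i)) r : ℝ) * (u i.succ / u 0) = q := by exact_mod_cast hq
  have h2 : ∑ i : Fin (n + 1), (Fin.cons (-q) (fun i => bilinQ β (toRat (l i)) r) :
      Fin (n + 1) → ℚ) i • u i = 0 := by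
    rw [Fin.sum_univ_succ]
    simp only [Fin.cons_zero, Fin.cons_succ, Rat.smul_def]
    have h3 : ∑ i : Fin n, (bilinQ β (toRat (l i)) r : ℝ) * u i.succ = q * u 0 := by
      rw [← h1, Finset.sum_mul]
      exact Finset.sum_congr rfl fun i _ => by field_simp
    rw [h3]
    push_cast
    ring
  have h4 := Fintype.linearIndependent_iff.1 hu _ h2
  rw [hl.expand r]
  refine Finset.sum_eq_zero fun i _ => ?_
  have := h4 i.succ
  rw [Fin.cons_succ] at this
  rw [this, zero_div, zero_smul]

/-- Uniqueness of the coefficients of an absolutely convergent Fourier series. -/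
theorem fourier_unique {a : ℚ ⊗[ℤ] L → ℂ}
    (h : ∀ z, HasSum (fun r => a r * e (pairing β r z)) 0) (r : ℚ ⊗[ℤ] L) : a r = 0 := by
  -- Genericity makes r ↦ e(β(r, z₀)) injective with unimodular values; evaluation at the multiples
  -- k z₀ yields their k-th powers.
  obtain ⟨z₀, hre, hinj⟩ := hl.exists_generic
  refine eq_zero_of_forall_tsum_mul_pow_eq_zero (w := fun r => e (pairing β r z₀)) ?_ ?_ ?_ ?_ r
  · have := (h 0).summable
    simpa [pairing] using this
  · intro r
    obtain ⟨x, hx⟩ := hre r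
    simp only [hx, norm_e_real]
  · intro r r' hrr
    obtain ⟨m, hm⟩ := e_eq_e_iff.1 hrr
    refine sub_eq_zero.1 (hinj (r - r') m ?_)
    rw [pairing_sub_left, hm]
    simp
  · intro k
    refine Eq.trans (tsum_congr fun r => ?_) (h ((k : ℂ) • z₀)).tsum_eq
    rw [pairing_smul_right, e_natCast_mul]

theorem latTerm_unique {c : ℚ ⊗[ℤ] L → ℂ} {τ : ℂ}
    (h : ∀ z, HasSum (fun r => c r * latTerm β τ z r) 0) (r : ℚ ⊗[ℤ] L) : c r = 0 := by
  have := hl.fourier_unique (a := fun r => c r * e ((quadQ β r : ℚ) * τ)) (fun z =>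
    (h z).congr_fun fun r => by rw [latTerm, e_add, mul_assoc]) r
  exact (mul_eq_zero.1 this).resolve_right (e_ne_zero _)

end IsOrthoFrame

end Frame

end LatticeJacobi

end

noncomputable section

namespace LatticeJacobi

/-! ### The orthogonal group acting on vectors and theta terms. -/

section Action

variable {L : Type*} [AddCommGroup L] {β : LinearMap.BilinForm ℤ L}

/-- The action of an automorphism of `L` on `ℂ ⊗ L`. -/
def actC (g : L ≃ₗ[ℤ] L) : ℂ ⊗[ℤ] L →ₗ[ℂ] ℂ ⊗[ℤ] L :=
  LinearMap.baseChange ℂ (g : L →ₗ[ℤ] L)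

theorem actQ_tmul (g : L ≃ₗ[ℤ] L) (a : ℚ) (x : L) : actQ g (a ⊗ₜ x) = a ⊗ₜ[ℤ] g x := rfl

theorem actC_tmul (g : L ≃ₗ[ℤ] L) (a : ℂ) (x : L) : actC g (a ⊗ₜ x) = a ⊗ₜ[ℤ] g x := rfl

theorem actQ_toRat (g : L ≃ₗ[ℤ] L) (x : L) : actQ g (toRat x) = toRat (g x) := rfl

theorem actQ_one (v : ℚ ⊗[ℤ] L) : actQ (1 : L ≃ₗ[ℤ] L) v = v := by
  induction v using TensorProduct.induction_on with
  | zero => simp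
  | tmul a x => rfl
  | add v w hv hw => rw [map_add, hv, hw]

theorem actQ_mul (g h : L ≃ₗ[ℤ] L) (v : ℚ ⊗[ℤ] L) : actQ (g * h) v = actQ g (actQ h v) := by
  induction v using TensorProduct.induction_on with
  | zero => simp
  | tmul a x => rfl
  | add v w hv hw => rw [map_add, hv, hw, map_add, map_add]

theorem actQ_inv_apply (g : L ≃ₗ[ℤ] L) (v : ℚ ⊗[ℤ] L) : actQ g⁻¹ (actQ g v) = v := by
  rw [← actQ_mul, inv_mul_cancel, actQ_one]

theorem actQ_apply_inv (g : L ≃ₗ[ℤ] L) (v : ℚ ⊗[ℤ] L) : actQ g (actQ g⁻¹ v) = v := by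
  rw [← actQ_mul, mul_inv_cancel, actQ_one]

/-- The action of an automorphism of `L` on `ℚ ⊗ L` as a permutation. -/
def actEquiv (g : L ≃ₗ[ℤ] L) : Equiv.Perm (ℚ ⊗[ℤ] L) where
  toFun := actQ g
  invFun := actQ g⁻¹
  left_inv := actQ_inv_apply g
  right_inv := actQ_apply_inv g

variable {g : L ≃ₗ[ℤ] L} (hg : g ∈ orthogonalGroup β)

include hg

theorem bilinQ_actQ (v w : ℚ ⊗[ℤ] L) : bilinQ β (actQ g v) (actQ g w) = bilinQ β v w := by
  induction v using TensorProduct.induction_on with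
  | zero => simp
  | tmul a x =>
    induction w using TensorProduct.induction_on with
    | zero => simp
    | tmul b y => rw [actQ_tmul, actQ_tmul, bilinQ_tmul, bilinQ_tmul, hg x y]
    | add v w hv hw => rw [map_add, map_add, hv, hw, map_add]
  | add v w hv hw =>
    rw [map_add, map_add, LinearMap.add_apply, hv, hw, map_add, LinearMap.add_apply]

theorem quadQ_actQ (v : ℚ ⊗[ℤ] L) : quadQ β (actQ g v) = quadQ β v := by
  rw [quadQ, bilinQ_actQ hg, quadQ]

theorem pairing_act (v : ℚ ⊗[ℤ] L) (z : ℂ ⊗[ℤ] L) :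
    pairing β (actQ g v) (actC g z) = pairing β v z := by
  induction z using TensorProduct.induction_on with
  | zero => simp [pairing]
  | tmul a x => rw [actC_tmul, pairing_tmul, pairing_tmul, ← actQ_toRat, bilinQ_actQ hg]
  | add v w hv hw => rw [map_add, pairing_add_right, hv, hw, pairing_add_right]

theorem latTerm_act (τ : ℂ) (z : ℂ ⊗[ℤ] L) (r : ℚ ⊗[ℤ] L) :
    latTerm β τ (actC g z) (actQ g r) = latTerm β τ z r := by
  rw [latTerm, latTerm, quadQ_actQ hg, pairing_act hg]

theorem actQ_mem_shadow {r : ℚ ⊗[ℤ] L} (hr : r ∈ shadow β) : actQ g r ∈ shadow β := by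
  intro x
  obtain ⟨m, hm⟩ := hr (g⁻¹ x)
  refine ⟨m, ?_⟩
  have h1 : g (g⁻¹ x) = x := by rw [← LinearEquiv.mul_apply, mul_inv_cancel]; rfl
  rw [← hm]
  conv_lhs => rw [← h1, ← actQ_toRat, quadQ_actQ hg, bilinQ_actQ hg]

theorem apply_mem_evenSublattice (hβ : β.IsSymm) {x : L} (hx : x ∈ evenSublattice β hβ) :
    g x ∈ evenSublattice β hβ := by
  change Even (β (g x) (g x))
  rw [hg]
  exact hx

end Action

/-! ### The shadow modulo L_ev. -/

section Coset

variable {L : Type*} [AddCommGroup L] {β : LinearMap.BilinForm ℤ L} (hβ : β.IsSymm)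

theorem add_toRat_mem_shadow {r : ℚ ⊗[ℤ] L} (hr : r ∈ shadow β) (x : L) :
    r + toRat x ∈ shadow β := by
  intro y
  obtain ⟨m, hm⟩ := hr y
  refine ⟨m - β x y, ?_⟩
  rw [map_add, LinearMap.add_apply, bilinQ_toRat]
  push_cast
  rw [← hm]; ring

theorem evenClass_eq_iff {r r' : ℚ ⊗[ℤ] L} :
    evenClass β hβ r = evenClass β hβ r' ↔ ∃ x ∈ evenSublattice β hβ, r' = r + toRat x := by
  rw [evenClass, evenClass, QuotientAddGroup.eq, evenSublatticeQ, AddSubgroup.mem_map]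
  refine exists_congr fun x => and_congr_right fun _ => ?_
  rw [eq_comm (a := r'), ← eq_neg_add_iff_add_eq]

-- For x in L_ev the number β(x) is an integer, so the shadow congruence reads β(r, x) ∈ ℤ. Shadow
-- vectors thus have integral inner products with an orthogonal frame.
include hβ in
theorem bilinQ_int_of_mem_shadow {x : L} (hx : Even (β x x)) {r : ℚ ⊗[ℤ] L} (hr : r ∈ shadow β) :
    ∃ m : ℤ, bilinQ β (toRat x) r = m := by
  obtain ⟨m, hm⟩ := hr x
  obtain ⟨j, hj⟩ := hx
  refine ⟨j - m, ?_⟩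
  rw [bilinQ_comm hβ]
  rw [quadQ_toRat, hj] at hm
  push_cast at hm ⊢
  rw [← hm]; ring

theorem toRat_injective (hL : IsIntegralLattice β) : Function.Injective (toRat (L := L)) := by
  refine (injective_iff_map_eq_zero _).2 fun x hx => ?_
  refine hL.nondegenerate.1 x fun y => ?_
  have := bilinQ_toRat β x y
  rw [hx, map_zero, LinearMap.zero_apply] at this
  exact_mod_cast this.symm

end Coset

/-! ### Theta expansion of functions with the elliptic law. -/

section Decomposition

variable {L : Type*} [AddCommGroup L] {β : LinearMap.BilinForm ℤ L} {n : ℕ} {l : Fin n → L}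
  {d : Fin n → ℕ} (hl : IsOrthoFrame β l d)

theorem IsOrthoFrame.mem_evenSublattice (hl : IsOrthoFrame β l d) (hβ : β.IsSymm) (i : Fin n) :
    l i ∈ evenSublattice β hβ := by
  change Even (β (l i) (l i))
  rw [hl.apply, if_pos rfl]
  exact_mod_cast hl.even i

/-- The elliptic transformation law of a Jacobi form of index `(L, β)` at a fixed `τ`. -/
def IsElliptic (β : LinearMap.BilinForm ℤ L) (τ : ℂ) (F : ℂ ⊗[ℤ] L → ℂ) : Prop :=
  ∀ (x y : L) (z : ℂ ⊗[ℤ] L), F (z + τ ⊗ₜ[ℤ] x + (1 : ℂ) ⊗ₜ[ℤ] y) =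
    e (quadQ β (toRat (x + y)) : ℚ) * e (-τ * (quadQ β (toRat x) : ℚ) - pairing β (toRat x) z) * F z

include hl in
theorem IsOrthoFrame.latTerm_congr {τ : ℂ} {F : ℂ ⊗[ℤ] L → ℂ} {c c' : ℚ ⊗[ℤ] L → ℂ}
    (h : ∀ z, HasSum (fun r => c r * latTerm β τ z r) (F z))
    (h' : ∀ z, HasSum (fun r => c' r * latTerm β τ z r) (F z)) (r : ℚ ⊗[ℤ] L) : c r = c' r := by
  refine sub_eq_zero.1 (hl.latTerm_unique (c := fun r => c r - c' r) (τ := τ) (fun z => ?_) r)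
  have := (h z).sub (h' z)
  rw [sub_self] at this
  exact this.congr_fun fun r => by ring

include hl in
/-- A function with the elliptic transformation law is a combination of products of theta
functions in the coordinates of an orthogonal frame. -/
theorem IsOrthoFrame.exists_eq_sum_prod_th [∀ i, NeZero (d i)] {τ : ℂ} (hτ : 0 < τ.im)
    {F : ℂ ⊗[ℤ] L → ℂ} (hF : ∀ z w, Differentiable ℂ fun t : ℂ => F (z + t • w))
    (hell : IsElliptic β τ F) :
    ∃ C : (∀ i, ZMod (d i)) → ℂ, ∀ z, F z = ∑ b, C b * ∏ i, th (d i) (b i) τ (coord β l d z i) := by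
  have key := exists_eq_sum_prod_of_slices (A := fun i => ZMod (d i))
    (fun i b z => th (d i) b τ z) (fun i => linearIndependent_th hτ)
    (fun ζ => F (∑ i, ζ i ⊗ₜ[ℤ] l i)) (fun i ζ => ?_)
  · obtain ⟨C, hC⟩ := key
    refine ⟨C, fun z => ?_⟩
    rw [← hC, ← hl.eq_sum_coord z]
  · obtain ⟨z₀, hupd⟩ : ∃ z₀, ∀ t, ∑ j, Function.update ζ i t j ⊗ₜ[ℤ] l j =
        z₀ + t • ((1 : ℂ) ⊗ₜ[ℤ] l i) := by
      refine ⟨∑ j, Function.update ζ i 0 j ⊗ₜ[ℤ] l j, fun t => ?_⟩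
      rw [TensorProduct.smul_tmul', smul_eq_mul, mul_one, ← Finset.add_sum_erase _ _ (Finset.mem_univ i),
        ← Finset.add_sum_erase _ _ (Finset.mem_univ i)]
      simp only [Function.update_self, TensorProduct.zero_tmul, zero_add]
      rw [add_comm]
      congr 1
      refine Finset.sum_congr rfl fun j hj => ?_
      rw [Function.update_of_ne (Finset.ne_of_mem_erase hj), Function.update_of_ne (Finset.ne_of_mem_erase hj)]
    simp only [hupd]
    -- Even length gives e(β(l_i)) = 1, so the slice satisfies the theta law of index d_i/2 without
    -- signs.
    obtain ⟨k, hk⟩ := hl.even i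
    have hq : quadQ β (toRat (l i)) = (k : ℤ) := by
      rw [quadQ_toRat, hl.apply, if_pos rfl, hk]
      push_cast; ring
    refine exists_eq_sum_th hτ (hF _ _) (fun t => ?_) (fun t => ?_)
    · have := hell 0 (l i) (z₀ + t • ((1 : ℂ) ⊗ₜ[ℤ] l i))
      rw [TensorProduct.tmul_zero, add_zero, zero_add, hq] at this
      rw [add_smul, one_smul, ← add_assoc, this]
      have h0 : pairing β (toRat (0 : L)) (z₀ + t • ((1 : ℂ) ⊗ₜ[ℤ] l i)) = 0 := by simp [pairing]
      have h1 : quadQ β (toRat (0 : L)) = 0 := by simp [quadQ]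
      rw [h0, h1, Rat.cast_intCast, e_int]
      simp
    · have := hell (l i) 0 (z₀ + t • ((1 : ℂ) ⊗ₜ[ℤ] l i))
      rw [TensorProduct.tmul_zero, add_zero, add_zero, hq] at this
      rw [add_smul, ← add_assoc]
      conv_lhs => rw [TensorProduct.smul_tmul' τ, smul_eq_mul, mul_one]
      rw [this, ← hupd, hl.pairing_frame_sum, Function.update_self, Rat.cast_intCast, e_int, one_mul]
      congr 2
      have : (d i : ℂ) = k + k := by exact_mod_cast hk
      rw [this]
      push_cast
      ring

/-- The coefficients of a function with the elliptic transformation law. -/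
theorem IsOrthoFrame.exists_coeff (hl : IsOrthoFrame β l d) (hβ : β.IsSymm) {τ : ℂ} (hτ : 0 < τ.im)
    {F : ℂ ⊗[ℤ] L → ℂ} (hF : ∀ z w, Differentiable ℂ fun t : ℂ => F (z + t • w))
    (hell : IsElliptic β τ F) :
    ∃ c : ℚ ⊗[ℤ] L → ℂ, (∀ z, HasSum (fun r => c r * latTerm β τ z r) (F z)) ∧
      (∀ r, c r ≠ 0 → r ∈ shadow β) ∧
      ∀ r, ∀ x ∈ evenSublattice β hβ, c (r + toRat x) = c r := by
  have : ∀ i, NeZero (d i) := fun i => ⟨(hl.pos i).ne'⟩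
  obtain ⟨C, hC⟩ := hl.exists_eq_sum_prod_th hτ hF hell
  -- Zero off the dual of the frame. The finer lattice L enters next, through uniqueness of
  -- coefficients.
  set c : ℚ ⊗[ℤ] L → ℂ := Function.extend (dualVec l d) (fun k => C fun i => (k i : ZMod (d i))) 0
    with hc
  have hsum : ∀ z, HasSum (fun r => c r * latTerm β τ z r) (F z) := by
    intro z
    rw [hC, ← hl.dualVec_injective.hasSum_iff]
    · refine (hl.hasSum_dualVec hτ z C).congr_fun fun k => ?_
      rw [Function.comp_apply, hc, hl.dualVec_injective.extend_apply]
    · intro r hr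
      rw [hc, Function.extend_apply' _ _ _ (by simpa using hr)]
      simp
  refine ⟨c, hsum, fun r hr x => ?_, fun r x hx => ?_⟩
  -- Translating z by x multiplies the r-th term by e(β(r, x)) and F by e(β(x)); where c(r) ≠ 0 the
  -- two must agree.
  · have h1 := hl.latTerm_congr (F := fun z => e (quadQ β (toRat x) : ℚ) * F z) (τ := τ)
      (c := fun r => e (bilinQ β r (toRat x) : ℚ) * c r)
      (c' := fun r => e (quadQ β (toRat x) : ℚ) * c r) (fun z => ?_) (fun z => ?_) r
    · have h2 := mul_right_cancel₀ hr h1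
      obtain ⟨m, hm⟩ := e_eq_e_iff.1 h2.symm
      exact ⟨m, by exact_mod_cast hm⟩
    · have h2 := hell 0 x z
      have h3 := hsum (z + τ ⊗ₜ[ℤ] (0 : L) + (1 : ℂ) ⊗ₜ[ℤ] x)
      have h0 : pairing β (toRat (0 : L)) z = 0 := by simp [pairing]
      have h00 : quadQ β (toRat (0 : L)) = 0 := by simp [quadQ]
      rw [h2, h0, h00, zero_add] at h3
      simp only [Rat.cast_zero, mul_zero, sub_zero, e_zero, mul_one] at h3
      refine h3.congr_fun fun r => ?_
      rw [TensorProduct.tmul_zero, add_zero, latTerm, latTerm, pairing_add_right, pairing_tmul,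
        one_mul, ← add_assoc, e_add _ ((bilinQ β r (toRat x) : ℚ) : ℂ)]
      ring
    · exact ((hsum z).mul_left _).congr_fun fun r => by ring
  · have hq : ∃ k : ℤ, quadQ β (toRat x) = k := by
      obtain ⟨k, hk⟩ : Even (β x x) := hx
      exact ⟨k, by rw [quadQ_toRat, hk]; push_cast; ring⟩
    obtain ⟨k, hk⟩ := hq
    -- Translating z by τx carries the term at r to the one at r + x, since β(r + x) = β(r) + β(r,
    -- x) + β(x).
    have h1 := hl.latTerm_congr (F := F) (τ := τ) (c := fun r => c (r - toRat x)) (c' := c)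
      (fun z => ?_) hsum (r + toRat x)
    · simpa using h1.symm
    · have h2 := hell x 0 z
      have h3 := hsum (z + τ ⊗ₜ[ℤ] x + (1 : ℂ) ⊗ₜ[ℤ] (0 : L))
      rw [h2, add_zero, hk, Rat.cast_intCast, e_int, one_mul] at h3
      rw [← (Equiv.addRight (toRat x)).hasSum_iff]
      have h4 := h3.mul_left (e (-τ * ((k : ℤ) : ℂ) - pairing β (toRat x) z))⁻¹
      rw [inv_mul_cancel_left₀ (e_ne_zero _)] at h4
      refine h4.congr_fun fun r => ?_
      simp only [Function.comp_apply, Equiv.coe_addRight, add_sub_cancel_right]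
      rw [← e_neg, TensorProduct.tmul_zero, add_zero, latTerm, latTerm, pairing_add_right,
        pairing_add_left, pairing_tmul, quadQ_add hβ, hk, mul_left_comm, ← e_add]
      congr 2
      push_cast
      ring

end Decomposition

end LatticeJacobi

end

noncomputable section

namespace LatticeJacobi

/-! ### The alternating theta series and its coefficients. -/

section AlternatingSeries

variable {L : Type*} [AddCommGroup L] {β : LinearMap.BilinForm ℤ L} {n N : ℕ} {l : Fin n → L}
  {d : Fin n → ℕ} {s : Fin N → ℚ ⊗[ℤ] L} {G : Subgroup (L ≃ₗ[ℤ] L)} {w : ℚ ⊗[ℤ] L}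

open Classical in
/-- The indicator function of the set `g (w + L_ev)`. -/
def cosetIndicator (β : LinearMap.BilinForm ℤ L) (hβ : β.IsSymm) (w : ℚ ⊗[ℤ] L) (g : L ≃ₗ[ℤ] L)
    (r : ℚ ⊗[ℤ] L) : ℂ :=
  if ∃ x ∈ evenSublattice β hβ, r = actQ g (w + toRat x) then 1 else 0

/-- The coefficients of the alternating theta series. -/
def alternatingCoeff (β : LinearMap.BilinForm ℤ L) (hβ : β.IsSymm) (s : Fin N → ℚ ⊗[ℤ] L)
    (G : Subgroup (L ≃ₗ[ℤ] L)) [Fintype G] (w r : ℚ ⊗[ℤ] L) : ℂ :=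
  ∑ g : G, (((sn s (g : L ≃ₗ[ℤ] L) : ℤˣ) : ℤ) : ℂ) * cosetIndicator β hβ w g r

/-- The alternating theta series. -/
def alternatingSeries (β : LinearMap.BilinForm ℤ L) (hβ : β.IsSymm) (s : Fin N → ℚ ⊗[ℤ] L)
    (G : Subgroup (L ≃ₗ[ℤ] L)) (w : ℚ ⊗[ℤ] L) (τ : UpperHalfPlane) (z : ℂ ⊗[ℤ] L) : ℂ :=
  ∑' x : evenSublattice β hβ, alternatingTerm β s G τ z (w + toRat (x : L))

theorem cosetIndicator_ne_zero {hβ : β.IsSymm} {g : L ≃ₗ[ℤ] L} {r : ℚ ⊗[ℤ] L}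
    (h : cosetIndicator β hβ w g r ≠ 0) :
    ∃ x ∈ evenSublattice β hβ, r = actQ g (w + toRat x) := by
  by_contra h0
  exact h (if_neg h0)

theorem cosetIndicator_mem_shadow {hβ : β.IsSymm} {g : L ≃ₗ[ℤ] L} (hg : g ∈ orthogonalGroup β)
    (hw : w ∈ shadow β) {r : ℚ ⊗[ℤ] L} (h : cosetIndicator β hβ w g r ≠ 0) : r ∈ shadow β := by
  obtain ⟨x, -, rfl⟩ := cosetIndicator_ne_zero h
  exact actQ_mem_shadow hg (add_toRat_mem_shadow hw x)

theorem cosetIndicator_add {hβ : β.IsSymm} {g : L ≃ₗ[ℤ] L} (hg : g ∈ orthogonalGroup β)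
    (r : ℚ ⊗[ℤ] L) {y : L} (hy : y ∈ evenSublattice β hβ) :
    cosetIndicator β hβ w g (r + toRat y) = cosetIndicator β hβ w g r := by
  have hg' : g⁻¹ ∈ orthogonalGroup β := inv_mem hg
  have key : ∀ (r : ℚ ⊗[ℤ] L) (y : L), y ∈ evenSublattice β hβ →
      (∃ x ∈ evenSublattice β hβ, r = actQ g (w + toRat x)) →
      ∃ x ∈ evenSublattice β hβ, r + toRat y = actQ g (w + toRat x) := by
    rintro r y hy ⟨x, hx, rfl⟩
    refine ⟨x + g⁻¹ y, add_mem hx (apply_mem_evenSublattice hg' hβ hy), ?_⟩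
    rw [map_add toRat, ← add_assoc, map_add (actQ g) (w + toRat x), ← actQ_toRat g⁻¹,
      actQ_apply_inv]
  rw [cosetIndicator, cosetIndicator]
  congr 1
  refine propext ⟨fun h => ?_, key r y hy⟩
  have := key _ (-y) (neg_mem hy) h
  rwa [map_neg, add_neg_cancel_right] at this

variable (hL : IsIntegralLattice β) (hG : G ≤ orthogonalGroup β)

include hL in
theorem hasSum_coset_iff {g : L ≃ₗ[ℤ] L} (f : ℚ ⊗[ℤ] L → ℂ) (a : ℂ) :
    HasSum (fun r => cosetIndicator β hL.symm w g r * f r) a ↔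
      HasSum (fun x : evenSublattice β hL.symm => f (actQ g (w + toRat (x : L)))) a := by
  have hinj : Function.Injective
      (fun x : evenSublattice β hL.symm => actQ g (w + toRat (x : L))) := by
    intro x y h
    have h1 := (actEquiv g).injective h
    exact Subtype.ext (toRat_injective hL (add_left_cancel h1))
  rw [← hinj.hasSum_iff]
  · refine iff_of_eq (congrArg (fun f => HasSum f a) (funext fun x => ?_))
    rw [Function.comp_apply, cosetIndicator, if_pos ⟨x, x.2, rfl⟩, one_mul]
  · intro r hr
    rw [cosetIndicator, if_neg, zero_mul]
    rintro ⟨x, hx, rfl⟩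
    exact hr ⟨⟨x, hx⟩, rfl⟩

include hG in
theorem alternatingTerm_eq [Fintype G] (τ : UpperHalfPlane) (z : ℂ ⊗[ℤ] L) (x : ℚ ⊗[ℤ] L) :
    alternatingTerm β s G τ z x =
      ∑ g : G, (((sn s (g : L ≃ₗ[ℤ] L) : ℤˣ) : ℤ) : ℂ) * latTerm β τ z (actQ (g : L ≃ₗ[ℤ] L) x) := by
  rw [alternatingTerm, finsum_eq_sum_of_fintype, Finset.mul_sum]
  refine Finset.sum_congr rfl fun g _ => ?_
  rw [latTerm, quadQ_actQ (hG g.2), e_add]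
  ring

variable [Fintype G]

include hG in
theorem alternatingCoeff_mem_shadow {hβ : β.IsSymm} (hw : w ∈ shadow β) {r : ℚ ⊗[ℤ] L}
    (h : alternatingCoeff β hβ s G w r ≠ 0) : r ∈ shadow β := by
  obtain ⟨g, -, hg⟩ := Finset.exists_ne_zero_of_sum_ne_zero h
  exact cosetIndicator_mem_shadow (hG g.2) hw (right_ne_zero_of_mul hg)

include hG in
theorem alternatingCoeff_add {hβ : β.IsSymm} (r : ℚ ⊗[ℤ] L) {y : L}
    (hy : y ∈ evenSublattice β hβ) :
    alternatingCoeff β hβ s G w (r + toRat y) = alternatingCoeff β hβ s G w r :=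
  Finset.sum_congr rfl fun g _ => by rw [cosetIndicator_add (hG g.2) r hy]

include hG in
/-- The theta decomposition of the alternating theta series. -/
theorem hasSum_alternatingCoeff [∀ i, NeZero (d i)] (hl : IsOrthoFrame β l d) (hw : w ∈ shadow β)
    (τ : UpperHalfPlane) (z : ℂ ⊗[ℤ] L) :
    Summable (fun x : evenSublattice β hL.symm =>
        alternatingTerm β s G τ z (w + toRat (x : L))) ∧
      HasSum (fun r => alternatingCoeff β hL.symm s G w r * latTerm β τ z r)
        (alternatingSeries β hL.symm s G w τ z) ∧
      alternatingSeries β hL.symm s G w τ z =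
        ∑ b : ∀ i, ZMod (d i), alternatingCoeff β hL.symm s G w (dualVec l d fun i => (b i).cast) *
          ∏ i, th (d i) (b i) τ (coord β l d z i) := by
  have hmem := fun i => hl.mem_evenSublattice hL.symm i
  have h1 : ∀ g : G, ∃ a, HasSum (fun r => cosetIndicator β hL.symm w g r * latTerm β τ z r) a :=
    fun g => ⟨_, hl.hasSum_of_periodic
      (fun r hr i => bilinQ_int_of_mem_shadow hL.symm (hmem i)
        (cosetIndicator_mem_shadow (hG g.2) hw hr))
      (fun r i => cosetIndicator_add (hG g.2) r (hmem i)) τ.im_pos z⟩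
  choose a ha using h1
  have h2 := hasSum_sum (s := Finset.univ) fun g _ =>
    (ha g).mul_left ((((sn s (g : L ≃ₗ[ℤ] L) : ℤˣ) : ℤ) : ℂ))
  have h3 := hasSum_sum (s := Finset.univ) fun g _ =>
    ((hasSum_coset_iff hL (latTerm β τ z) (a g)).1 (ha g)).mul_left
      ((((sn s (g : L ≃ₗ[ℤ] L) : ℤˣ) : ℤ) : ℂ))
  have h4 : HasSum (fun x : evenSublattice β hL.symm =>
      alternatingTerm β s G τ z (w + toRat (x : L)))
      (∑ g : G, (((sn s (g : L ≃ₗ[ℤ] L) : ℤˣ) : ℤ) : ℂ) * a g) :=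
    h3.congr_fun fun x => alternatingTerm_eq hG τ z _
  have h5 : HasSum (fun r => alternatingCoeff β hL.symm s G w r * latTerm β τ z r)
      (alternatingSeries β hL.symm s G w τ z) := by
    rw [alternatingSeries, h4.tsum_eq]
    refine h2.congr_fun fun r => ?_
    rw [alternatingCoeff, Finset.sum_mul]
    exact Finset.sum_congr rfl fun g _ => by ring
  refine ⟨h4.summable, h5, h5.unique (hl.hasSum_of_periodic (fun r hr i =>
    bilinQ_int_of_mem_shadow hL.symm (hmem i) (alternatingCoeff_mem_shadow hG hw hr))
      (fun r i => alternatingCoeff_add hG r (hmem i)) τ.im_pos z)⟩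

end AlternatingSeries

/-! ### Extremality leaves one function up to scalars. -/

section Extremal

variable {L : Type*} [AddCommGroup L] {β : LinearMap.BilinForm ℤ L} {n N : ℕ} {l : Fin n → L}
  {d : Fin n → ℕ} {s : Fin N → ℚ ⊗[ℤ] L} {G : Subgroup (L ≃ₗ[ℤ] L)} [Fintype G]

/-- If a function on the shadow is periodic under `L_ev`, alternating under `G`, and supported on
the orbit of `w`, then it is proportional to the coefficients of the alternating theta series. -/
theorem exists_mul_alternatingCoeff (hβ : β.IsSymm) (hG : G ≤ orthogonalGroup β)
    (w : ℚ ⊗[ℤ] L) {c : ℚ ⊗[ℤ] L → ℂ}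
    (hper : ∀ r, ∀ x ∈ evenSublattice β hβ, c (r + toRat x) = c r)
    (halt : ∀ g ∈ G, ∀ r, c (actQ g r) = (((sn s g : ℤˣ) : ℤ) : ℂ) * c r)
    (hsupp : ∀ r, c r ≠ 0 → evenClass β hβ r ∈ orbit β hβ G w) :
    ∃ a : ℂ, ∀ r, c r = a * alternatingCoeff β hβ s G w r := by
  classical
  have hcos : ∀ (g : G) r, (∃ x ∈ evenSublattice β hβ, r = actQ (g : L ≃ₗ[ℤ] L) (w + toRat x)) ↔
      evenClass β hβ (actQ (g : L ≃ₗ[ℤ] L) w) = evenClass β hβ r := by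
    intro g r
    rw [evenClass_eq_iff]
    constructor
    · rintro ⟨x, hx, rfl⟩
      exact ⟨(g : L ≃ₗ[ℤ] L) x, apply_mem_evenSublattice (hG g.2) hβ hx, by
        rw [map_add, actQ_toRat]⟩
    · rintro ⟨x, hx, rfl⟩
      refine ⟨(g : L ≃ₗ[ℤ] L)⁻¹ x, apply_mem_evenSublattice (inv_mem (hG g.2)) hβ hx, ?_⟩
      rw [map_add (actQ _), ← actQ_toRat, actQ_apply_inv]
  have hval : ∀ (g : G) r, evenClass β hβ (actQ (g : L ≃ₗ[ℤ] L) w) = evenClass β hβ r →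
      c r = (((sn s (g : L ≃ₗ[ℤ] L) : ℤˣ) : ℤ) : ℂ) * c w := by
    intro g r h
    obtain ⟨x, hx, rfl⟩ := (evenClass_eq_iff hβ).1 h
    rw [hper _ x hx, halt g g.2]
  set S : ℚ ⊗[ℤ] L → Finset G := fun r =>
    Finset.univ.filter fun g : G => evenClass β hβ (actQ (g : L ≃ₗ[ℤ] L) w) = evenClass β hβ r
    with hS
  -- Each g that carries w into the class of r contributes sn(g) c(w) = c(r); the others contribute
  -- zero.
  have hmul : ∀ r, c w * alternatingCoeff β hβ s G w r = (S r).card * c r := by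
    intro r
    rw [alternatingCoeff, Finset.mul_sum, ← nsmul_eq_mul, ← Finset.sum_const, hS,
      Finset.sum_filter]
    refine Finset.sum_congr rfl fun g _ => ?_
    by_cases h : evenClass β hβ (actQ (g : L ≃ₗ[ℤ] L) w) = evenClass β hβ r
    · rw [cosetIndicator, if_pos ((hcos g r).2 h), if_pos h, hval g r h]; ring
    · rw [cosetIndicator, if_neg (mt (hcos g r).1 h), if_neg h]; ring
  -- If g₀ carries w into the class of r, then S(r) is the left translate by g₀ of S(w), the
  -- stabilizer of the class of w.
  have hcard : ∀ r, c r ≠ 0 → (S r).card = (S w).card := by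
    intro r hr
    obtain ⟨g₀, hg₀, h0⟩ := hsupp r hr
    have htrans : ∀ (g : L ≃ₗ[ℤ] L), g ∈ G → ∀ v v' : ℚ ⊗[ℤ] L,
        evenClass β hβ v = evenClass β hβ v' →
        evenClass β hβ (actQ g v) = evenClass β hβ (actQ g v') := by
      intro g hg v v' h
      obtain ⟨x, hx, rfl⟩ := (evenClass_eq_iff hβ).1 h
      exact (evenClass_eq_iff hβ).2 ⟨g x, apply_mem_evenSublattice (hG hg) hβ hx, by
        rw [map_add, actQ_toRat]⟩
    refine Finset.card_bij' (fun g _ => (⟨g₀, hg₀⟩ : G)⁻¹ * g) (fun g _ => (⟨g₀, hg₀⟩ : G) * g)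
      ?_ ?_ (fun g _ => by simp) (fun g _ => by simp)
    · intro g hg
      simp only [hS, Finset.mem_filter, Finset.mem_univ, true_and] at hg ⊢
      rw [Subgroup.coe_mul, Subgroup.coe_inv, actQ_mul,
        htrans g₀⁻¹ (inv_mem hg₀) _ _ (hg.trans h0), actQ_inv_apply]
    · intro g hg
      simp only [hS, Finset.mem_filter, Finset.mem_univ, true_and] at hg ⊢
      rw [Subgroup.coe_mul, actQ_mul, htrans g₀ hg₀ _ _ hg, h0]
  have hpos : ((S w).card : ℂ) ≠ 0 := by
    have : (1 : G) ∈ S w := by simp [hS, actQ_one]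
    exact_mod_cast (Finset.card_pos.2 ⟨_, this⟩).ne'
  refine ⟨c w / (S w).card, fun r => ?_⟩
  rw [div_mul_eq_mul_div, hmul, eq_div_iff hpos]
  by_cases hr : c r = 0
  · rw [hr]; ring
  · rw [hcard r hr]; ring

/-- For a `G`-extremal star, a function with the elliptic transformation law that alternates
under `G` is a multiple of the alternating theta series. -/
theorem IsExtremal.exists_eq_mul_alternatingSeries (hL : IsIntegralLattice β)
    (hl : IsOrthoFrame β l d) (hG : IsExtremal β hL.symm G s) :
    ∃ w ∈ shadow β, ∀ (τ : UpperHalfPlane) (F : ℂ ⊗[ℤ] L → ℂ),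
      (∀ z v, Differentiable ℂ fun t : ℂ => F (z + t • v)) → IsElliptic β τ F →
      (∀ g ∈ G, ∀ z, F (actC g z) = (((sn s g : ℤˣ) : ℤ) : ℂ) * F z) →
      ∃ a : ℂ, ∀ z, F z = a * alternatingSeries β hL.symm s G w τ z := by
  have : ∀ i, NeZero (d i) := fun i => ⟨(hl.pos i).ne'⟩
  -- The representative w is fixed before τ and F, so one series serves for all τ.
  obtain ⟨O, ⟨⟨w, hw, hO⟩, -⟩, huniq⟩ := hG.existsUnique_orbit
  refine ⟨w, hw, fun τ F hF hell halt => ?_⟩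
  obtain ⟨c, hsum, hsupp, hper⟩ := hl.exists_coeff hL.symm τ.im_pos hF hell
  have hcalt : ∀ g ∈ G, ∀ r, c (actQ g r) = (((sn s g : ℤˣ) : ℤ) : ℂ) * c r := by
    intro g hg r
    refine hl.latTerm_congr (F := fun z => F (actC g z)) (τ := τ)
      (c := fun r => c (actQ g r)) (c' := fun r => (((sn s g : ℤˣ) : ℤ) : ℂ) * c r)
      (fun z => ?_) (fun z => ?_) r
    · have h1 := hsum (actC g z)
      rw [← (actEquiv g).hasSum_iff] at h1
      refine h1.congr_fun fun r => ?_
      change _ = c (actQ g r) * latTerm β τ (actC g z) (actQ g r)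
      rw [latTerm_act (hG.le_orthogonal hg)]
    · rw [halt g hg]
      exact ((hsum z).mul_left _).congr_fun fun r => by ring
  -- If h fixes a class in the orbit of r, then c(r') = sn(h) c(r') ≠ 0 there, whence sn(h) = 1. The
  -- orbit of r thus has the property that characterizes O.
  have horb : ∀ r, c r ≠ 0 → evenClass β hL.symm r ∈ orbit β hL.symm G w := by
    intro r hr
    have h1 : orbit β hL.symm G r = O := by
      refine huniq _ ⟨⟨r, hsupp r hr, rfl⟩, ?_⟩
      rintro r' - ⟨g, hg, h2⟩ h hh h3
      obtain ⟨x, hx, rfl⟩ := (evenClass_eq_iff hL.symm).1 h2.symm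
      set r' := actQ g r + toRat x
      have hr' : c r' ≠ 0 := by
        rw [hper _ x hx, hcalt g hg]
        exact mul_ne_zero (by exact_mod_cast (sn s g).ne_zero) hr
      obtain ⟨y, hy, h4⟩ := (evenClass_eq_iff hL.symm).1 h3.symm
      have h5 := hcalt h hh r'
      rw [h4, hper _ y hy] at h5
      have h6 : (((sn s h : ℤˣ) : ℤ) : ℂ) = 1 := mul_right_cancel₀ hr' (by rw [one_mul]; exact h5.symm)
      exact Units.ext (Int.cast_injective (α := ℂ) (by rw [h6]; simp))
    rw [← hO, ← h1]
    exact ⟨1, one_mem _, by rw [actQ_one]⟩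
  obtain ⟨a, ha⟩ := exists_mul_alternatingCoeff hL.symm hG.le_orthogonal w hper hcalt horb
  refine ⟨a, fun z => (hsum z).unique ?_⟩
  refine ((hasSum_alternatingCoeff hL hG.le_orthogonal hl hw τ z).2.1.mul_left a).congr_fun fun r => ?_
  rw [ha]; ring

end Extremal

end LatticeJacobi

end

noncomputable section

namespace LatticeJacobi

/-! ### Consequences of eutaxy. -/

section EutacticStar

variable {L : Type*} [AddCommGroup L] {β : LinearMap.BilinForm ℤ L} {N : ℕ}
  {s : Fin N → ℚ ⊗[ℤ] L}

namespace IsEutacticStar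

variable (hs : IsEutacticStar β s)

include hs

theorem bilinQ_eq_sum (x y : ℚ ⊗[ℤ] L) :
    bilinQ β x y = ∑ j, bilinQ β (s j) x * bilinQ β (s j) y := by
  conv_lhs => rw [hs.eutactic x]
  rw [map_sum, LinearMap.sum_apply]
  exact Finset.sum_congr rfl fun j _ => by rw [map_smul, LinearMap.smul_apply, smul_eq_mul]

theorem bilinQ_pos (v : ℚ ⊗[ℤ] L) (hv : v ≠ 0) : 0 < bilinQ β v v := by
  have h0 : ∀ j ∈ Finset.univ, 0 ≤ bilinQ β (s j) v * bilinQ β (s j) v := fun j _ =>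
    mul_self_nonneg _
  rw [hs.bilinQ_eq_sum]
  refine lt_of_le_of_ne (Finset.sum_nonneg h0) fun h => hv ?_
  have h1 := (Finset.sum_eq_zero_iff_of_nonneg h0).1 h.symm
  rw [hs.eutactic v]
  exact Finset.sum_eq_zero fun j hj => by rw [mul_self_eq_zero.1 (h1 j hj), zero_smul]

theorem quadQ_eq_sum (v : ℚ ⊗[ℤ] L) : quadQ β v = ∑ j, bilinQ β (s j) v ^ 2 / 2 := by
  rw [quadQ, hs.bilinQ_eq_sum, Finset.sum_div]
  exact Finset.sum_congr rfl fun j _ => by ring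

theorem quadQ_nonneg (v : ℚ ⊗[ℤ] L) : 0 ≤ quadQ β v := by
  rw [hs.quadQ_eq_sum]
  positivity

theorem bilinC_eq_sum (z z' : ℂ ⊗[ℤ] L) :
    bilinC β z z' = ∑ j, pairing β (s j) z * pairing β (s j) z' := by
  induction z using TensorProduct.induction_on with
  | zero => simp [pairing]
  | add a b ha hb =>
    rw [map_add, LinearMap.add_apply, ha, hb, ← Finset.sum_add_distrib]
    exact Finset.sum_congr rfl fun j _ => by rw [pairing_add_right]; ring
  | tmul c x =>
    induction z' using TensorProduct.induction_on with
    | zero => simp [pairing]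
    | add a b ha hb =>
      rw [map_add, ha, hb, ← Finset.sum_add_distrib]
      exact Finset.sum_congr rfl fun j _ => by rw [pairing_add_right]; ring
    | tmul c' y =>
      have h := congrArg (Rat.cast : ℚ → ℂ) (hs.bilinQ_eq_sum (toRat x) (toRat y))
      rw [bilinQ_toRat] at h
      simp only [Rat.cast_intCast, Rat.cast_sum, Rat.cast_mul] at h
      rw [bilinC_tmul, h, Finset.mul_sum]
      exact Finset.sum_congr rfl fun j _ => by rw [pairing_tmul, pairing_tmul]; ring

theorem quadC_eq_sum (z : ℂ ⊗[ℤ] L) : quadC β z = ∑ j, pairing β (s j) z ^ 2 / 2 := by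
  rw [quadC, hs.bilinC_eq_sum, Finset.sum_div]
  exact Finset.sum_congr rfl fun j _ => by ring

theorem pairing_eq_sum (r : ℚ ⊗[ℤ] L) (z : ℂ ⊗[ℤ] L) :
    pairing β r z = ∑ j, bilinQ β (s j) r * pairing β (s j) z := by
  conv_lhs => rw [hs.eutactic r]
  rw [pairing_sum_left]
  exact Finset.sum_congr rfl fun j _ => by rw [pairing_smul_left]

/-- The star spans ℚ ⊗ L. The resulting sign of n - N makes η^{n-N} harmless in lower bounds at the
cusp. -/
theorem finrank_le [Module.Free ℤ L] : Module.finrank ℤ L ≤ N := by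
  have h1 : Module.finrank ℚ (ℚ ⊗[ℤ] L) = Module.finrank ℤ L := Module.finrank_baseChange
  have h2 : Submodule.span ℚ (Set.range s) = ⊤ := by
    refine eq_top_iff.2 fun v _ => ?_
    rw [hs.eutactic v]
    exact Submodule.sum_mem _ fun j _ =>
      Submodule.smul_mem _ _ (Submodule.subset_span ⟨j, rfl⟩)
  have h3 := finrank_range_le_card (R := ℚ) s
  rw [Set.finrank, h2, finrank_top, h1, Fintype.card_fin] at h3
  exact h3

theorem ext_actQ {g h : L ≃ₗ[ℤ] L} (hgh : ∀ j, actQ g (s j) = actQ h (s j))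
    (v : ℚ ⊗[ℤ] L) : actQ g v = actQ h v := by
  rw [hs.eutactic v, map_sum, map_sum]
  exact Finset.sum_congr rfl fun j _ => by rw [map_smul, map_smul, hgh]

end IsEutacticStar

/-- Since the star spans, g is determined by its permutation and signs, of which there are finitely
many. -/
theorem finite_of_preservesUpToSigns (hL : IsIntegralLattice β) (hs : IsEutacticStar β s)
    {G : Subgroup (L ≃ₗ[ℤ] L)} (hG : ∀ g ∈ G, PreservesUpToSigns s g) : Finite G := by
  choose σ ε h using fun g : G => hG g g.2
  refine Finite.of_injective (fun g : G => (σ g, ε g)) fun g g' hgg => ?_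
  obtain ⟨h1, h2⟩ := Prod.ext_iff.1 hgg
  dsimp only at h1 h2
  refine Subtype.ext (LinearEquiv.ext fun x => toRat_injective hL ?_)
  rw [← actQ_toRat, ← actQ_toRat]
  exact hs.ext_actQ (fun j => by rw [h g j, h g' j, h1, h2]) _

end EutacticStar

/-! ### The product of the theta functions over the star. -/

section ThetaProduct

variable {L : Type*} [AddCommGroup L] {β : LinearMap.BilinForm ℤ L} {N : ℕ}
  {s : Fin N → ℚ ⊗[ℤ] L}

theorem theta_neg (τ : UpperHalfPlane) (z : ℂ) : theta τ (-z) = -theta τ z := by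
  rw [theta, theta, ← tsum_neg, ← (Equiv.neg ℤ).tsum_eq]
  refine tsum_congr fun r => ?_
  have h : ZMod.χ₄ ((-r : ℤ) : ZMod 4) = -ZMod.χ₄ (r : ZMod 4) := by
    rw [Int.cast_neg, neg_eq_neg_one_mul, map_mul]
    have : ZMod.χ₄ (-1) = -1 := by decide
    rw [this, neg_one_mul]
  rw [Equiv.neg_apply, h]
  push_cast
  rw [neg_mul]
  congr 3
  ring

theorem theta_units_mul (τ : UpperHalfPlane) (u : ℤˣ) (z : ℂ) :
    theta τ (((u : ℤ) : ℂ) * z) = ((u : ℤ) : ℂ) * theta τ z := by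
  rcases Int.units_eq_one_or u with rfl | rfl
  · simp
  · simp [theta_neg]

/-- The product `∏_j ϑ(τ, β(s_j, z))`. -/
def thetaProd (β : LinearMap.BilinForm ℤ L) (s : Fin N → ℚ ⊗[ℤ] L) (τ : UpperHalfPlane)
    (z : ℂ ⊗[ℤ] L) : ℂ :=
  ∏ j, theta τ (pairing β (s j) z)

/-- Moving g to the other side, β(s_j, gz) = β(g⁻¹s_j, z): the factors are permuted, and oddness of
ϑ releases the signs of g⁻¹. -/
theorem thetaProd_actC (hs : IsEutacticStar β s) {g : L ≃ₗ[ℤ] L} (hg : g ∈ orthogonalGroup β)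
    (hp : PreservesUpToSigns s g⁻¹) (τ : UpperHalfPlane) (z : ℂ ⊗[ℤ] L) :
    thetaProd β s τ (actC g z) = (((sn s g⁻¹ : ℤˣ) : ℤ) : ℂ) * thetaProd β s τ z := by
  obtain ⟨σ, ε, h⟩ := hp
  have h1 : ∀ j, pairing β (s j) (actC g z) = ((ε j : ℤ) : ℂ) * pairing β (s (σ j)) z := by
    intro j
    rw [← actQ_apply_inv g (s j), pairing_act hg, h j, ← Int.cast_smul_eq_zsmul ℚ,
      pairing_smul_left, Rat.cast_intCast]
  rw [sn_eq hs.ne_zero h, thetaProd, thetaProd]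
  simp only [h1, theta_units_mul]
  rw [Finset.prod_mul_distrib, Equiv.prod_comp σ fun j => theta τ (pairing β (s j) z)]
  congr 1
  push_cast
  rfl

theorem sn_inv (hs : IsEutacticStar β s) {g : L ≃ₗ[ℤ] L} (hp : PreservesUpToSigns s g) :
    PreservesUpToSigns s g⁻¹ ∧ sn s g⁻¹ = sn s g := by
  obtain ⟨σ, ε, h⟩ := hp
  have h1 : IsSignedPerm s g⁻¹ σ.symm (fun j => ε (σ.symm j)) := by
    intro j
    have h2 := congrArg (actQ g⁻¹) (h (σ.symm j))
    rw [actQ_inv_apply, σ.apply_symm_apply] at h2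
    rw [h2, map_zsmul, smul_smul]
    rcases Int.units_eq_one_or (ε (σ.symm j)) with h3 | h3 <;> simp [h3]
  exact ⟨⟨_, _, h1⟩, by rw [sn_eq hs.ne_zero h1, sn_eq hs.ne_zero h, Equiv.prod_comp σ.symm ε]⟩

theorem thetaProd_alternating (hs : IsEutacticStar β s) {g : L ≃ₗ[ℤ] L}
    (hg : g ∈ orthogonalGroup β) (hp : PreservesUpToSigns s g) (τ : UpperHalfPlane)
    (z : ℂ ⊗[ℤ] L) : thetaProd β s τ (actC g z) = (((sn s g : ℤˣ) : ℤ) : ℂ) * thetaProd β s τ z := by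
  rw [thetaProd_actC hs hg (sn_inv hs hp).1, (sn_inv hs hp).2]

/-- The numbers β(s_j, x) are integers as s_j ∈ L^♯, so each factor obeys its own lattice law;
eutaxy sums the exponents to β(x), β(x, z) and β(x + y). -/
theorem thetaProd_elliptic (hs : IsEutacticStar β s) (τ : UpperHalfPlane) :
    IsElliptic β τ (thetaProd β s τ) := by
  intro x y z
  choose a ha using fun j => hs.mem_dual j x
  choose b hb using fun j => hs.mem_dual j y
  have h1 : ∀ j, theta τ (pairing β (s j) (z + (τ : ℂ) ⊗ₜ[ℤ] x + (1 : ℂ) ⊗ₜ[ℤ] y)) =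
      e ((a j + b j : ℂ) ^ 2 / 2) * e (-((a j : ℂ) ^ 2 / 2 * τ) - a j * pairing β (s j) z) *
        theta τ (pairing β (s j) z) := by
    intro j
    rw [← theta_add_lattice, pairing_add_right, pairing_add_right, pairing_tmul, pairing_tmul,
      ha, hb, one_mul, Rat.cast_intCast, Rat.cast_intCast, mul_comm]
  rw [thetaProd, thetaProd, Finset.prod_congr rfl fun j _ => h1 j, Finset.prod_mul_distrib,
    Finset.prod_mul_distrib, ← e_sum, ← e_sum]
  congr 3
  · rw [hs.quadQ_eq_sum, Rat.cast_sum]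
    refine Finset.sum_congr rfl fun j _ => ?_
    rw [map_add, map_add, ha, hb]
    push_cast
    ring
  · rw [hs.quadQ_eq_sum, hs.pairing_eq_sum, Rat.cast_sum, Finset.mul_sum, ← Finset.sum_sub_distrib]
    refine Finset.sum_congr rfl fun j _ => ?_
    rw [ha]
    push_cast
    ring

theorem thetaProd_differentiable (τ : UpperHalfPlane) (z v : ℂ ⊗[ℤ] L) :
    Differentiable ℂ fun t : ℂ => thetaProd β s τ (z + t • v) := by
  simp only [thetaProd, pairing_add_right, pairing_smul_right]
  refine Differentiable.fun_finsetProd fun j _ => ?_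
  exact (theta_differentiable τ).comp (by fun_prop)

theorem thetaProd_differentiableAt {m : ℕ} (b : Fin m → L) {τ : ℂ} (hτ : 0 < τ.im)
    (ζ : Fin m → ℂ) :
    DifferentiableAt ℂ (fun p : ℂ × (Fin m → ℂ) =>
      thetaProd β s (ofComplex p.1) (∑ i, p.2 i ⊗ₜ[ℤ] b i)) (τ, ζ) := by
  classical
  have h : ∀ j, DifferentiableAt ℂ (fun p : ℂ × (Fin m → ℂ) => theta (ofComplex p.1)
      (∑ i, p.2 i * ((bilinQ β (s j) (toRat (b i)) : ℚ) : ℂ))) (τ, ζ) := fun j =>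
    (theta_differentiableAt hτ _).comp (τ, ζ) (f := fun p : ℂ × (Fin m → ℂ) =>
      (p.1, ∑ i, p.2 i * ((bilinQ β (s j) (toRat (b i)) : ℚ) : ℂ))) (by fun_prop)
  simp only [thetaProd, pairing_sum_right, pairing_tmul]
  exact (HasFDerivAt.finsetProd fun j _ => (h j).hasFDerivAt).differentiableAt

theorem thetaProd_modular (hs : IsEutacticStar β s) (A : Matrix.SpecialLinearGroup (Fin 2) ℤ)
    (τ : UpperHalfPlane) (z : ℂ ⊗[ℤ] L) :
    thetaProd β s (A • τ) ((autFactor A τ)⁻¹ • z) =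
      e (((A 1 0 : ℤ) : ℂ) * quadC β z / autFactor A τ) * (autFactor A τ)⁻¹ ^ N *
        etaCocycle 3 A τ ^ N * thetaProd β s τ z := by
  simp only [thetaProd, pairing_smul_right, theta_modular, Finset.prod_mul_distrib,
    Finset.prod_const, Finset.card_univ, Fintype.card_fin, ← e_sum]
  congr 4
  rw [hs.quadC_eq_sum, mul_div_right_comm, Finset.mul_sum]

/-- On the line through a generic z₀ no β(s_j, ·) vanishes identically, so each factor has isolated
zeros and a small t avoids all of them. -/
theorem thetaProd_ne_zero (hs : IsEutacticStar β s) {z₀ : ℂ ⊗[ℤ] L}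
    (hz₀ : ∀ r, ∀ q : ℚ, pairing β r z₀ = q → r = 0) (τ : UpperHalfPlane) :
    ∃ t : ℂ, thetaProd β s τ (t • z₀) ≠ 0 := by
  have h : ∀ᶠ t in nhdsWithin (0 : ℂ) {0}ᶜ, ∀ j, theta τ (0 + t * pairing β (s j) z₀) ≠ 0 := by
    refine Filter.eventually_all.2 fun j => theta_eventually_ne_zero τ (fun h => ?_) _ _
    exact hs.ne_zero j (hz₀ (s j) 0 (by rw [h, Rat.cast_zero]))
  obtain ⟨t, ht⟩ := h.exists
  refine ⟨t, Finset.prod_ne_zero_iff.2 fun j _ => ?_⟩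
  rw [pairing_smul_right, ← zero_add (t * _)]
  exact ht j

theorem thetaProd_add_one (τ τ' : UpperHalfPlane) (hτ' : (τ' : ℂ) = τ + 1) (z : ℂ ⊗[ℤ] L) :
    thetaProd β s τ' z = e (1 / 8) ^ N * thetaProd β s τ z := by
  simp only [thetaProd, theta_add_one τ τ' hτ', Finset.prod_mul_distrib,
    Finset.prod_const, Finset.card_univ, Fintype.card_fin]

theorem thetaProd_neg_one_div (hs : IsEutacticStar β s) (τ τ' : UpperHalfPlane)
    (hτ' : (τ' : ℂ) = -1 / τ) (z : ℂ ⊗[ℤ] L) :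
    thetaProd β s τ' ((τ : ℂ)⁻¹ • z) = e (quadC β z / τ) *
      (-Complex.I * (-Complex.I * (τ : ℂ)) ^ (1 / 2 : ℂ)) ^ N * thetaProd β s τ z := by
  simp only [thetaProd, pairing_smul_right, inv_mul_eq_div, theta_neg_one_div τ τ' hτ',
    Finset.prod_mul_distrib,
    Finset.prod_const, Finset.card_univ, Fintype.card_fin, ← e_sum]
  rw [mul_pow]
  congr 3
  rw [hs.quadC_eq_sum, Finset.sum_div]
  exact Finset.sum_congr rfl fun j _ => by ring

/-- The inverse of the product of theta functions at a generic real point grows at most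
exponentially at the cusp. -/
theorem exists_le_norm_thetaProd (hs : IsEutacticStar β s) {z₀ : ℂ ⊗[ℤ] L}
    (hz₀ : ∀ r, ∀ q : ℚ, pairing β r z₀ = q → r = 0) :
    ∃ c > 0, ∀ᶠ τ : UpperHalfPlane in UpperHalfPlane.atImInfty,
      c * Real.exp (-(N * (Real.pi / 4) * τ.im)) ≤ ‖thetaProd β s τ z₀‖ := by
  choose c hc h using fun j => exists_le_norm_theta (z := pairing β (s j) z₀) fun m hm =>
    hs.ne_zero j (hz₀ (s j) m (by rw [hm, Rat.cast_intCast]))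
  refine ⟨∏ j, c j, Finset.prod_pos fun j _ => hc j, ?_⟩
  filter_upwards [Filter.eventually_all.2 h] with τ hτ
  have h1 : Real.exp (-(N * (Real.pi / 4) * τ.im)) =
      ∏ _j : Fin N, Real.exp (-(Real.pi / 4 * τ.im)) := by
    rw [Finset.prod_const, Finset.card_univ, Fintype.card_fin, ← Real.exp_nat_mul]
    congr 1; ring
  rw [h1, ← Finset.prod_mul_distrib, thetaProd, norm_prod]
  exact Finset.prod_le_prod (fun j _ => mul_nonneg (hc j).le (Real.exp_pos _).le) fun j _ => hτ j

end ThetaProduct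

end LatticeJacobi

end

noncomputable section

namespace LatticeJacobi

/-! ### Coefficient families of theta products under inversion. -/

section ThetaSum

open Complex

variable {L : Type*} [AddCommGroup L] {β : LinearMap.BilinForm ℤ L} {n : ℕ} {l : Fin n → L}
  {d : Fin n → ℕ} [∀ i, NeZero (d i)]

/-- A linear combination of products of theta functions in the coordinates of an orthogonal
frame. -/
def thetaSum (β : LinearMap.BilinForm ℤ L) (l : Fin n → L) (d : Fin n → ℕ) [∀ i, NeZero (d i)]
    (C : (∀ i, ZMod (d i)) → ℂ) (τ : ℂ) (z : ℂ ⊗[ℤ] L) : ℂ :=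
  ∑ b, C b * ∏ i, th (d i) (b i) τ (coord β l d z i)

theorem thetaSum_differentiableAt (C : (∀ i, ZMod (d i)) → ℂ) {τ : ℂ} (hτ : 0 < τ.im)
    (z : ℂ ⊗[ℤ] L) : DifferentiableAt ℂ (fun τ => thetaSum β l d C τ z) τ := by
  refine DifferentiableAt.fun_sum fun b _ => DifferentiableAt.const_mul ?_ _
  refine DifferentiableAt.fun_finsetProd fun i _ => ?_
  exact (th_differentiableAt (b i) hτ (coord β l d z i)).comp τ
    (f := fun τ => (τ, coord β l d z i)) (by fun_prop)

theorem IsOrthoFrame.thetaSum_injective (hl : IsOrthoFrame β l d) {τ : ℂ} (hτ : 0 < τ.im)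
    {C C' : (∀ i, ZMod (d i)) → ℂ} (h : ∀ z, thetaSum β l d C τ z = thetaSum β l d C' τ z) :
    C = C' := by
  have hsum : ∀ (C : (∀ i, ZMod (d i)) → ℂ) (z : ℂ ⊗[ℤ] L), HasSum
      (fun r => Function.extend (dualVec l d) (fun k => C fun i => (k i : ZMod (d i))) 0 r *
        latTerm β τ z r) (thetaSum β l d C τ z) := by
    intro C z
    rw [← hl.dualVec_injective.hasSum_iff]
    · refine (hl.hasSum_dualVec hτ z C).congr_fun fun k => ?_
      rw [Function.comp_apply, hl.dualVec_injective.extend_apply]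
    · intro r hr
      rw [Function.extend_apply' _ _ _ (by simpa using hr)]
      simp
  ext b
  have h1 := hl.latTerm_congr (fun z => hsum C z) (fun z => by rw [h]; exact hsum C' z)
    (dualVec l d fun i => (b i).cast)
  rw [hl.dualVec_injective.extend_apply, hl.dualVec_injective.extend_apply] at h1
  simpa using h1

/-- The transformation of the span of the theta functions under `τ ↦ -1/τ`. -/
theorem IsOrthoFrame.exists_thetaSum_inversion (hl : IsOrthoFrame β l d)
    (C : (∀ i, ZMod (d i)) → ℂ) :
    ∃ D : (∀ i, ZMod (d i)) → ℂ, ∀ (τ : ℂ) (z : ℂ ⊗[ℤ] L), 0 < τ.im →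
      thetaSum β l d C (-1 / τ) (τ⁻¹ • z) =
        ((-I * τ) ^ (1 / 2 : ℂ)) ^ n * e (quadC β z / τ) * thetaSum β l d D τ z := by
  choose M hM using fun i => exists_th_inversion (d i)
  -- The tensor product of the one-variable inversion matrices applied to C; it involves neither τ
  -- nor z.
  refine ⟨fun b => ∑ a, C a * ∏ i, M i (a i) (b i), fun τ z hτ => ?_⟩
  have hc : ∀ i, coord β l d (τ⁻¹ • z) i = coord β l d z i / τ := fun i => by
    rw [coord, coord, pairing_smul_right]; ring
  have hq : e (quadC β z / τ) = ∏ i, e (d i * coord β l d z i ^ 2 / (2 * τ)) := by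
    rw [hl.quadC_eq, ← e_sum, Finset.sum_div]
    congr 1
    exact Finset.sum_congr rfl fun i _ => by ring
  have hp : ∀ a : ∀ i, ZMod (d i), ∏ i, th (d i) (a i) (-1 / τ) (coord β l d (τ⁻¹ • z) i) =
      ((-I * τ) ^ (1 / 2 : ℂ)) ^ n * e (quadC β z / τ) *
        ∑ b : ∀ i, ZMod (d i), (∏ i, M i (a i) (b i)) * ∏ i, th (d i) (b i) τ (coord β l d z i) := by
    intro a
    simp only [hc, hM _ _ τ _ hτ, Finset.prod_mul_distrib, ← hq, Finset.prod_const,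
      Finset.card_univ, Fintype.card_fin, Finset.prod_univ_sum, Fintype.piFinset_univ]
  simp only [thetaSum, hp, Finset.sum_mul, Finset.mul_sum]
  rw [Finset.sum_comm]
  refine Finset.sum_congr rfl fun b _ => Finset.sum_congr rfl fun a _ => by ring

end ThetaSum

/-! ### Translation by one and boundedness of the alternating series. -/

section AlternatingSeries

variable {L : Type*} [AddCommGroup L] {β : LinearMap.BilinForm ℤ L} {n N : ℕ} {l : Fin n → L}
  {d : Fin n → ℕ} {s : Fin N → ℚ ⊗[ℤ] L} {G : Subgroup (L ≃ₗ[ℤ] L)} {w : ℚ ⊗[ℤ] L} [Fintype G]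

theorem quadQ_of_alternatingCoeff_ne_zero {hβ : β.IsSymm} (hG : G ≤ orthogonalGroup β)
    (hw : w ∈ shadow β) {r : ℚ ⊗[ℤ] L} (h : alternatingCoeff β hβ s G w r ≠ 0) :
    ∃ m : ℤ, quadQ β r = quadQ β w + m := by
  obtain ⟨g, -, hg⟩ := Finset.exists_ne_zero_of_sum_ne_zero h
  obtain ⟨x, hx, rfl⟩ := cosetIndicator_ne_zero (right_ne_zero_of_mul hg)
  obtain ⟨m, hm⟩ := bilinQ_int_of_mem_shadow hβ hx hw
  obtain ⟨k, hk⟩ : Even (β x x) := hx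
  refine ⟨m + k, ?_⟩
  rw [quadQ_actQ (hG g.2), quadQ_add hβ, bilinQ_comm hβ, hm, quadQ_toRat, hk]
  push_cast
  ring

theorem alternatingSeries_add_one [∀ i, NeZero (d i)] (hL : IsIntegralLattice β)
    (hG : G ≤ orthogonalGroup β) (hl : IsOrthoFrame β l d) (hw : w ∈ shadow β)
    (τ τ' : UpperHalfPlane) (hτ' : (τ' : ℂ) = τ + 1) (z : ℂ ⊗[ℤ] L) :
    alternatingSeries β hL.symm s G w τ' z =
      e (quadQ β w : ℚ) * alternatingSeries β hL.symm s G w τ z := by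
  refine (hasSum_alternatingCoeff hL hG hl hw τ' z).2.1.unique
    (((hasSum_alternatingCoeff hL hG hl hw τ z).2.1.mul_left _).congr_fun fun r => ?_)
  by_cases h : alternatingCoeff β hL.symm s G w r = 0
  · simp [h]
  · obtain ⟨m, hm⟩ := quadQ_of_alternatingCoeff_ne_zero hG hw h
    have h1 : e ((quadQ β r : ℚ) * (1 : ℂ)) = e (quadQ β w : ℚ) := by
      rw [mul_one, hm, Rat.cast_add, Rat.cast_intCast, e_add_int]
    rw [latTerm, latTerm, hτ', mul_add, add_right_comm, e_add, h1]
    ring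

/-- At a real point the r-th theta term has modulus exp(-2πβ(r) Im τ), and β(r) ≥ 0, so the terms at
τ = i dominate. -/
theorem exists_norm_alternatingSeries_le [∀ i, NeZero (d i)] (hL : IsIntegralLattice β)
    (hs : IsEutacticStar β s) (hG : G ≤ orthogonalGroup β) (hl : IsOrthoFrame β l d)
    (hw : w ∈ shadow β) {z₀ : ℂ ⊗[ℤ] L} (hz₀ : ∀ r, ∃ x : ℝ, pairing β r z₀ = x) :
    ∃ B : ℝ, ∀ τ : UpperHalfPlane, 1 ≤ τ.im → ‖alternatingSeries β hL.symm s G w τ z₀‖ ≤ B := by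
  have h := hasSum_alternatingCoeff (s := s) hL hG hl hw
  have hnorm : ∀ (τ : UpperHalfPlane) r,
      ‖latTerm β τ z₀ r‖ = Real.exp (-(2 * Real.pi * (quadQ β r * τ.im))) := by
    intro τ r
    obtain ⟨x, hx⟩ := hz₀ r
    rw [latTerm, e_add, norm_mul, hx, norm_e_real, mul_one, norm_e, ← Complex.ofReal_ratCast,
      Complex.im_ofReal_mul]
    rfl
  have h1 := (h UpperHalfPlane.I z₀).2.1.summable.norm
  refine ⟨∑' r, ‖alternatingCoeff β hL.symm s G w r * latTerm β UpperHalfPlane.I z₀ r‖,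
    fun τ hτ => ?_⟩
  rw [← (h τ z₀).2.1.tsum_eq]
  refine tsum_of_norm_bounded h1.hasSum fun r => ?_
  rw [norm_mul, norm_mul, hnorm, hnorm]
  refine mul_le_mul_of_nonneg_left (Real.exp_le_exp.2 ?_) (norm_nonneg _)
  have h2 : (0 : ℝ) ≤ quadQ β r := by exact_mod_cast hs.quadQ_nonneg r
  rw [UpperHalfPlane.I_im]
  have h3 := mul_le_mul_of_nonneg_left hτ h2
  have := Real.pi_pos
  gcongr

end AlternatingSeries

end LatticeJacobi

end

noncomputable section

namespace LatticeJacobi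

/-! ### Transformation laws and size of the theta block. -/

section ThetaBlock

variable {L : Type*} [AddCommGroup L] {β : LinearMap.BilinForm ℤ L} {n N : ℕ}
  {s : Fin N → ℚ ⊗[ℤ] L}

/-- The theta block `η(τ)^(n-N) ∏_j ϑ(τ, β(s_j, z))`. -/
def thetaBlock (β : LinearMap.BilinForm ℤ L) (n : ℕ) (s : Fin N → ℚ ⊗[ℤ] L) (τ : UpperHalfPlane)
    (z : ℂ ⊗[ℤ] L) : ℂ :=
  ModularForm.eta (τ : ℂ) ^ ((n : ℤ) - (N : ℤ)) * ∏ j, theta τ (pairing β (s j) z)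

theorem thetaBlock_eq (τ : UpperHalfPlane) (z : ℂ ⊗[ℤ] L) :
    thetaBlock β n s τ z = ModularForm.eta (τ : ℂ) ^ ((n : ℤ) - (N : ℤ)) * thetaProd β s τ z := rfl

theorem eta_zpow_differentiableAt (m : ℤ) {τ : ℂ} (hτ : 0 < τ.im) :
    DifferentiableAt ℂ (fun τ => ModularForm.eta τ ^ m) τ :=
  DifferentiableAt.zpow (f := ModularForm.eta)
    (ModularForm.differentiableAt_eta_of_mem_upperHalfPlaneSet hτ)
    (.inl (ModularForm.eta_ne_zero hτ))

theorem isHolomorphic_thetaBlock : IsHolomorphic (thetaBlock β n s) := by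
  rintro b ⟨τ, ζ⟩ hτ
  have hτ : 0 < τ.im := hτ
  refine DifferentiableAt.differentiableWithinAt (DifferentiableAt.mul ?_ ?_)
  · have h : (fun p : ℂ × (Fin (Module.finrank ℤ L) → ℂ) =>
        ModularForm.eta ((ofComplex p.1 : UpperHalfPlane) : ℂ) ^ ((n : ℤ) - (N : ℤ))) =ᶠ[nhds (τ, ζ)]
        fun p => ModularForm.eta p.1 ^ ((n : ℤ) - (N : ℤ)) := by
      have : ∀ᶠ p : ℂ × (Fin (Module.finrank ℤ L) → ℂ) in nhds (τ, ζ), 0 < p.1.im :=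
        (Complex.continuous_im.comp continuous_fst).continuousAt.eventually (lt_mem_nhds hτ)
      filter_upwards [this] with p hp
      rw [UpperHalfPlane.ofComplex_apply_of_im_pos hp]
    refine DifferentiableAt.congr_of_eventuallyEq ?_ h
    exact (eta_zpow_differentiableAt _ hτ).comp (τ, ζ)
      (f := fun p : ℂ × (Fin (Module.finrank ℤ L) → ℂ) => p.1) (by fun_prop)
  · exact thetaProd_differentiableAt _ hτ _

/-- Each ϑ contributes the cocycle of η³ and one factor (cτ+d)⁻¹; the exponent of the η-cocycle is
(n - N) + 3N = n + 2N. -/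
theorem thetaBlock_modular (hs : IsEutacticStar β s) (A : Matrix.SpecialLinearGroup (Fin 2) ℤ)
    (τ : UpperHalfPlane) (z : ℂ ⊗[ℤ] L) :
    thetaBlock β n s (A • τ) ((autFactor A τ)⁻¹ • z) =
      e (((A 1 0 : ℤ) : ℂ) * quadC β z / autFactor A τ) * autFactor A τ ^ (-N : ℤ) *
        etaCocycle (n + 2 * N) A τ * thetaBlock β n s τ z := by
  have h1 : ModularForm.eta ((A • τ : UpperHalfPlane) : ℂ) ^ ((n : ℤ) - (N : ℤ)) *
      etaCocycle 3 A τ ^ N =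
      etaCocycle (n + 2 * N) A τ * ModularForm.eta (τ : ℂ) ^ ((n : ℤ) - (N : ℤ)) := by
    have hη := ModularForm.eta_ne_zero (im_coe_pos τ)
    have hη' := ModularForm.eta_ne_zero (im_coe_pos (A • τ))
    have h2 : (n + 2 * N : ℤ) = ((n : ℤ) - N) + 3 * N := by ring
    rw [etaCocycle, etaCocycle, div_pow, ← zpow_natCast, ← zpow_natCast, ← zpow_mul, ← zpow_mul,
      h2, zpow_add₀ hη, zpow_add₀ hη']
    have := zpow_ne_zero ((n : ℤ) - N) hη
    have := zpow_ne_zero (3 * (N : ℤ)) hη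
    field_simp
  rw [thetaBlock_eq, thetaBlock_eq, thetaProd_modular hs, zpow_neg, zpow_natCast, inv_pow]
  linear_combination (e (((A 1 0 : ℤ) : ℂ) * quadC β z / autFactor A τ) *
    (autFactor A τ ^ N)⁻¹ * thetaProd β s τ z) * h1

theorem thetaBlock_elliptic (hs : IsEutacticStar β s) (τ : UpperHalfPlane) :
    IsElliptic β τ (thetaBlock β n s τ) := fun x y z => by
  rw [thetaBlock_eq, thetaBlock_eq, thetaProd_elliptic hs]
  ring

theorem thetaBlock_differentiable (τ : UpperHalfPlane) (z v : ℂ ⊗[ℤ] L) :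
    Differentiable ℂ fun t : ℂ => thetaBlock β n s τ (z + t • v) :=
  (thetaProd_differentiable τ z v).const_mul _

theorem thetaBlock_alternating (hs : IsEutacticStar β s) {g : L ≃ₗ[ℤ] L}
    (hg : g ∈ orthogonalGroup β) (hp : PreservesUpToSigns s g) (τ : UpperHalfPlane)
    (z : ℂ ⊗[ℤ] L) :
    thetaBlock β n s τ (actC g z) = (((sn s g : ℤˣ) : ℤ) : ℂ) * thetaBlock β n s τ z := by
  rw [thetaBlock_eq, thetaBlock_eq, thetaProd_alternating hs hg hp]
  ring

theorem thetaBlock_add_one (τ τ' : UpperHalfPlane) (hτ' : (τ' : ℂ) = τ + 1) (z : ℂ ⊗[ℤ] L) :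
    thetaBlock β n s τ' z = e ((n + 2 * N : ℂ) / 24) * thetaBlock β n s τ z := by
  have h : e (1 / 24) ^ ((n : ℤ) - (N : ℤ)) * e (1 / 8) ^ N = e ((n + 2 * N : ℂ) / 24) := by
    rw [show (1 / 8 : ℂ) = (3 : ℕ) * (1 / 24) by norm_num, e_natCast_mul, ← pow_mul,
      ← zpow_natCast, ← zpow_add₀ (e_ne_zero _),
      show ((n : ℤ) - N + ((3 * N : ℕ) : ℤ)) = ((n + 2 * N : ℕ) : ℤ) by push_cast; ring,
      zpow_natCast, ← e_natCast_mul]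
    congr 1
    push_cast
    ring
  rw [thetaBlock_eq, thetaBlock_eq, thetaProd_add_one τ τ' hτ', hτ', eta_add_one, mul_zpow, ← h]
  ring

theorem thetaBlock_neg_one_div (hs : IsEutacticStar β s) (τ τ' : UpperHalfPlane)
    (hτ' : (τ' : ℂ) = -1 / τ) (z : ℂ ⊗[ℤ] L) :
    thetaBlock β n s τ' ((τ : ℂ)⁻¹ • z) =
      ((-Complex.I * (τ : ℂ)) ^ (1 / 2 : ℂ)) ^ n * e (quadC β z / τ) * (-Complex.I) ^ N *
        thetaBlock β n s τ z := by
  have hJ : (-Complex.I * (τ : ℂ)) ^ (1 / 2 : ℂ) ≠ 0 := by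
    rw [Ne, Complex.cpow_eq_zero_iff]
    exact fun h => neg_I_mul_ne_zero (im_coe_pos τ) h.1
  rw [thetaBlock_eq, thetaBlock_eq, thetaProd_neg_one_div hs τ τ' hτ', hτ',
    eta_neg_one_div (im_coe_pos τ), mul_zpow, zpow_sub₀ hJ, zpow_natCast, zpow_natCast, mul_pow]
  generalize (-Complex.I * (τ : ℂ)) ^ (1 / 2 : ℂ) = J at hJ ⊢
  field_simp

theorem thetaBlock_ne_zero (hs : IsEutacticStar β s) {z₀ : ℂ ⊗[ℤ] L}
    (hz₀ : ∀ r, ∀ q : ℚ, pairing β r z₀ = q → r = 0) (τ : UpperHalfPlane) :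
    ∃ z, thetaBlock β n s τ z ≠ 0 := by
  obtain ⟨t, ht⟩ := thetaProd_ne_zero hs hz₀ τ
  exact ⟨t • z₀, mul_ne_zero (zpow_ne_zero _ (ModularForm.eta_ne_zero (im_coe_pos τ))) ht⟩

theorem thetaBlock_differentiableAt (z : ℂ ⊗[ℤ] L) {τ : ℂ} (hτ : 0 < τ.im) :
    DifferentiableAt ℂ (fun τ => thetaBlock β n s (ofComplex τ) z) τ := by
  refine DifferentiableAt.mul ?_ (DifferentiableAt.fun_finsetProd fun j _ => ?_)
  · refine (eta_zpow_differentiableAt ((n : ℤ) - N) hτ).congr_of_eventuallyEq ?_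
    filter_upwards [Complex.continuous_im.continuousAt.eventually (lt_mem_nhds hτ)] with p hp
    rw [UpperHalfPlane.ofComplex_apply_of_im_pos hp]
  · exact (theta_differentiableAt hτ (pairing β (s j) z)).comp τ
      (f := fun τ => (τ, pairing β (s j) z)) (by fun_prop)

theorem exists_le_norm_thetaBlock (hs : IsEutacticStar β s) (hn : n ≤ N) {z₀ : ℂ ⊗[ℤ] L}
    (hz₀ : ∀ r, ∀ q : ℚ, pairing β r z₀ = q → r = 0) :
    ∃ c > 0, ∀ᶠ τ : UpperHalfPlane in UpperHalfPlane.atImInfty,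
      c * Real.exp (-(N * (Real.pi / 4) * τ.im)) ≤ ‖thetaBlock β n s τ z₀‖ := by
  obtain ⟨c, hc, h⟩ := exists_le_norm_thetaProd hs hz₀
  refine ⟨c, hc, ?_⟩
  filter_upwards [h, eventually_norm_eta_le_one] with τ h1 h2
  refine h1.trans ?_
  rw [thetaBlock_eq, norm_mul, norm_zpow]
  refine le_mul_of_one_le_left (norm_nonneg _) ?_
  rw [show ((n : ℤ) - N) = -((N - n : ℕ) : ℤ) by omega, zpow_neg, zpow_natCast]
  refine (one_le_inv₀ (pow_pos (norm_pos_iff.2 (ModularForm.eta_ne_zero (im_coe_pos τ))) _)).2 ?_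
  exact pow_le_one₀ (norm_nonneg _) h2

end ThetaBlock

/-! ### The proportionality factor is constant; Fourier expansion. -/

section Main

variable {L : Type*} [AddCommGroup L] {β : LinearMap.BilinForm ℤ L} {n N : ℕ} {l : Fin n → L}
  {d : Fin n → ℕ} {s : Fin N → ℚ ⊗[ℤ] L} {G : Subgroup (L ≃ₗ[ℤ] L)}

/-- The theta block of a `G`-extremal eutactic star is a constant multiple of an alternating theta
series. -/
theorem exists_thetaBlock_eq [Fintype G] (hL : IsIntegralLattice β) (hs : IsEutacticStar β s)
    (hG : IsExtremal β hL.symm G s) (hl : IsOrthoFrame β l d) (hn : n ≤ N) :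
    ∃ (γ : ℂ) (w : ℚ ⊗[ℤ] L), w ∈ shadow β ∧ ∀ (τ : UpperHalfPlane) (z : ℂ ⊗[ℤ] L),
      thetaBlock β n s τ z = γ * alternatingSeries β hL.symm s G w τ z := by
  have : ∀ i, NeZero (d i) := fun i => ⟨(hl.pos i).ne'⟩
  obtain ⟨w, hw, hmul⟩ := hG.exists_eq_mul_alternatingSeries hL hl
  choose f hf using fun τ => hmul τ (thetaBlock β n s τ) (thetaBlock_differentiable τ)
    (thetaBlock_elliptic hs τ)
    fun g hg => thetaBlock_alternating hs (hG.le_orthogonal hg) (hG.preserves g hg) τ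
  obtain ⟨z₀, hre, hgen⟩ := hl.exists_generic
  have hne := thetaBlock_ne_zero (n := n) hs hgen
  have hf0 : ∀ τ, f τ ≠ 0 := fun τ h => by
    obtain ⟨z, hz⟩ := hne τ
    exact hz (by rw [hf, h, zero_mul])
  set C : (∀ i, ZMod (d i)) → ℂ := fun b =>
    alternatingCoeff β hL.symm s G w (dualVec l d fun i => (b i).cast) with hC
  have hser : ∀ (τ : UpperHalfPlane) z,
      alternatingSeries β hL.symm s G w τ z = thetaSum β l d C τ z := fun τ z =>
    (hasSum_alternatingCoeff hL hG.le_orthogonal hl hw τ z).2.2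
  -- Near each τ, f is the quotient of block and series at a fixed z where both are non-zero.
  have hfd : DifferentiableOn ℂ (f ∘ ofComplex) {z | 0 < z.im} := by
    intro τ hτ
    have hτ : 0 < τ.im := hτ
    obtain ⟨z, hz⟩ := hne (ofComplex τ)
    have h1 := thetaSum_differentiableAt (β := β) (l := l) C hτ z
    have h2 : thetaSum β l d C τ z ≠ 0 := by
      have := right_ne_zero_of_mul (hf (ofComplex τ) z ▸ hz)
      rwa [hser, UpperHalfPlane.ofComplex_apply_of_im_pos hτ] at this
    have h3 := thetaBlock_differentiableAt (β := β) (n := n) (s := s) z hτ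
    refine (DifferentiableAt.congr_of_eventuallyEq (h3.div h1 h2) ?_).differentiableWithinAt
    filter_upwards [Complex.continuous_im.continuousAt.eventually (lt_mem_nhds hτ),
      h1.continuousAt.eventually_ne h2] with p hp hp2
    rw [Pi.div_apply, eq_div_iff hp2, hf, hser, Function.comp_apply]
    rw [UpperHalfPlane.ofComplex_apply_of_im_pos hp]
  have hT : ∀ τ : UpperHalfPlane, f (ModularGroup.T • τ) =
      e ((n + 2 * N : ℂ) / 24) / e (quadQ β w : ℚ) * f τ := by
    intro τ
    have hτ' : ((ModularGroup.T • τ : UpperHalfPlane) : ℂ) = τ + 1 := by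
      rw [UpperHalfPlane.modular_T_smul, UpperHalfPlane.coe_vadd]
      push_cast
      ring
    obtain ⟨z, hz⟩ := hne τ
    have h1 := thetaBlock_add_one (β := β) (n := n) (s := s) τ _ hτ' z
    rw [hf, hf, alternatingSeries_add_one hL hG.le_orthogonal hl hw τ _ hτ'] at h1
    have h2 := right_ne_zero_of_mul (hf τ z ▸ hz)
    have h3 := e_ne_zero (quadQ β w : ℚ)
    rw [div_mul_eq_mul_div, eq_div_iff h3]
    refine mul_right_cancel₀ h2 ?_
    linear_combination h1
  obtain ⟨b, hb⟩ : ∃ b, C b ≠ 0 := by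
    by_contra! h
    obtain ⟨z, hz⟩ := hne UpperHalfPlane.I
    refine hz ?_
    rw [hf, hser, thetaSum]
    simp [h]
  obtain ⟨D, hD⟩ := hl.exists_thetaSum_inversion C
  have hS : ∀ τ : UpperHalfPlane, f (ModularGroup.S • τ) = (-Complex.I) ^ N * C b / D b * f τ := by
    intro τ
    have hτ' : ((ModularGroup.S • τ : UpperHalfPlane) : ℂ) = -1 / τ := by
      rw [UpperHalfPlane.modular_S_smul, UpperHalfPlane.coe_mk, inv_neg, neg_div, one_div]
    have hJ : (-Complex.I * (τ : ℂ)) ^ (1 / 2 : ℂ) ≠ 0 := by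
      rw [Ne, Complex.cpow_eq_zero_iff]
      exact fun h => neg_I_mul_ne_zero (im_coe_pos τ) h.1
    -- After cancelling the common automorphy factor, independence of the theta products compares
    -- coefficients. At b with C_b ≠ 0 this forces D_b ≠ 0, and the ratio does not depend on τ.
    have h1 : (fun b => f (ModularGroup.S • τ) * D b) = fun b => (-Complex.I) ^ N * f τ * C b := by
      refine hl.thetaSum_injective (im_coe_pos τ) fun z => ?_
      have h2 := thetaBlock_neg_one_div (n := n) hs τ _ hτ' z
      rw [hf, hf, hser, hser, hτ', hD _ _ (im_coe_pos τ)] at h2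
      have h3 : ∀ (a : ℂ) (E : (∀ i, ZMod (d i)) → ℂ),
          thetaSum β l d (fun b => a * E b) τ z = a * thetaSum β l d E τ z := fun a E => by
        simp only [thetaSum, Finset.mul_sum, mul_assoc]
      rw [h3, h3]
      refine mul_left_cancel₀ (mul_ne_zero (pow_ne_zero n hJ) (e_ne_zero (quadC β z / τ))) ?_
      linear_combination h2
    have h2 := congrFun h1 b
    have h3 : D b ≠ 0 := fun h => by
      rw [h, mul_zero] at h2
      exact mul_ne_zero (mul_ne_zero (pow_ne_zero _ (neg_ne_zero.2 Complex.I_ne_zero)) (hf0 τ)) hb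
        h2.symm
    rw [div_mul_eq_mul_div, eq_div_iff h3, h2]
    ring
  -- At the generic real point the block is bounded below by an exponential and the series is
  -- bounded above by B; their quotient controls 1/f.
  have hbound : (fun τ : UpperHalfPlane => (f τ)⁻¹) =O[UpperHalfPlane.atImInfty]
      fun τ => Real.exp (N * (Real.pi / 4) * τ.im) := by
    obtain ⟨B, hB⟩ := exists_norm_alternatingSeries_le hL hs hG.le_orthogonal hl hw hre
    obtain ⟨c, hc, hlow⟩ := exists_le_norm_thetaBlock hs hn hgen
    have him : ∀ᶠ τ : UpperHalfPlane in UpperHalfPlane.atImInfty, 1 ≤ τ.im :=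
      (Filter.eventually_ge_atTop 1).comap _
    refine Asymptotics.IsBigO.of_bound (B / c) ?_
    filter_upwards [hlow, him] with τ h1 h2
    have h3 : 0 < ‖f τ‖ := norm_pos_iff.2 (hf0 τ)
    have h4 : c * Real.exp (-(N * (Real.pi / 4) * τ.im)) ≤ ‖f τ‖ * B := by
      refine h1.trans ?_
      rw [hf, norm_mul]
      exact mul_le_mul_of_nonneg_left (hB τ h2) h3.le
    rw [Real.exp_neg, ← div_eq_mul_inv, div_le_iff₀ (Real.exp_pos _)] at h4
    rw [Real.norm_eq_abs, Real.abs_exp, norm_inv, inv_le_iff_one_le_mul₀ h3, div_mul_eq_mul_div,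
      div_mul_eq_mul_div, one_le_div hc]
    linarith
  obtain ⟨γ, hγ⟩ := eq_const_of_multiplicative hf0 hfd hT hS hbound
  exact ⟨γ, w, hw, fun τ z => by rw [hf, hγ]⟩

/-- The Fourier expansion of the theta block of a `G`-extremal eutactic star. -/
theorem thetaBlock_fourier [Fintype G] (hL : IsIntegralLattice β) (hs : IsEutacticStar β s)
    (hG : IsExtremal β hL.symm G s) (hl : IsOrthoFrame β l d) {γ : ℂ} {w : ℚ ⊗[ℤ] L}
    (hw : w ∈ shadow β) (h : ∀ (τ : UpperHalfPlane) (z : ℂ ⊗[ℤ] L),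
      thetaBlock β n s τ z = γ * alternatingSeries β hL.symm s G w τ z) :
    ∃ c : ℚ → ℚ ⊗[ℤ] L → ℂ,
      (∀ m r, c m r ≠ 0 → (∃ j : ℤ, m = ((n : ℤ) + 2 * (N : ℤ) : ℤ) / 24 + j) ∧ r ∈ shadow β ∧
        quadQ β r ≤ m) ∧
      ∀ (τ : UpperHalfPlane) (z : ℂ ⊗[ℤ] L),
        HasSum (fun p : ℚ × (ℚ ⊗[ℤ] L) => c p.1 p.2 * e ((p.1 : ℂ) * τ) * e (pairing β p.2 z))
          (thetaBlock β n s τ z) := by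
  have : ∀ i, NeZero (d i) := fun i => ⟨(hl.pos i).ne'⟩
  -- Under τ ↦ τ + 1 the block is multiplied by e((n+2N)/24) and the series by e(β(w)); at a point
  -- where the block is non-zero these coincide.
  obtain ⟨j, hj⟩ : ∃ j : ℤ, quadQ β w = ((n : ℤ) + 2 * (N : ℤ) : ℤ) / 24 + j := by
    obtain ⟨z₀, -, hgen⟩ := hl.exists_generic
    obtain ⟨z, hz⟩ := thetaBlock_ne_zero (n := n) hs hgen UpperHalfPlane.I
    have hτ' : (((1 : ℝ) +ᵥ UpperHalfPlane.I : UpperHalfPlane) : ℂ) = UpperHalfPlane.I + 1 := by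
      rw [UpperHalfPlane.coe_vadd]
      push_cast
      ring
    have h1 := thetaBlock_add_one (β := β) (n := n) (s := s) _ _ hτ' z
    rw [h, alternatingSeries_add_one hL hG.le_orthogonal hl hw _ _ hτ', mul_left_comm, ← h] at h1
    obtain ⟨j, hj⟩ := e_eq_e_iff.1 (mul_right_cancel₀ hz h1)
    refine ⟨j, ?_⟩
    rw [sub_eq_iff_eq_add'] at hj
    have h2 : ((quadQ β w : ℚ) : ℂ) = ((((n : ℤ) + 2 * (N : ℤ) : ℤ) / 24 + j : ℚ) : ℂ) := by
      rw [hj]; push_cast; rfl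
    exact_mod_cast h2
  classical
  refine ⟨fun m r => if m = quadQ β r then γ * alternatingCoeff β hL.symm s G w r else 0,
    fun m r hmr => ?_, fun τ z => ?_⟩
  · dsimp only at hmr
    split_ifs at hmr with hm
    · have hr := right_ne_zero_of_mul hmr
      obtain ⟨k, hk⟩ := quadQ_of_alternatingCoeff_ne_zero hG.le_orthogonal hw hr
      refine ⟨⟨j + k, ?_⟩, alternatingCoeff_mem_shadow hG.le_orthogonal hw hr, hm.ge⟩
      rw [hm, hk, hj]
      push_cast
      ring
    · exact absurd rfl hmr
  · have hinj : Function.Injective fun r : ℚ ⊗[ℤ] L => (quadQ β r, r) := fun r r' hr =>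
      (Prod.ext_iff.1 hr).2
    rw [← hinj.hasSum_iff, h]
    · refine ((hasSum_alternatingCoeff hL hG.le_orthogonal hl hw τ z).2.1.mul_left γ).congr_fun
        fun r => ?_
      simp only [Function.comp_apply, if_true, latTerm, e_add]
      ring
    · rintro ⟨m, r⟩ hmr
      have : m ≠ quadQ β r := fun hm => hmr ⟨r, by rw [hm]⟩
      simp [this]

end Main

end LatticeJacobi

end

theorem mainTheorem1 {L : Type*} [AddCommGroup L] (β : LinearMap.BilinForm ℤ L)
    (hL : LatticeJacobi.IsIntegralLattice β) (n N : ℕ) (hn : Module.finrank ℤ L = n)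
    (G : Subgroup (L ≃ₗ[ℤ] L)) (s : Fin N → ℚ ⊗[ℤ] L)
    (hs : LatticeJacobi.IsEutacticStar β s)
    (hG : LatticeJacobi.IsExtremal β hL.symm G s) :
    Finite G ∧
    (∃ (γ : ℂ) (w : ℚ ⊗[ℤ] L), w ∈ LatticeJacobi.shadow β ∧
      ∀ (τ : UpperHalfPlane) (z : ℂ ⊗[ℤ] L),
        Summable (fun x : LatticeJacobi.evenSublattice β hL.symm =>
          LatticeJacobi.alternatingTerm β s G τ z (w + LatticeJacobi.toRat (x : L))) ∧
        ModularForm.eta (τ : ℂ) ^ ((n : ℤ) - (N : ℤ)) *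
            ∏ j, LatticeJacobi.theta τ (LatticeJacobi.pairing β (s j) z) =
          γ * ∑' x : LatticeJacobi.evenSublattice β hL.symm,
            LatticeJacobi.alternatingTerm β s G τ z (w + LatticeJacobi.toRat (x : L))) ∧
    LatticeJacobi.IsJacobiForm β ((n : ℚ) / 2) ((n : ℤ) + 2 * (N : ℤ))
      (fun τ z => ModularForm.eta (τ : ℂ) ^ ((n : ℤ) - (N : ℤ)) *
        ∏ j, LatticeJacobi.theta τ (LatticeJacobi.pairing β (s j) z)) := by
  have := hL.free
  have hfin : Finite G := LatticeJacobi.finite_of_preservesUpToSigns hL hs hG.preserves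
  have : Fintype G := Fintype.ofFinite G
  subst hn
  obtain ⟨l, d, hl⟩ := LatticeJacobi.exists_isOrthoFrame hL hs.bilinQ_pos
  have : ∀ i, NeZero (d i) := fun i => ⟨(hl.pos i).ne'⟩
  obtain ⟨γ, w, hw, h⟩ := LatticeJacobi.exists_thetaBlock_eq hL hs hG hl hs.finrank_le
  refine ⟨hfin, ⟨γ, w, hw, fun τ z => ⟨(LatticeJacobi.hasSum_alternatingCoeff hL hG.le_orthogonal
    hl hw τ z).1, h τ z⟩⟩, ?_⟩
  exact
    { holomorphic := LatticeJacobi.isHolomorphic_thetaBlock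
      -- The exponent is n/2 - (n + 2N)/2 = -N.
      modular := ⟨-N, by push_cast; ring, LatticeJacobi.thetaBlock_modular hs⟩
      elliptic := fun x y τ z => LatticeJacobi.thetaBlock_elliptic hs τ x y z
      fourier := LatticeJacobi.thetaBlock_fourier hL hs hG hl hw h }
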